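/- Let $d\ge 1$ be an integer, $\rho,\gamma\in(0,\infty)$ and $p\in\mathbb{N}=\{1,2,\dots\}$. Let $\xi=\{\xi(x,t): x\in\mathbb{Z}^d,\,t\ge 0\}$ be the Poisson field of independent simple random walks (ISRW) with density $\rho$: at time $0$ the sites carry independent Poisson($\rho$) numbers of particles, all particles move independently as continuous-time simple random walks on $\mathbb{Z}^d$ stepping at rate $1$ (each of the $2d$ neighbours being chosen with probability $1/2d$), and $\xi(x,t)$ is the number of particles at site $x$ at time $t$. For $\kappa\in[0,\infty)$ let $u$ be the solution of the parabolic Anderson equation $$\frac{\partial}{\partial t}u(x,t)=\kappa\sum_{y:\,\|y-x\|=1}[u(y,t)-u(x,t)]+\gamma\,\xi(x,t)\,u(x,t),\qquad u(\cdot,0)\equiv 1,$$ given by the Feynman–Kac formula $$u(x,t)=E_x\left(\exp\left[\gamma\int_0^t \xi\left(X^\kappa(s),t-s\right)ds\right]\right),$$ where $X^\kappa$ is simple random walk on $\mathbb{Z}^d$ with step rate $2d\kappa$, independent of $\xi$, and $E_x$ is expectation with respect to $X^\kappa$ given $X^\kappa(0)=x$. With $\mathbb{E}$ denoting expectation with respect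 to $\xi$, put $$\Lambda_p(t)=\frac1t\log\mathbb{E}\left([u(0,t)]^p\right)^{1/p}\quad(t>0),\qquad \lambda_p(\kappa)=\lim_{t\to\infty}\Lambda_p(t).$$ (i) For all $\kappa\in[0,\infty)$, the limit $\lambda_p(\kappa)$ exists as an extended real number (it may be $+\infty$). (ii) If $\lambda_p(0)<\infty$, then $\kappa\mapsto\lambda_p(\kappa)$ is finite, continuous, non-increasing and convex on $[0,\infty)$. -/

import Mathlib

open MeasureTheory ProbabilityTheory Filter Topology
open scoped ENNReal NNReal

noncomputable section

namespace PAM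

/-! ### Simple random walk on the lattice in continuous time -/

/-- The lattice `ℤ^d`. -/
abbrev Site (d : ℕ) : Type := Fin d → ℤ

/-- The `2d` nearest-neighbour directions: an axis together with a sign. -/
abbrev Dir (d : ℕ) : Type := Fin d × Bool

/-- The unit vector `± e_i` belonging to a direction. -/
def Dir.vec {d : ℕ} (a : Dir d) : Site d := Pi.single a.1 (if a.2 then 1 else -1)

/-- Raw randomness of one continuous-time walk: for each `n`, the `n`-th waiting time (at rate 1)
and the `n`-th direction. -/
abbrev WalkData (d : ℕ) : Type := ℕ → ℝ × Dir d

instance isProbabilityMeasure_expOne : IsProbabilityMeasure (expMeasure 1) :=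
  isProbabilityMeasure_expMeasure one_pos

/-- Law of the data of a simple random walk: the waiting times are i.i.d. exponential with mean 1,
the directions are i.i.d. uniform on the `2d` possibilities, and both sequences are independent. -/
def walkLaw (d : ℕ) [NeZero d] : Measure (WalkData d) :=
  Measure.infinitePi fun _ : ℕ =>
    (expMeasure 1).prod (PMF.uniformOfFintype (Dir d)).toMeasure

instance isProbabilityMeasure_walkLaw (d : ℕ) [NeZero d] : IsProbabilityMeasure (walkLaw d) := by
  unfold walkLaw; infer_instance

/-- Number of jumps made up to time `t` at rate 1: the number of `n` such that the sum of the first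
`n + 1` waiting times is at most `t` (almost surely finite). -/
def jumpCount {d : ℕ} (w : WalkData d) (t : ℝ) : ℕ :=
  {n : ℕ | ∑ i ∈ Finset.range (n + 1), (w i).1 ≤ t}.ncard

/-- Position at time `t` of the simple random walk which starts at the origin and jumps at total
rate `r`, i.e. at rate `r / (2d)` to each neighbour (for `r = 0` it stands still). -/
def walk {d : ℕ} (r : ℝ) (w : WalkData d) (t : ℝ) : Site d :=
  ∑ i ∈ Finset.range (jumpCount w (r * t)), (w i).2.vec

/-! ### The catalyst: a Poisson field of independent simple random walks -/

/-- Raw randomness of the catalyst: the number of particles which each site carries at time `0`, and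
the walk data of the `k`-th particle which starts at `y`, for each `(y, k)`. -/
abbrev CatalystData (d : ℕ) : Type := (Site d → ℕ) × (Site d × ℕ → WalkData d)

/-- Law of the catalyst data: initial occupation numbers i.i.d. Poisson with mean `ρ`, and all
particles moving as independent simple random walks. -/
def catalystLaw (d : ℕ) [NeZero d] (ρ : ℝ≥0) : Measure (CatalystData d) :=
  (Measure.infinitePi fun _ : Site d => poissonMeasure ρ).prod
    (Measure.infinitePi fun _ : Site d × ℕ => walkLaw d)

/-- `ξ(x,t)`: the number of catalyst particles at site `x` at time `t`; the particles step at
rate 1. -/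
def catalyst {d : ℕ} (c : CatalystData d) (x : Site d) (t : ℝ) : ℕ∞ :=
  {q : Site d × ℕ | q.2 < c.1 q.1 ∧ q.1 + walk 1 (c.2 q) t = x}.encard

/-! ### The reactant and its annealed Lyapunov exponents -/

/-- The solution of `∂u/∂t = κ Δu + γ ξ u`, `u(·,0) = 1`, for a given realisation of the catalyst,
that is `u(x,t) = E_x exp (γ ∫₀ᵗ ξ(X^κ(s), t - s) ds)`, where `X^κ` is the simple random walk with
step rate `2dκ` started at `x`. All integrands are nonnegative, so that the integrals and the
expectation are taken in `[0,∞]`. -/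
def reactant {d : ℕ} [NeZero d] (κ γ : ℝ) (c : CatalystData d) (x : Site d) (t : ℝ) : ℝ≥0∞ :=
  ∫⁻ w, EReal.exp ((ENNReal.ofReal γ *
    ∫⁻ s in Set.Icc 0 t, (catalyst c (x + walk (2 * d * κ) w s) (t - s) : ℝ≥0∞) : ℝ≥0∞) : EReal)
    ∂(walkLaw d)

/-- `Λ_p(t) = (1/t) log (E [u(0,t)^p])^(1/p)`, where `E` is the expectation over the catalyst. -/
def momentRate (d : ℕ) [NeZero d] (ρ : ℝ≥0) (γ : ℝ) (p : ℕ) (κ t : ℝ) : EReal :=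
  ((1 / t : ℝ) : EReal) *
    ENNReal.log ((∫⁻ c, reactant κ γ c 0 t ^ p ∂(catalystLaw d ρ)) ^ (1 / p : ℝ))

/-- The annealed Lyapunov exponent `λ_p(κ) = lim_{t → ∞} Λ_p(t)`, as an extended real number. (If
the limit did not exist, this would be an arbitrary value.) -/
def lyapunov (d : ℕ) [NeZero d] (ρ : ℝ≥0) (γ : ℝ) (p : ℕ) (κ : ℝ) : EReal :=
  limUnder atTop (momentRate d ρ γ p κ)

end PAM

end

/-!
The moments `E[u(0,t)^p]` are integrals over `p` independent copies of the reactant walk of an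
exponential functional of the catalyst. Because the catalyst is a Poisson system, the exponential
moment of a sum over the particles is explicit (`lintegral_expE_particleSum`). This yields
finiteness, stationarity in time, and positive correlation of increasing functionals of this type
(`lintegral_expE_particleSum_mul_le`), and it shows that the catalyst average depends on the paths
of the copies through a kernel of the form `exp (∑ …)` in the differences between the reactant paths
and the particle paths.

The main tool is a Cauchy-Schwarz inequality. A reactant of jump rate `r₁ + r₂` has the law of
`A - B` with independent walks `A`, `B` of rates `r₁`, `r₂` (`lintegral_weight_add`). In the same
way the path of a particle is a difference of two independent walks, and one of them can be
attached to `A`, the other to `B`; summing over the starting site of the particle then presents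
the catalyst average, as a function of `(A, B)`, as an integral of products `f(A) f(B)`
(`isCompletelyPositive_moment`). Hence `T(A, B)² ≤ T(A, A) T(B, B)` for the corresponding moments
(`pairMoment_sq_le`), also with the end points pinned. From this one inequality follow

* midpoint log-convexity of the moments in the jump rate (`moment_sq_le`),
* monotonicity in the jump rate: a reactant from which an arbitrary path is subtracted has smaller
  moments (`lintegral_shifted_pow_le`, `moment_add_le`),
* maximality of the return to the origin among all end points (`moment_pin_le`), so that pinning
  the reactant at the origin at time `t` costs a polynomial factor only (`moment_one_le_pin`).

The pinned moments are supermultiplicative in time (`moment_pin_mul_le`): loops can be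
concatenated, and the catalyst is stationary and positively correlated. Fekete's lemma gives the
limit, and the polynomial comparison transfers it to the unpinned moments (`tendsto_momentRate`).
The other half of the regularity in `κ` is that additional jumps of rate `h` are absent up to time
`t` with probability `exp (-h t)` (`le_moment_add`). So at every time the normalised logarithms of
the moments are nonnegative, non-increasing, `2d`-Lipschitz and midpoint convex functions of `κ`,
and all of this passes to the limit.
-/

open MeasureTheory ProbabilityTheory Filter Topology
open scoped ENNReal NNReal

noncomputable section

namespace PAM

section

variable {d : ℕ}

/-! ### The jump times of a walk -/

/-- The time of the `n`-th jump of the rate one walk. -/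
def arrival (w : WalkData d) (n : ℕ) : ℝ := ∑ i ∈ Finset.range n, (w i).1

/-- The rate one walk, `pos w t = walk 1 w t`; the walk of rate `r` is a time change of it. -/
@[irreducible] def pos (w : WalkData d) (t : ℝ) : Site d :=
  ∑ i ∈ Finset.range (jumpCount w t), (w i).2.vec

lemma walk_eq_pos (r : ℝ) (w : WalkData d) (t : ℝ) : walk r w t = pos w (r * t) := by
  rw [pos]; rfl

/-- Data without the null events: all waiting times are positive and the walk does not explode. -/
def Regular (w : WalkData d) : Prop := (∀ i, 0 < (w i).1) ∧ Tendsto (arrival w) atTop atTop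

@[simp] lemma arrival_zero (w : WalkData d) : arrival w 0 = 0 := by simp [arrival]

lemma arrival_succ (w : WalkData d) (n : ℕ) : arrival w (n + 1) = arrival w n + (w n).1 := by
  simp [arrival, Finset.sum_range_succ]

lemma arrival_strictMono {w : WalkData d} (hw : ∀ i, 0 < (w i).1) : StrictMono (arrival w) :=
  strictMono_nat_of_lt_succ fun n => by rw [arrival_succ]; linarith [hw n]

lemma jumpCount_eq {w : WalkData d} (hw : ∀ i, 0 < (w i).1) {t : ℝ} {n : ℕ}
    (h1 : arrival w n ≤ t) (h2 : t < arrival w (n + 1)) : jumpCount w t = n := by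
  have hm := arrival_strictMono hw
  have : {m : ℕ | ∑ i ∈ Finset.range (m + 1), (w i).1 ≤ t} = Set.Iio n := by
    ext m
    change arrival w (m + 1) ≤ t ↔ m < n
    constructor
    · intro h
      have := hm.lt_iff_lt.1 (h.trans_lt h2)
      omega
    · intro h
      exact (hm.monotone h).trans h1
  rw [jumpCount, this, Set.ncard_eq_toFinset_card']
  simp

lemma Regular.exists_arrival {w : WalkData d} (hw : Regular w) {t : ℝ} (ht : 0 ≤ t) :
    ∃ n, arrival w n ≤ t ∧ t < arrival w (n + 1) := by
  classical
  have hex : ∃ n, t < arrival w n := (hw.2.eventually_gt_atTop t).exists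
  have h0 : Nat.find hex ≠ 0 := by
    intro h
    have := Nat.find_spec hex
    rw [h, arrival_zero] at this
    linarith
  obtain ⟨m, hm⟩ := Nat.exists_eq_succ_of_ne_zero h0
  refine ⟨m, not_lt.1 (Nat.find_min hex (by omega)), ?_⟩
  have := Nat.find_spec hex
  rwa [hm] at this

lemma Regular.arrival_jumpCount {w : WalkData d} (hw : Regular w) {t : ℝ} (ht : 0 ≤ t) :
    arrival w (jumpCount w t) ≤ t ∧ t < arrival w (jumpCount w t + 1) := by
  obtain ⟨n, h1, h2⟩ := hw.exists_arrival ht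
  rw [jumpCount_eq hw.1 h1 h2]
  exact ⟨h1, h2⟩

lemma Regular.jumpCount_zero {w : WalkData d} (hw : Regular w) : jumpCount w 0 = 0 :=
  jumpCount_eq hw.1 (by simp) (by simpa [arrival_succ] using hw.1 0)

lemma Regular.pos_zero {w : WalkData d} (hw : Regular w) : pos w 0 = 0 := by
  simp [pos, hw.jumpCount_zero]

lemma Regular.le_jumpCount_iff {w : WalkData d} (hw : Regular w) {t : ℝ} (ht : 0 ≤ t) (n : ℕ) :
    n ≤ jumpCount w t ↔ arrival w n ≤ t := by
  obtain ⟨h1, h2⟩ := hw.arrival_jumpCount ht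
  have hm := arrival_strictMono hw.1
  constructor
  · intro h
    exact (hm.monotone h).trans h1
  · intro h
    have := hm.lt_iff_lt.1 (h.trans_lt h2)
    omega

/-! ### Measurability of the walk -/

lemma measurable_arrival (n : ℕ) : Measurable (fun w : WalkData d => arrival w n) := by
  unfold arrival; fun_prop

lemma measurable_jumpCount : Measurable (fun x : WalkData d × ℝ => jumpCount x.1 x.2) := by
  have key : (fun x : WalkData d × ℝ => jumpCount x.1 x.2) = fun x =>
      ⌊(∑' n : ℕ, Set.indicator {x : WalkData d × ℝ | arrival x.1 (n + 1) ≤ x.2}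
        (fun _ => (1 : ℝ≥0∞)) x).toReal⌋₊ := by
    funext x
    have h1 : (∑' n : ℕ, Set.indicator {x : WalkData d × ℝ | arrival x.1 (n + 1) ≤ x.2}
        (fun _ => (1 : ℝ≥0∞)) x) = ({n : ℕ | arrival x.1 (n + 1) ≤ x.2}.encard : ℝ≥0∞) := by
      rw [← ENNReal.tsum_set_one, tsum_subtype _ (fun _ => (1 : ℝ≥0∞))]
      rfl
    have h2 : ((({n : ℕ | arrival x.1 (n + 1) ≤ x.2}.encard : ℕ∞) : ℝ≥0∞)).toReal
        = (({n : ℕ | arrival x.1 (n + 1) ≤ x.2}.ncard : ℕ) : ℝ) := by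
      rw [Set.ncard]
      cases {n : ℕ | arrival x.1 (n + 1) ≤ x.2}.encard <;> simp
    -- If infinitely many jumps have occurred, both sides are `0` by convention.
    rw [h1, h2, Nat.floor_natCast]
    rfl
  rw [key]
  refine Nat.measurable_floor.comp (ENNReal.measurable_toReal.comp ?_)
  refine Measurable.tsum fun n => measurable_const.indicator ?_
  exact measurableSet_le ((measurable_arrival _).comp measurable_fst) measurable_snd

lemma measurable_pos : Measurable (fun x : WalkData d × ℝ => pos x.1 x.2) := by
  have h : Measurable (fun x : ℕ × WalkData d => ∑ i ∈ Finset.range x.1, (x.2 i).2.vec) := by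
    refine measurable_from_prod_countable_right fun n => ?_
    change Measurable fun w : WalkData d => ∑ i ∈ Finset.range n, (w i).2.vec
    have hi (i : ℕ) : Measurable fun w : WalkData d => (w i).2.vec := by
      have hv : Measurable (Dir.vec (d := d)) := measurable_of_countable _
      exact hv.comp (measurable_pi_apply i).snd
    exact Finset.measurable_fun_sum (M := Site d) (f := fun i (w : WalkData d) => (w i).2.vec) _
      fun i _ => hi i
  simp only [pos]
  exact h.comp (measurable_jumpCount.prodMk measurable_fst)

lemma measurable_walk (r : ℝ) : Measurable (fun x : WalkData d × ℝ => walk r x.1 x.2) := by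
  have h : Measurable fun x : WalkData d × ℝ => (x.1, r * x.2) := by fun_prop
  simpa only [Function.comp_def, walk_eq_pos] using measurable_pos.comp h

lemma measurable_pos_right (t : ℝ) : Measurable (fun w : WalkData d => pos w t) := by
  have h : Measurable fun w : WalkData d => (w, t) := by fun_prop
  simpa only [Function.comp_def] using measurable_pos.comp h

lemma measurable_jumpCount_right (t : ℝ) : Measurable (fun w : WalkData d => jumpCount w t) := by
  have h : Measurable fun w : WalkData d => (w, t) := by fun_prop
  simpa only [Function.comp_def] using measurable_jumpCount.comp h

/-! ### Splitting off the first step -/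

/-- The data with first step `a` and remaining data `w`. -/
def cons (a : ℝ × Dir d) (w : WalkData d) : WalkData d := fun n => Nat.casesOn n a w

@[simp] lemma cons_zero (a : ℝ × Dir d) (w : WalkData d) : cons a w 0 = a := rfl
@[simp] lemma cons_succ (a : ℝ × Dir d) (w : WalkData d) (n : ℕ) : cons a w (n + 1) = w n := rfl

lemma measurable_cons : Measurable (fun x : (ℝ × Dir d) × WalkData d => cons x.1 x.2) := by
  refine measurable_pi_iff.2 fun n => ?_
  cases n with
  | zero => exact measurable_fst
  | succ n => exact (measurable_pi_apply n).comp measurable_snd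

lemma arrival_cons (a : ℝ × Dir d) (w : WalkData d) (n : ℕ) :
    arrival (cons a w) (n + 1) = a.1 + arrival w n := by
  simp [arrival, Finset.sum_range_succ', add_comm]

/-- The law of a single step: waiting time and direction. -/
def stepLaw (d : ℕ) [NeZero d] : Measure (ℝ × Dir d) :=
  (expMeasure 1).prod (PMF.uniformOfFintype (Dir d)).toMeasure

instance (d : ℕ) [NeZero d] : IsProbabilityMeasure (stepLaw d) := by
  unfold stepLaw; infer_instance

variable [NeZero d]

lemma walkLaw_eq : walkLaw d = Measure.infinitePi fun _ : ℕ => stepLaw d := rfl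

lemma map_cons_walkLaw :
    ((stepLaw d).prod (walkLaw d)).map (fun x => cons x.1 x.2) = walkLaw d := by
  rw [walkLaw_eq]
  refine Measure.eq_infinitePi _ fun s t ht => ?_
  obtain ⟨n, hn⟩ : ∃ n, s ⊆ Finset.range (n + 1) := by
    refine ⟨s.sup id, fun i hi => ?_⟩
    have := Finset.le_sup (f := id) hi
    simp only [id] at this
    simp only [Finset.mem_range]; omega
  classical
  set t' : ℕ → Set (ℝ × Dir d) := fun i => if i ∈ s then t i else Set.univ with ht'
  have hmt' : ∀ i, MeasurableSet (t' i) := fun i => by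
    simp only [ht']; split_ifs; exacts [ht i, MeasurableSet.univ]
  have hpi : Set.pi (s : Set ℕ) t = Set.pi (Finset.range (n + 1) : Set ℕ) t' := by
    ext x
    simp only [Set.mem_pi, ht', SetLike.mem_coe]
    constructor
    · intro h i _
      split_ifs with hi
      exacts [h i hi, trivial]
    · intro h i hi
      have := h i (hn hi)
      rwa [if_pos hi] at this
  have hprod : ∏ i ∈ s, stepLaw d (t i) = ∏ i ∈ Finset.range (n + 1), stepLaw d (t' i) := by
    rw [← Finset.prod_subset hn]
    · refine Finset.prod_congr rfl fun i hi => by simp [ht', hi]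
    · intro i _ hi
      simp [ht', hi]
  rw [hpi, hprod, Measure.map_apply measurable_cons
    (MeasurableSet.pi (Finset.countable_toSet _) fun i _ => hmt' i)]
  have hpre : (fun x : (ℝ × Dir d) × WalkData d => cons x.1 x.2) ⁻¹'
      Set.pi (Finset.range (n + 1) : Set ℕ) t' =
      t' 0 ×ˢ Set.pi (Finset.range n : Set ℕ) (fun i => t' (i + 1)) := by
    ext x
    simp only [Set.mem_preimage, Set.mem_pi, Set.mem_prod, SetLike.mem_coe, Finset.mem_range]
    constructor
    · intro h
      exact ⟨h 0 (by omega), fun i hi => h (i + 1) (by omega)⟩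
    · rintro ⟨h0, h⟩ i hi
      cases i with
      | zero => exact h0
      | succ i => exact h i (by omega)
  rw [hpre, Measure.prod_prod, Measure.infinitePi_pi _ (fun i _ => hmt' _),
    Finset.prod_range_succ' _ n, mul_comm]

lemma lintegral_walkLaw_cons {f : WalkData d → ℝ≥0∞} (hf : Measurable f) :
    ∫⁻ w, f w ∂(walkLaw d) = ∫⁻ a, ∫⁻ w, f (cons a w) ∂(walkLaw d) ∂(stepLaw d) := by
  conv_lhs => rw [← map_cons_walkLaw]
  rw [lintegral_map hf measurable_cons]
  exact lintegral_prod _ (hf.comp measurable_cons).aemeasurable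

/-! ### Exponential waiting times -/

lemma lintegral_expMeasure {f : ℝ → ℝ≥0∞} (hf : Measurable f) :
    ∫⁻ x, f x ∂(expMeasure 1) = ∫⁻ x in Set.Ici 0, ENNReal.ofReal (Real.exp (-x)) * f x := by
  have h : expMeasure 1 = volume.withDensity (exponentialPDF 1) := rfl
  have hm : Measurable (exponentialPDF 1) := (measurable_exponentialPDFReal 1).ennreal_ofReal
  rw [h, lintegral_withDensity_eq_lintegral_mul _ hm hf, ← lintegral_indicator measurableSet_Ici]
  refine lintegral_congr fun x => ?_
  by_cases hx : 0 ≤ x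
  · simp [Set.indicator, hx, exponentialPDF_of_nonneg]
  · simp [Set.indicator, hx, exponentialPDF_of_neg (not_le.1 hx)]

/-- The exponential distribution has no memory. -/
lemma lintegral_expMeasure_shift {f : ℝ → ℝ≥0∞} (hf : Measurable f) {s : ℝ} (hs : 0 ≤ s) :
    ∫⁻ x, (Set.Ici s).indicator (fun x => f (x - s)) x ∂(expMeasure 1) =
      ENNReal.ofReal (Real.exp (-s)) * ∫⁻ x, f x ∂(expMeasure 1) := by
  have hm : Measurable ((Set.Ici s).indicator fun x => f (x - s)) :=
    (hf.comp (measurable_id.sub_const s)).indicator measurableSet_Ici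
  rw [lintegral_expMeasure hf, lintegral_expMeasure hm, ← lintegral_const_mul _ (by fun_prop),
    ← lintegral_indicator measurableSet_Ici, ← lintegral_indicator measurableSet_Ici,
    ← lintegral_add_right_eq_self _ s]
  refine lintegral_congr fun x => ?_
  by_cases hx : 0 ≤ x
  · have h1 : 0 ≤ x + s := by linarith
    simp only [Set.indicator, Set.mem_Ici, hx, h1, if_true, le_add_iff_nonneg_left,
      add_sub_cancel_right]
    rw [← mul_assoc, ← ENNReal.ofReal_mul (Real.exp_nonneg _), ← Real.exp_add]
    congr 3; ring
  · simp [Set.indicator, hx]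

lemma lintegral_exp_neg_expMeasure :
    ∫⁻ x, ENNReal.ofReal (Real.exp (-x)) ∂(expMeasure 1) = 2⁻¹ := by
  rw [lintegral_expMeasure (by fun_prop)]
  have h := lintegral_exponentialPDF_eq_one (r := 2) (by norm_num)
  have h2 : ∀ x, exponentialPDF 2 x = 2 * (Set.Ici (0:ℝ)).indicator
      (fun x => ENNReal.ofReal (Real.exp (-x)) * ENNReal.ofReal (Real.exp (-x))) x := by
    intro x
    by_cases hx : 0 ≤ x
    · simp only [exponentialPDF_of_nonneg hx, Set.indicator, Set.mem_Ici, hx, if_true]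
      rw [← ENNReal.ofReal_mul (Real.exp_nonneg _), ← Real.exp_add,
        ENNReal.ofReal_mul (by norm_num)]
      congr 2
      · simp
      · ring_nf
    · simp [Set.indicator, hx, exponentialPDF_of_neg (not_le.1 hx)]
  simp_rw [h2] at h
  rw [lintegral_const_mul _ (Measurable.indicator (by fun_prop) measurableSet_Ici),
    lintegral_indicator measurableSet_Ici] at h
  exact ENNReal.eq_inv_of_mul_eq_one_left (by rw [mul_comm]; exact h)

lemma ae_pos_expMeasure : ∀ᵐ x ∂(expMeasure 1), 0 < x := by
  have h : expMeasure 1 (Set.Iic 0) = 0 := by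
    rw [← lintegral_indicator_one measurableSet_Iic, lintegral_expMeasure
      (measurable_one.indicator measurableSet_Iic)]
    rw [← setLIntegral_congr (Ioi_ae_eq_Ici (a := (0:ℝ)) (μ := volume))]
    rw [setLIntegral_congr_fun measurableSet_Ioi (g := fun _ => 0)]
    · simp
    · intro x hx
      have : ¬ x ≤ 0 := not_le.2 hx
      simp [Set.indicator, this]
  rw [ae_iff]
  convert h using 2
  ext x; simp

/-- The exponential moment of the jump times, from which the tail of the number of jumps and the
absence of explosion follow. -/
lemma lintegral_exp_neg_arrival (n : ℕ) :
    ∫⁻ w, ENNReal.ofReal (Real.exp (-arrival w n)) ∂(walkLaw d) = 2⁻¹ ^ n := by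
  induction n with
  | zero => simp
  | succ n ih =>
    rw [lintegral_walkLaw_cons (by have := measurable_arrival (d := d) (n + 1); fun_prop)]
    simp_rw [arrival_cons, neg_add, Real.exp_add, ENNReal.ofReal_mul (Real.exp_nonneg _)]
    have : ∀ a : ℝ × Dir d, ∫⁻ w, ENNReal.ofReal (Real.exp (-a.1)) *
        ENNReal.ofReal (Real.exp (-arrival w n)) ∂(walkLaw d)
        = ENNReal.ofReal (Real.exp (-a.1)) * 2⁻¹ ^ n := fun a => by
      rw [lintegral_const_mul _ (by have := measurable_arrival (d := d) n; fun_prop), ih]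
    simp_rw [this]
    rw [lintegral_mul_const _ (by fun_prop), stepLaw, lintegral_prod _ (by fun_prop)]
    simp only [lintegral_const, measure_univ, mul_one]
    rw [lintegral_exp_neg_expMeasure, pow_succ, mul_comm]

lemma walkLaw_arrival_le (n : ℕ) (t : ℝ) :
    walkLaw d {w | arrival w n ≤ t} ≤ ENNReal.ofReal (Real.exp t) * 2⁻¹ ^ n := by
  have hm : Measurable fun w : WalkData d => ENNReal.ofReal (Real.exp (-arrival w n)) := by
    have := measurable_arrival (d := d) n; fun_prop
  have h := mul_meas_ge_le_lintegral (μ := walkLaw d) hm (ENNReal.ofReal (Real.exp (-t)))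
  rw [lintegral_exp_neg_arrival] at h
  have hset : {w : WalkData d | ENNReal.ofReal (Real.exp (-t)) ≤
      ENNReal.ofReal (Real.exp (-arrival w n))} = {w | arrival w n ≤ t} := by
    ext w
    simp [ENNReal.ofReal_le_ofReal_iff (Real.exp_nonneg _)]
  rw [hset] at h
  calc walkLaw d {w | arrival w n ≤ t}
      = ENNReal.ofReal (Real.exp t) * (ENNReal.ofReal (Real.exp (-t)) *
        walkLaw d {w | arrival w n ≤ t}) := by
        rw [← mul_assoc, ← ENNReal.ofReal_mul (Real.exp_nonneg _), ← Real.exp_add]; simp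
    _ ≤ _ := by gcongr

lemma ae_regular : ∀ᵐ w ∂(walkLaw d), Regular w := by
  have h1 : ∀ᵐ w ∂(walkLaw d), ∀ i, 0 < (w i).1 := by
    rw [ae_all_iff]
    intro i
    have hp := measurePreserving_eval_infinitePi (fun _ : ℕ => stepLaw d) i
    have h2 : ∀ᵐ a ∂(stepLaw d), 0 < a.1 := by
      have := (Measure.quasiMeasurePreserving_fst (μ := expMeasure 1)
        (ν := (PMF.uniformOfFintype (Dir d)).toMeasure)).ae ae_pos_expMeasure
      exact this
    exact hp.quasiMeasurePreserving.ae h2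
  have h2 : ∀ᵐ w ∂(walkLaw d), ∀ K : ℕ, ∀ᶠ n in atTop, (K : ℝ) < arrival w n := by
    rw [ae_all_iff]
    intro K
    have hs : (∑' n, walkLaw d {w | arrival w n ≤ (K : ℝ)}) ≠ ∞ := by
      refine ne_top_of_le_ne_top ?_ (ENNReal.tsum_le_tsum fun n => walkLaw_arrival_le n K)
      rw [ENNReal.tsum_mul_left, ENNReal.tsum_geometric]
      exact ENNReal.mul_ne_top ENNReal.ofReal_ne_top (by simp)
    filter_upwards [ae_eventually_notMem hs] with w hw
    filter_upwards [hw] with n hn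
    simpa using hn
  filter_upwards [h1, h2] with w hw1 hw2
  refine ⟨hw1, tendsto_atTop.2 fun b => ?_⟩
  obtain ⟨K, hK⟩ := exists_nat_ge b
  filter_upwards [hw2 K] with n hn
  exact hK.trans hn.le

end

section

variable {d : ℕ}

/-! ### The Markov property -/

/-- The data of the walk after time `s`: the first waiting time is the residual one. -/
def shift (s : ℝ) (w : WalkData d) : WalkData d := fun i =>
  if i = 0 then (arrival w (jumpCount w s + 1) - s, (w (jumpCount w s)).2)
  else w (jumpCount w s + i)

/-- The data of the walk before time `s`; the later steps are replaced by `b`. If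
the waiting time in `b` is longer than `s`, then the path up to time `s` is not affected. -/
def freeze (b : ℝ × Dir d) (s : ℝ) (w : WalkData d) : WalkData d := fun i =>
  if i < jumpCount w s then w i else b

lemma measurable_shift (s : ℝ) : Measurable (shift s : WalkData d → WalkData d) := by
  have h : Measurable (fun x : ℕ × WalkData d => (fun i : ℕ =>
      if i = 0 then (arrival x.2 (x.1 + 1) - s, (x.2 x.1).2) else x.2 (x.1 + i) :
        WalkData d)) := by
    refine measurable_from_prod_countable_right fun n => ?_
    refine measurable_pi_iff.2 fun i => ?_
    by_cases hi : i = 0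
    · simp only [hi, if_true]
      have := measurable_arrival (d := d) (n + 1)
      fun_prop
    · simp only [hi, if_false]
      fun_prop
  have h2 : Measurable fun w : WalkData d => (jumpCount w s, w) :=
    (measurable_jumpCount_right s).prodMk measurable_id
  exact h.comp h2

lemma measurable_freeze (b : ℝ × Dir d) (s : ℝ) :
    Measurable (freeze b s : WalkData d → WalkData d) := by
  have h : Measurable (fun x : ℕ × WalkData d => (fun i : ℕ =>
      if i < x.1 then x.2 i else b : WalkData d)) := by
    refine measurable_from_prod_countable_right fun n => ?_
    refine measurable_pi_iff.2 fun i => ?_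
    by_cases hi : i < n
    · simp only [hi, if_true]
      fun_prop
    · simp only [hi, if_false]
      fun_prop
  have h2 : Measurable fun w : WalkData d => (jumpCount w s, w) :=
    (measurable_jumpCount_right s).prodMk measurable_id
  exact h.comp h2

lemma arrival_shift (s : ℝ) (w : WalkData d) (n : ℕ) :
    arrival (shift s w) (n + 1) = arrival w (jumpCount w s + n + 1) - s := by
  induction n with
  | zero => simp [arrival_succ, shift]
  | succ n ih =>
    rw [arrival_succ, ih, ← add_assoc (jumpCount w s), arrival_succ w (_ + n + 1)]
    simp only [shift, Nat.add_eq_zero_iff, one_ne_zero, and_false, if_false]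
    rw [← add_assoc]; ring

lemma Regular.shift_pos {w : WalkData d} (hw : Regular w) {s : ℝ} (hs : 0 ≤ s) (i : ℕ) :
    0 < (shift s w i).1 := by
  by_cases hi : i = 0
  · simp only [shift, hi, if_true]
    linarith [(hw.arrival_jumpCount hs).2]
  · simp only [shift, hi, if_false]
    exact hw.1 _

lemma Regular.jumpCount_add {w : WalkData d} (hw : Regular w) {s u : ℝ} (hs : 0 ≤ s)
    (hu : 0 ≤ u) : jumpCount w (s + u) = jumpCount w s + jumpCount (shift s w) u := by
  obtain ⟨h1, h2⟩ := hw.arrival_jumpCount hs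
  obtain ⟨h3, h4⟩ := hw.arrival_jumpCount (add_nonneg hs hu)
  have hm := arrival_strictMono hw.1
  have hle : jumpCount w s ≤ jumpCount w (s + u) := by
    have := hm.lt_iff_lt.1 ((h1.trans (by linarith)).trans_lt h4)
    omega
  obtain ⟨n, hn⟩ := Nat.exists_eq_add_of_le hle
  rw [hn] at h3 h4 ⊢
  congr 1
  symm
  refine jumpCount_eq (hw.shift_pos hs) ?_ ?_
  · cases n with
    | zero => simpa using hu
    | succ n => rw [arrival_shift]; rw [← add_assoc] at h3; linarith
  · rw [arrival_shift]; linarith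

lemma Regular.pos_add {w : WalkData d} (hw : Regular w) {s u : ℝ} (hs : 0 ≤ s)
    (hu : 0 ≤ u) : pos w (s + u) = pos w s + pos (shift s w) u := by
  rw [pos, pos, pos, hw.jumpCount_add hs hu, Finset.sum_range_add]
  congr 1
  refine Finset.sum_congr rfl fun i _ => ?_
  by_cases hi : i = 0
  · simp [shift, hi]
  · simp [shift, hi]

lemma Regular.pos_freeze {w : WalkData d} (hw : Regular w) {s u : ℝ} (hu : 0 ≤ u)
    (hus : u ≤ s) {b : ℝ × Dir d} (hb : s < b.1) : pos (freeze b s w) u = pos w u := by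
  have hs : 0 ≤ s := hu.trans hus
  obtain ⟨h1, h2⟩ := hw.arrival_jumpCount hs
  obtain ⟨h3, h4⟩ := hw.arrival_jumpCount hu
  have hm := arrival_strictMono hw.1
  have hle : jumpCount w u ≤ jumpCount w s := by
    have := hm.lt_iff_lt.1 ((h3.trans hus).trans_lt h2)
    omega
  have hst : ∀ i < jumpCount w s, freeze b s w i = w i := fun i hi => by simp [freeze, hi]
  have harr : ∀ m ≤ jumpCount w s, arrival (freeze b s w) m = arrival w m := fun m hm =>
    Finset.sum_congr rfl fun i hi => by rw [hst i ((Finset.mem_range.1 hi).trans_le hm)]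
  have hpos : ∀ i, 0 < (freeze b s w i).1 := fun i => by
    simp only [freeze]; split_ifs
    exacts [hw.1 i, hs.trans_lt hb]
  have hcount : jumpCount (freeze b s w) u = jumpCount w u := by
    refine jumpCount_eq hpos (by rwa [harr _ hle]) ?_
    rcases hle.lt_or_eq with hlt | heq
    · rwa [harr _ hlt]
    · rw [arrival_succ, harr _ hle]
      have h0 : 0 ≤ arrival w (jumpCount w u) := by
        simpa using hm.monotone (Nat.zero_le (jumpCount w u))
      have : freeze b s w (jumpCount w u) = b := by simp [freeze, heq]
      rw [this]; linarith
  rw [pos, pos, hcount]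
  exact Finset.sum_congr rfl fun i hi => by
    rw [hst i ((Finset.mem_range.1 hi).trans_le hle)]

lemma regular_cons {a : ℝ × Dir d} {w : WalkData d} (ha : 0 < a.1) (hw : Regular w) :
    Regular (cons a w) := by
  refine ⟨fun i => ?_, ?_⟩
  · cases i
    exacts [ha, hw.1 _]
  · rw [← tendsto_add_atTop_iff_nat 1]
    simp only [arrival_cons]
    exact tendsto_atTop_add_const_left _ _ hw.2

lemma jumpCount_cons_of_le {a : ℝ × Dir d} {w : WalkData d} (ha : 0 < a.1) (hw : Regular w)
    {s : ℝ} (h : a.1 ≤ s) : jumpCount (cons a w) s = jumpCount w (s - a.1) + 1 := by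
  obtain ⟨h1, h2⟩ := hw.arrival_jumpCount (sub_nonneg.2 h)
  refine jumpCount_eq (regular_cons ha hw).1 ?_ ?_
  · rw [arrival_cons]; linarith
  · rw [arrival_cons]; linarith

lemma jumpCount_cons_of_lt {a : ℝ × Dir d} {w : WalkData d} (ha : 0 < a.1) (hw : Regular w)
    {s : ℝ} (hs : 0 ≤ s) (h : s < a.1) : jumpCount (cons a w) s = 0 :=
  jumpCount_eq (regular_cons ha hw).1 (by simpa using hs) (by simpa [arrival_cons] using h)

lemma shift_cons_of_le {a : ℝ × Dir d} {w : WalkData d} (ha : 0 < a.1) (hw : Regular w)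
    {s : ℝ} (h : a.1 ≤ s) : shift s (cons a w) = shift (s - a.1) w := by
  funext i
  simp only [shift, jumpCount_cons_of_le ha hw h, arrival_cons, cons_succ]
  split_ifs
  · congr 1; ring
  · rw [add_right_comm, cons_succ]

lemma freeze_cons_of_le {a : ℝ × Dir d} {w : WalkData d} (ha : 0 < a.1) (hw : Regular w)
    (b : ℝ × Dir d) {s : ℝ} (h : a.1 ≤ s) :
    freeze b s (cons a w) = cons a (freeze b (s - a.1) w) := by
  funext i
  cases i with
  | zero => simp [freeze, jumpCount_cons_of_le ha hw h]
  | succ i => simp [freeze, jumpCount_cons_of_le ha hw h]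

lemma shift_cons_of_lt {a : ℝ × Dir d} {w : WalkData d} (ha : 0 < a.1) (hw : Regular w)
    {s : ℝ} (hs : 0 ≤ s) (h : s < a.1) : shift s (cons a w) = cons (a.1 - s, a.2) w := by
  funext i
  cases i with
  | zero => simp [shift, jumpCount_cons_of_lt ha hw hs h, arrival_cons]
  | succ i => simp [shift, jumpCount_cons_of_lt ha hw hs h]

lemma freeze_cons_of_lt {a : ℝ × Dir d} {w : WalkData d} (ha : 0 < a.1) (hw : Regular w)
    (b : ℝ × Dir d) {s : ℝ} (hs : 0 ≤ s) (h : s < a.1) : freeze b s (cons a w) = fun _ => b := by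
  funext i
  simp [freeze, jumpCount_cons_of_lt ha hw hs h]

/-- The data of the reflected walk. -/
def flip (w : WalkData d) : WalkData d := fun i => ((w i).1, ((w i).2.1, !(w i).2.2))

lemma pos_flip (w : WalkData d) (t : ℝ) : pos (flip w) t = -pos w t := by
  have h1 : jumpCount (flip w) t = jumpCount w t := rfl
  rw [pos, pos, h1, ← Finset.sum_neg_distrib]
  refine Finset.sum_congr rfl fun i _ => ?_
  rcases h : (w i).2 with ⟨j, b⟩
  cases b <;> simp [flip, Dir.vec, h, ← Pi.single_neg]

lemma measurable_flip : Measurable (flip : WalkData d → WalkData d) := by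
  refine measurable_pi_iff.2 fun i => ?_
  have h1 : Measurable fun a : Dir d => (a.1, !a.2) := measurable_of_countable _
  have h2 : Measurable fun w : WalkData d => w i := measurable_pi_apply i
  exact h2.fst.prodMk (h1.comp h2.snd)

lemma ae_ne_expMeasure (s : ℝ) : ∀ᵐ x ∂(expMeasure 1), x ≠ s := by
  have hac : expMeasure 1 ≪ volume := withDensity_absolutelyContinuous _ _
  exact hac.ae_le (compl_mem_ae_iff.2 (measure_singleton s))

variable [NeZero d]

lemma ae_stepLaw_pos : ∀ᵐ a ∂(stepLaw d), 0 < a.1 :=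
  (Measure.quasiMeasurePreserving_fst (μ := expMeasure 1)
    (ν := (PMF.uniformOfFintype (Dir d)).toMeasure)).ae ae_pos_expMeasure

/-- The step law has no memory. -/
lemma lintegral_stepLaw_shift {f : ℝ × Dir d → ℝ≥0∞} (hf : Measurable f) {s : ℝ} (hs : 0 ≤ s) :
    ∫⁻ a, {a : ℝ × Dir d | s < a.1}.indicator (fun a => f (a.1 - s, a.2)) a ∂(stepLaw d) =
      stepLaw d {a | s < a.1} * ∫⁻ a, f a ∂(stepLaw d) := by
  have main : ∀ g : ℝ × Dir d → ℝ≥0∞, Measurable g →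
      ∫⁻ a, {a : ℝ × Dir d | s < a.1}.indicator (fun a => g (a.1 - s, a.2)) a ∂(stepLaw d) =
      ENNReal.ofReal (Real.exp (-s)) * ∫⁻ a, g a ∂(stepLaw d) := by
    intro g hg
    have hset : MeasurableSet {a : ℝ × Dir d | s < a.1} :=
      measurableSet_lt measurable_const measurable_fst
    have hm : Measurable ({a : ℝ × Dir d | s < a.1}.indicator (fun a => g (a.1 - s, a.2))) :=
      Measurable.indicator (hg.comp (by fun_prop)) hset
    rw [stepLaw, lintegral_prod_symm _ hm.aemeasurable, lintegral_prod_symm _ hg.aemeasurable,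
      ← lintegral_const_mul _ hg.lintegral_prod_left']
    refine lintegral_congr fun b => ?_
    rw [← lintegral_expMeasure_shift (f := fun x => g (x, b)) (by fun_prop) hs]
    refine lintegral_congr_ae ?_
    filter_upwards [ae_ne_expMeasure s] with x hx
    have : s < x ↔ s ≤ x := ⟨le_of_lt, fun h => lt_of_le_of_ne h (Ne.symm hx)⟩
    simp [Set.indicator, this]
  have h1 := main (fun _ => 1) measurable_const
  rw [main f hf]
  have hset : MeasurableSet {a : ℝ × Dir d | s < a.1} :=
    measurableSet_lt measurable_const measurable_fst
  have : ∫⁻ a, {a : ℝ × Dir d | s < a.1}.indicator (fun _ => (1 : ℝ≥0∞)) a ∂(stepLaw d) =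
    stepLaw d {a | s < a.1} := lintegral_indicator_one hset
  rw [this] at h1
  rw [h1]; simp

/-- The Markov property on the event that there are `n` jumps before time `s`, by splitting off the
first step and the lack of memory of the waiting time which straddles `s`. -/
lemma markov_aux (b : ℝ × Dir d) (n : ℕ) : ∀ {s : ℝ}, 0 ≤ s →
    ∀ {h : WalkData d × WalkData d → ℝ≥0∞}, Measurable h →
    ∫⁻ w, {w | jumpCount w s = n}.indicator (fun w => h (freeze b s w, shift s w)) w ∂(walkLaw d) =
    ∫⁻ w, {w | jumpCount w s = n}.indicator
      (fun w => ∫⁻ w', h (freeze b s w, w') ∂(walkLaw d)) w ∂(walkLaw d) := by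
  induction n with
  | zero =>
    intro s hs h hh
    have hset : MeasurableSet {w : WalkData d | jumpCount w s = 0} :=
      measurable_jumpCount_right s (MeasurableSet.singleton 0)
    have hm1 : Measurable ({w : WalkData d | jumpCount w s = 0}.indicator
        (fun w => h (freeze b s w, shift s w))) :=
      Measurable.indicator (hh.comp ((measurable_freeze b s).prodMk (measurable_shift s))) hset
    have hm2 : Measurable ({w : WalkData d | jumpCount w s = 0}.indicator
        (fun w => ∫⁻ w', h (freeze b s w, w') ∂(walkLaw d))) :=
      Measurable.indicator (hh.lintegral_prod_right'.comp (measurable_freeze b s)) hset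
    rw [lintegral_walkLaw_cons hm1, lintegral_walkLaw_cons hm2]
    set c : WalkData d := fun _ => b
    have e1 : ∀ᵐ a ∂(stepLaw d), ∫⁻ w, {w : WalkData d | jumpCount w s = 0}.indicator
        (fun w => h (freeze b s w, shift s w)) (cons a w) ∂(walkLaw d) =
        {a : ℝ × Dir d | s < a.1}.indicator (fun a => ∫⁻ w, h (c, cons (a.1 - s, a.2) w)
          ∂(walkLaw d)) a := by
      filter_upwards [ae_stepLaw_pos] with a ha
      by_cases has : s < a.1
      · simp only [Set.indicator, Set.mem_ofPred_eq, has, if_true]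
        refine lintegral_congr_ae ?_
        filter_upwards [ae_regular] with w hw
        simp [jumpCount_cons_of_lt ha hw hs has, freeze_cons_of_lt ha hw b hs has,
          shift_cons_of_lt ha hw hs has, c]
      · simp only [Set.indicator, Set.mem_ofPred_eq, has, if_false]
        rw [← lintegral_zero (μ := walkLaw d)]
        refine lintegral_congr_ae ?_
        filter_upwards [ae_regular] with w hw
        simp [jumpCount_cons_of_le ha hw (not_lt.1 has)]
    have e2 : ∀ᵐ a ∂(stepLaw d), ∫⁻ w, {w : WalkData d | jumpCount w s = 0}.indicator
        (fun w => ∫⁻ w', h (freeze b s w, w') ∂(walkLaw d)) (cons a w) ∂(walkLaw d) =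
        {a : ℝ × Dir d | s < a.1}.indicator (fun _ => ∫⁻ w', h (c, w') ∂(walkLaw d)) a := by
      filter_upwards [ae_stepLaw_pos] with a ha
      by_cases has : s < a.1
      · simp only [Set.indicator, Set.mem_ofPred_eq, has, if_true]
        have : ∀ᵐ w ∂(walkLaw d), (if jumpCount (cons a w) s = 0 then
            ∫⁻ w', h (freeze b s (cons a w), w') ∂(walkLaw d) else 0) =
            ∫⁻ w', h (c, w') ∂(walkLaw d) := by
          filter_upwards [ae_regular] with w hw
          simp [jumpCount_cons_of_lt ha hw hs has, freeze_cons_of_lt ha hw b hs has, c]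
        rw [lintegral_congr_ae this]
        simp
      · simp only [Set.indicator, Set.mem_ofPred_eq, has, if_false]
        rw [← lintegral_zero (μ := walkLaw d)]
        refine lintegral_congr_ae ?_
        filter_upwards [ae_regular] with w hw
        simp [jumpCount_cons_of_le ha hw (not_lt.1 has)]
    rw [lintegral_congr_ae e1, lintegral_congr_ae e2]
    have hmc : Measurable fun a : ℝ × Dir d => ∫⁻ w, h (c, cons a w) ∂(walkLaw d) :=
      Measurable.lintegral_prod_right' (f := fun x : (ℝ × Dir d) × WalkData d =>
        h (c, cons x.1 x.2)) (hh.comp (measurable_const.prodMk measurable_cons))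
    rw [lintegral_stepLaw_shift hmc hs, ← lintegral_walkLaw_cons (f := fun w => h (c, w))
      (by fun_prop), lintegral_indicator_const (measurableSet_lt measurable_const measurable_fst),
      mul_comm]
  | succ n ih =>
    intro s hs h hh
    have hset : MeasurableSet {w : WalkData d | jumpCount w s = n + 1} :=
      measurable_jumpCount_right s (MeasurableSet.singleton _)
    have hm1 : Measurable ({w : WalkData d | jumpCount w s = n + 1}.indicator
        (fun w => h (freeze b s w, shift s w))) :=
      Measurable.indicator (hh.comp ((measurable_freeze b s).prodMk (measurable_shift s))) hset
    have hm2 : Measurable ({w : WalkData d | jumpCount w s = n + 1}.indicator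
        (fun w => ∫⁻ w', h (freeze b s w, w') ∂(walkLaw d))) :=
      Measurable.indicator (hh.lintegral_prod_right'.comp (measurable_freeze b s)) hset
    rw [lintegral_walkLaw_cons hm1, lintegral_walkLaw_cons hm2]
    refine lintegral_congr_ae ?_
    filter_upwards [ae_stepLaw_pos] with a ha
    by_cases has : a.1 ≤ s
    · have hh' : Measurable fun x : WalkData d × WalkData d => h (cons a x.1, x.2) := by
        refine hh.comp (Measurable.prodMk ?_ measurable_snd)
        have : Measurable fun x : WalkData d × WalkData d => (a, x.1) := by fun_prop
        exact measurable_cons.comp this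
      have := ih (sub_nonneg.2 has) hh'
      refine Eq.trans ?_ (this.trans ?_)
      · refine lintegral_congr_ae ?_
        filter_upwards [ae_regular] with w hw
        simp [Set.indicator, jumpCount_cons_of_le ha hw has, freeze_cons_of_le ha hw b has,
          shift_cons_of_le ha hw has]
      · refine lintegral_congr_ae ?_
        filter_upwards [ae_regular] with w hw
        simp [Set.indicator, jumpCount_cons_of_le ha hw has, freeze_cons_of_le ha hw b has]
    · refine lintegral_congr_ae ?_
      filter_upwards [ae_regular] with w hw
      simp [Set.indicator, jumpCount_cons_of_lt ha hw hs (not_le.1 has)]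

/-- **Markov property**: the data after time `s` are those of a walk independent of the past. -/
lemma markov (b : ℝ × Dir d) {s : ℝ} (hs : 0 ≤ s) {h : WalkData d × WalkData d → ℝ≥0∞}
    (hh : Measurable h) :
    ∫⁻ w, h (freeze b s w, shift s w) ∂(walkLaw d) =
      ∫⁻ w, ∫⁻ w', h (freeze b s w, w') ∂(walkLaw d) ∂(walkLaw d) := by
  have hset : ∀ n, MeasurableSet {w : WalkData d | jumpCount w s = n} := fun n =>
    measurable_jumpCount_right s (MeasurableSet.singleton n)
  have key : ∀ f : WalkData d → ℝ≥0∞, Measurable f → ∫⁻ w, f w ∂(walkLaw d) =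
      ∑' n, ∫⁻ w, {w | jumpCount w s = n}.indicator f w ∂(walkLaw d) := by
    intro f hf
    rw [← lintegral_tsum fun n => (hf.indicator (hset n)).aemeasurable]
    refine lintegral_congr fun w => ?_
    rw [tsum_eq_single (jumpCount w s)]
    · simp
    · intro n hn
      simp [hn.symm]
  have h1 : Measurable fun w => h (freeze b s w, shift s w) :=
    hh.comp ((measurable_freeze b s).prodMk (measurable_shift s))
  have h2 : Measurable fun w => ∫⁻ w', h (freeze b s w, w') ∂(walkLaw d) :=
    hh.lintegral_prod_right'.comp (measurable_freeze b s)
  rw [key _ h1, key _ h2]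
  exact tsum_congr fun n => markov_aux b n hs hh

lemma lintegral_shift {s : ℝ} (hs : 0 ≤ s) {f : WalkData d → ℝ≥0∞} (hf : Measurable f) :
    ∫⁻ w, f (shift s w) ∂(walkLaw d) = ∫⁻ w, f w ∂(walkLaw d) := by
  have := markov (d := d) (0, default) hs (h := fun x => f x.2) (hf.comp measurable_snd)
  simpa using this

lemma markov_pos {s : ℝ} (hs : 0 ≤ s) {h : Site d × WalkData d → ℝ≥0∞} (hh : Measurable h) :
    ∫⁻ w, h (pos w s, shift s w) ∂(walkLaw d) =
      ∫⁻ w, ∫⁻ w', h (pos w s, w') ∂(walkLaw d) ∂(walkLaw d) := by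
  have hm : Measurable fun x : WalkData d × WalkData d => h (pos x.1 s, x.2) :=
    hh.comp (((measurable_pos_right s).comp measurable_fst).prodMk measurable_snd)
  have := markov (d := d) (s + 1, default) hs hm
  refine Eq.trans ?_ (this.trans ?_)
  · refine lintegral_congr_ae ?_
    filter_upwards [ae_regular] with w hw
    rw [hw.pos_freeze hs le_rfl (by simp)]
  · refine lintegral_congr_ae ?_
    filter_upwards [ae_regular] with w hw
    rw [hw.pos_freeze hs le_rfl (by simp)]

/-! ### Symmetry -/

lemma map_flip_walkLaw : (walkLaw d).map flip = walkLaw d := by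
  have hinv : (PMF.uniformOfFintype (Dir d)).toMeasure.map (fun a : Dir d => (a.1, !a.2)) =
      (PMF.uniformOfFintype (Dir d)).toMeasure := by
    have hi : Function.Injective (fun a : Dir d => (a.1, !a.2)) := by
      rintro ⟨a, b⟩ ⟨a', b'⟩ h
      simpa using h
    refine Measure.ext_of_singleton fun a => ?_
    rw [Measure.map_apply (measurable_of_countable _) (MeasurableSet.singleton _)]
    have : (fun a : Dir d => (a.1, !a.2)) ⁻¹' {a} = {(a.1, !a.2)} := by
      ext ⟨x, y⟩
      rcases a with ⟨u, v⟩
      cases y <;> cases v <;> simp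
    rw [this, PMF.toMeasure_apply_singleton _ _ (MeasurableSet.singleton _),
      PMF.toMeasure_apply_singleton _ _ (MeasurableSet.singleton _)]
    simp
  have hstep : (stepLaw d).map (fun a => (a.1, (a.2.1, !a.2.2))) = stepLaw d := by
    conv_rhs => rw [stepLaw, ← hinv]
    have := Measure.map_prod_map (expMeasure 1) (PMF.uniformOfFintype (Dir d)).toMeasure
      (f := id) measurable_id (measurable_of_countable (fun a : Dir d => (a.1, !a.2)))
    rw [Measure.map_id] at this
    rw [this]; rfl
  have hm : Measurable (fun a : ℝ × Dir d => (a.1, (a.2.1, !a.2.2))) := by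
    have : Measurable fun a : Dir d => (a.1, !a.2) := measurable_of_countable _
    exact measurable_fst.prodMk (this.comp measurable_snd)
  have := Measure.infinitePi_map_pi (μ := fun _ : ℕ => stepLaw d)
    (f := fun _ (a : ℝ × Dir d) => (a.1, (a.2.1, !a.2.2))) (fun _ => hm)
  rw [walkLaw_eq]
  refine Eq.trans ?_ (this.trans ?_)
  · rfl
  · simp_rw [hstep]

/-- With probability at least `exp (-s)` there is no jump up to time `s`. -/
lemma exp_neg_le_jumpCount_zero {s : ℝ} (hs : 0 ≤ s) :
    ENNReal.ofReal (Real.exp (-s)) ≤ walkLaw d {w | jumpCount w s = 0} := by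
  have hset : MeasurableSet {w : WalkData d | jumpCount w s = 0} :=
    measurable_jumpCount_right s (MeasurableSet.singleton 0)
  rw [← lintegral_indicator_one hset, lintegral_walkLaw_cons (measurable_one.indicator hset)]
  have h : ∀ᵐ a ∂(stepLaw d), ∫⁻ w, {w : WalkData d | jumpCount w s = 0}.indicator 1 (cons a w)
      ∂(walkLaw d) = (Set.Ioi s).indicator 1 a.1 := by
    filter_upwards [ae_stepLaw_pos] with a ha
    have : ∀ᵐ w ∂(walkLaw d), {w : WalkData d | jumpCount w s = 0}.indicator 1 (cons a w) =
        ((Set.Ioi s).indicator 1 a.1 : ℝ≥0∞) := by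
      filter_upwards [ae_regular] with w hw
      by_cases has : s < a.1
      · simp [Set.indicator, has, jumpCount_cons_of_lt ha hw hs has]
      · simp [Set.indicator, has, jumpCount_cons_of_le ha hw (not_lt.1 has)]
    rw [lintegral_congr_ae this]; simp
  rw [lintegral_congr_ae h, stepLaw, lintegral_prod _ (by
    exact ((measurable_one.indicator measurableSet_Ioi).comp measurable_fst).aemeasurable)]
  simp only [lintegral_const, measure_univ, mul_one]
  have := lintegral_expMeasure_shift (f := fun _ => 1) measurable_const hs
  simp only [lintegral_const, measure_univ, mul_one] at this
  rw [← this]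
  refine le_of_eq (lintegral_congr_ae ?_)
  filter_upwards [ae_ne_expMeasure s] with x hx
  have : s < x ↔ s ≤ x := ⟨le_of_lt, fun h => lt_of_le_of_ne h (Ne.symm hx)⟩
  simp [Set.indicator, this]

end

section

/-! ### The exponential function on `[0,∞]` and its series -/

/-- The exponential function on `[0,∞]`. -/
def expE (x : ℝ≥0∞) : ℝ≥0∞ := EReal.exp (x : EReal)

/-- The function `exp x - 1` on `[0,∞]`, given by its power series so that no subtraction occurs. -/
def expOne (x : ℝ≥0∞) : ℝ≥0∞ := ∑' n : ℕ, ((n + 1).factorial : ℝ≥0∞)⁻¹ * x ^ (n + 1)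

lemma expE_eq_tsum (x : ℝ≥0∞) : expE x = ∑' n : ℕ, (n.factorial : ℝ≥0∞)⁻¹ * x ^ n := by
  induction x with
  | top =>
    simp only [expE, EReal.coe_ennreal_top, EReal.exp_top]
    symm
    refine top_unique (le_trans ?_ (ENNReal.le_tsum 1))
    simp
  | coe x =>
    have h1 : expE x = ENNReal.ofReal (Real.exp x) := rfl
    have h2 := Real.summable_pow_div_factorial (x : ℝ)
    rw [h1, Real.exp_eq_exp_ℝ, NormedSpace.exp_eq_tsum_div,
      ENNReal.ofReal_tsum_of_nonneg (fun n => by positivity) h2]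
    refine tsum_congr fun n => ?_
    rw [ENNReal.ofReal_div_of_pos (by positivity), ENNReal.ofReal_pow x.coe_nonneg,
      ENNReal.ofReal_coe_nnreal, ENNReal.ofReal_natCast, mul_comm, div_eq_mul_inv]

lemma expE_eq_one_add (x : ℝ≥0∞) : expE x = 1 + expOne x := by
  rw [expE_eq_tsum, tsum_eq_zero_add' ENNReal.summable, expOne]
  simp

lemma expE_zero : expE 0 = 1 := by simp [expE]

lemma expE_add (x y : ℝ≥0∞) : expE (x + y) = expE x * expE y := by
  rw [expE, EReal.coe_ennreal_add, EReal.exp_add]; rfl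

lemma expE_mono {x y : ℝ≥0∞} (h : x ≤ y) : expE x ≤ expE y :=
  EReal.exp_monotone (EReal.coe_ennreal_le_coe_ennreal_iff.2 h)

lemma one_le_expE (x : ℝ≥0∞) : 1 ≤ expE x := by
  rw [expE_eq_one_add]; exact le_self_add

lemma expE_ne_top {x : ℝ≥0∞} (h : x ≠ ∞) : expE x ≠ ∞ := by
  simpa [expE] using h

lemma expE_sum {ι : Type*} (s : Finset ι) (f : ι → ℝ≥0∞) :
    expE (∑ i ∈ s, f i) = ∏ i ∈ s, expE (f i) := by
  classical
  induction s using Finset.induction_on with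
  | empty => simp [expE_zero]
  | insert a s ha ih => rw [Finset.sum_insert ha, Finset.prod_insert ha, expE_add, ih]

lemma continuous_expE : Continuous expE :=
  ENNReal.continuous_exp.comp continuous_coe_ennreal_ereal

lemma measurable_expE : Measurable expE := continuous_expE.measurable

lemma measurable_expOne : Measurable expOne := by
  unfold expOne; fun_prop

lemma expE_tsum {ι : Type*} (f : ι → ℝ≥0∞) :
    expE (∑' i, f i) = ⨆ s : Finset ι, ∏ i ∈ s, expE (f i) := by
  have h : Monotone expE := fun _ _ => expE_mono
  rw [ENNReal.tsum_eq_iSup_sum, Monotone.map_ciSup_of_continuousAt continuous_expE.continuousAt h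
    (OrderTop.bddAbove _)]
  simp_rw [expE_sum]

lemma expE_surj {y : ℝ≥0∞} (hy : 1 ≤ y) : ∃ x, expE x = y := by
  refine ⟨(ENNReal.log y).toENNReal, ?_⟩
  rw [expE, EReal.coe_toENNReal (by simpa using hy), ENNReal.exp_log]

lemma expOne_add_le (x y : ℝ≥0∞) : expOne x + expOne y ≤ expOne (x + y) := by
  simp only [expOne]
  rw [← ENNReal.tsum_add]
  refine ENNReal.tsum_le_tsum fun n => ?_
  rw [← mul_add]
  gcongr
  exact pow_add_pow_le zero_le zero_le (by omega)

lemma expOne_le_mul (x : ℝ≥0∞) : expOne x ≤ x * expE x := by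
  rw [expOne, expE_eq_tsum, ← ENNReal.tsum_mul_left]
  refine ENNReal.tsum_le_tsum fun n => ?_
  rw [pow_succ', ← mul_assoc, ← mul_assoc, mul_comm _ x]
  gcongr
  omega

/-! ### Powers of integrals -/

lemma lintegral_pi_prod {α : Type*} [MeasurableSpace α] (μ : Measure α) [SigmaFinite μ] {n : ℕ}
    {f : Fin n → α → ℝ≥0∞} (hf : ∀ i, Measurable (f i)) :
    ∫⁻ x, ∏ i, f i (x i) ∂(Measure.pi fun _ : Fin n => μ) = ∏ i, ∫⁻ y, f i y ∂μ := by
  induction n with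
  | zero => simp
  | succ n ih =>
    have hp := measurePreserving_piFinSuccAbove (fun _ : Fin (n + 1) => μ) 0
    have hm : Measurable fun x : Fin n → α => ∏ i : Fin n, f i.succ (x i) := by fun_prop
    rw [Fin.prod_univ_succ, ← ih (fun i => hf i.succ),
      ← lintegral_prod_mul (hf 0).aemeasurable hm.aemeasurable,
      ← hp.lintegral_comp (f := fun z : α × (Fin n → α) => f 0 z.1 * ∏ i, f i.succ (z.2 i))
        (by fun_prop)]
    refine lintegral_congr fun x => ?_
    rw [Fin.prod_univ_succ]
    rfl

lemma lintegral_pow_eq {α : Type*} [MeasurableSpace α] (μ : Measure α) [SigmaFinite μ] (n : ℕ)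
    {f : α → ℝ≥0∞} (hf : Measurable f) :
    (∫⁻ y, f y ∂μ) ^ n = ∫⁻ x, ∏ i, f (x i) ∂(Measure.pi fun _ : Fin n => μ) := by
  rw [lintegral_pi_prod μ fun _ => hf]; simp

lemma expE_lintegral {α : Type*} [MeasurableSpace α] (μ : Measure α) [SigmaFinite μ]
    {f : α → ℝ≥0∞} (hf : Measurable f) :
    expE (∫⁻ y, f y ∂μ) = ∑' n : ℕ, (n.factorial : ℝ≥0∞)⁻¹ *
      ∫⁻ x, ∏ i, f (x i) ∂(Measure.pi fun _ : Fin n => μ) := by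
  rw [expE_eq_tsum]
  simp_rw [lintegral_pow_eq μ _ hf]

/-! ### Exponential functionals depend on the finite dimensional distributions only -/

/-- Expanding the exponential series brings in the process at finitely many times only. -/
lemma lintegral_expE_expand {Ω β : Type*} [MeasurableSpace Ω] [MeasurableSpace β]
    (P : Measure Ω) [SFinite P] {X : Ω → ℝ → β} (hX : Measurable fun x : Ω × ℝ => X x.1 x.2)
    (T : Set ℝ) {g : ℝ → β → ℝ≥0∞} (hg : Measurable fun x : ℝ × β => g x.1 x.2)
    (t : ℝ) {φ : β → ℝ≥0∞} (hφ : Measurable φ) :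
    ∫⁻ ω, expE (∫⁻ s in T, g s (X ω s)) * φ (X ω t) ∂P =
      ∑' n : ℕ, (n.factorial : ℝ≥0∞)⁻¹ * ∫⁻ u, ∫⁻ ω, (∏ i, g (u i) (X ω (u i))) * φ (X ω t) ∂P
        ∂(Measure.pi fun _ : Fin n => volume.restrict T) := by
  have hXs : ∀ ω, Measurable (X ω) := fun ω => hX.comp (measurable_prodMk_left (x := ω))
  have hXt : Measurable fun ω => X ω t := hX.comp (measurable_prodMk_right (y := t))
  have hgX : Measurable fun x : Ω × ℝ => g x.2 (X x.1 x.2) := hg.comp (measurable_snd.prodMk hX)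
  have hj : ∀ n : ℕ, Measurable fun x : Ω × (Fin n → ℝ) =>
      (∏ i, g (x.2 i) (X x.1 (x.2 i))) * φ (X x.1 t) := by
    intro n
    refine Measurable.mul ?_ (hφ.comp (hXt.comp measurable_fst))
    refine Finset.measurable_prod _ fun i _ => ?_
    have : Measurable fun x : Ω × (Fin n → ℝ) => (x.1, x.2 i) := by fun_prop
    exact hgX.comp this
  have h1 : ∀ ω, expE (∫⁻ s in T, g s (X ω s)) * φ (X ω t) = ∑' n : ℕ, (n.factorial : ℝ≥0∞)⁻¹ *
      ∫⁻ u, (∏ i, g (u i) (X ω (u i))) * φ (X ω t)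
        ∂(Measure.pi fun _ : Fin n => volume.restrict T) := by
    intro ω
    have hω : Measurable fun s => g s (X ω s) := hg.comp (measurable_id.prodMk (hXs ω))
    rw [expE_lintegral _ hω, ← ENNReal.tsum_mul_right]
    refine tsum_congr fun n => ?_
    rw [lintegral_mul_const _ (by fun_prop), mul_assoc]
  simp_rw [h1]
  rw [lintegral_tsum fun n => ((hj n).lintegral_prod_right'.const_mul _).aemeasurable]
  refine tsum_congr fun n => ?_
  rw [lintegral_const_mul _ (hj n).lintegral_prod_right',
    lintegral_lintegral_swap (hj n).aemeasurable]

/-- Two processes with the same finite dimensional distributions have the same expectations of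
exponentials of additive functionals. -/
lemma lintegral_expE_congr {Ω₁ Ω₂ β : Type*} [MeasurableSpace Ω₁] [MeasurableSpace Ω₂]
    [MeasurableSpace β] (P₁ : Measure Ω₁) [SFinite P₁] (P₂ : Measure Ω₂) [SFinite P₂]
    {X₁ : Ω₁ → ℝ → β} (hX₁ : Measurable fun x : Ω₁ × ℝ => X₁ x.1 x.2)
    {X₂ : Ω₂ → ℝ → β} (hX₂ : Measurable fun x : Ω₂ × ℝ => X₂ x.1 x.2)
    {T : Set ℝ} (hT : MeasurableSet T)
    (hfdd : ∀ (n : ℕ) (u : Fin n → ℝ), (∀ i, u i ∈ T) →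
      P₁.map (fun ω i => X₁ ω (u i)) = P₂.map (fun ω i => X₂ ω (u i)))
    {g : ℝ → β → ℝ≥0∞} (hg : Measurable fun x : ℝ × β => g x.1 x.2)
    {t : ℝ} (ht : t ∈ T) {φ : β → ℝ≥0∞} (hφ : Measurable φ) :
    ∫⁻ ω, expE (∫⁻ s in T, g s (X₁ ω s)) * φ (X₁ ω t) ∂P₁ =
      ∫⁻ ω, expE (∫⁻ s in T, g s (X₂ ω s)) * φ (X₂ ω t) ∂P₂ := by
  rw [lintegral_expE_expand P₁ hX₁ T hg t hφ, lintegral_expE_expand P₂ hX₂ T hg t hφ]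
  refine tsum_congr fun n => ?_
  congr 1
  rw [← Measure.restrict_pi_pi]
  refine setLIntegral_congr_fun (MeasurableSet.univ_pi fun _ => hT) fun u hu => ?_
  have hu' : ∀ i, u i ∈ T := fun i => hu i trivial
  set v : Fin (n + 1) → ℝ := Fin.cons t u
  have hv : ∀ i, v i ∈ T := fun i => by
    refine Fin.cases ?_ (fun i => ?_) i
    · exact ht
    · exact hu' i
  have hm : Measurable fun y : Fin (n + 1) → β => (∏ i, g (u i) (y i.succ)) * φ (y 0) := by
    refine Measurable.mul ?_ (by fun_prop)
    refine Finset.measurable_prod _ fun i _ => ?_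
    have : Measurable fun y : Fin (n + 1) → β => (u i, y i.succ) := by fun_prop
    exact hg.comp this
  have hm1 : Measurable fun (ω : Ω₁) (i : Fin (n + 1)) => X₁ ω (v i) :=
    measurable_pi_iff.2 fun i => hX₁.comp (measurable_prodMk_right (y := v i))
  have hm2 : Measurable fun (ω : Ω₂) (i : Fin (n + 1)) => X₂ ω (v i) :=
    measurable_pi_iff.2 fun i => hX₂.comp (measurable_prodMk_right (y := v i))
  have e1 := lintegral_map (μ := P₁) hm hm1
  have e2 := lintegral_map (μ := P₂) hm hm2
  rw [hfdd _ v hv] at e1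
  exact e1.symm.trans e2

/-! ### Superposition of walks -/

variable {d : ℕ}

lemma measurable_walk_right (r t : ℝ) : Measurable fun w : WalkData d => walk r w t := by
  simpa only [walk_eq_pos] using measurable_pos_right (d := d) (r * t)

lemma measurable_walk_pi {ι : Type*} (r : ℝ) (u : ι → ℝ) :
    Measurable fun (w : WalkData d) (i : ι) => walk r w (u i) :=
  measurable_pi_iff.2 fun i => measurable_walk_right r (u i)

variable [NeZero d]

/-- Finite dimensional distributions of the walk of rate `r`. -/
def fdd (d : ℕ) [NeZero d] {ι : Type*} (r : ℝ) (u : ι → ℝ) : Measure (ι → Site d) :=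
  (walkLaw d).map fun w i => walk r w (u i)

instance {ι : Type*} (r : ℝ) (u : ι → ℝ) : IsProbabilityMeasure (fdd d r u) :=
  Measure.isProbabilityMeasure_map (measurable_walk_pi r u).aemeasurable

lemma lintegral_fdd {ι : Type*} (r : ℝ) (u : ι → ℝ) {f : (ι → Site d) → ℝ≥0∞}
    (hf : Measurable f) : ∫⁻ x, f x ∂(fdd d r u) = ∫⁻ w, f (fun i => walk r w (u i)) ∂walkLaw d :=
  lintegral_map hf (measurable_walk_pi r u)

/-- The walk of rate `r` is the sum of its position at time `c` and an independent walk. -/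
lemma fdd_peel {ι : Type*} [Fintype ι] {r : ℝ} (hr : 0 ≤ r) {u : ι → ℝ} (hu : ∀ i, 0 ≤ u i)
    {c : ℝ} (hc : 0 ≤ c) (hcu : ∀ i, 0 < u i → c ≤ u i) :
    fdd d r u = ((fdd d r fun _ : Unit => c).map fun x i => if 0 < u i then x () else 0) ∗
      fdd d r fun i => if 0 < u i then u i - c else 0 := by
  refine Measure.ext_of_lintegral _ fun f hf => ?_
  have hD : Measurable fun (x : Unit → Site d) (i : ι) => if 0 < u i then x () else 0 := by
    refine measurable_pi_iff.2 fun i => ?_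
    split_ifs <;> fun_prop
  rw [Measure.lintegral_conv (by fun_prop), lintegral_fdd _ _ hf,
    lintegral_map (Measurable.lintegral_prod_right' (f := fun x : (ι → Site d) × (ι → Site d) =>
      f (x.1 + x.2)) (by fun_prop)) hD]
  have hinner : Measurable fun x : Unit → Site d => ∫⁻ y,
      f ((fun i => if 0 < u i then x () else 0) + y)
        ∂(fdd d r fun i => if 0 < u i then u i - c else 0) :=
    (Measurable.lintegral_prod_right' (f := fun x : (ι → Site d) × (ι → Site d) =>
      f (x.1 + x.2)) (by fun_prop)).comp hD
  rw [lintegral_fdd _ _ hinner]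
  have hrc : 0 ≤ r * c := mul_nonneg hr hc
  set h : Site d × WalkData d → ℝ≥0∞ := fun x => f ((fun i => if 0 < u i then x.1 else 0) +
    fun i => walk r x.2 (if 0 < u i then u i - c else 0)) with hh
  have hhm : Measurable h := by
    refine hf.comp (Measurable.add ?_ ((measurable_walk_pi _ _).comp measurable_snd))
    refine measurable_pi_iff.2 fun i => ?_
    split_ifs <;> fun_prop
  refine Eq.trans ?_ ((markov_pos hrc hhm).trans ?_)
  · refine lintegral_congr_ae ?_
    filter_upwards [ae_regular] with w hw
    simp only [hh]
    congr 1
    funext i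
    simp only [Pi.add_apply, walk_eq_pos]
    split_ifs with hi
    · rw [← hw.pos_add hrc (mul_nonneg hr (sub_nonneg.2 (hcu i hi)))]
      congr 1; ring
    · have h0 : u i = 0 := le_antisymm (not_lt.1 hi) (hu i)
      have h1 := hw.pos_add hrc le_rfl
      simp only [add_zero] at h1
      simp only [h0, mul_zero, zero_add, hw.pos_zero]
      exact (left_eq_add.1 h1).symm
  · refine lintegral_congr fun w => ?_
    rw [lintegral_fdd _ _ (by fun_prop)]
    simp only [hh, walk_eq_pos]

lemma fdd_zero {ι : Type*} [Fintype ι] (r : ℝ) :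
    fdd d r (fun _ : ι => (0 : ℝ)) = Measure.dirac 0 := by
  refine Measure.ext_of_lintegral _ fun f hf => ?_
  rw [lintegral_fdd _ _ hf, lintegral_dirac' _ hf]
  have : ∀ᵐ w ∂(walkLaw d), f (fun _ => walk r w 0) = f 0 := by
    filter_upwards [ae_regular] with w hw
    simp [walk_eq_pos, hw.pos_zero]
    rfl
  rw [lintegral_congr_ae this]; simp

lemma fdd_unit_add {r r' : ℝ} (hr : 0 ≤ r) (hr' : 0 ≤ r') {c : ℝ} (hc : 0 ≤ c) :
    fdd d (r + r') (fun _ : Unit => c) = fdd d r (fun _ : Unit => c) ∗ fdd d r' fun _ => c := by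
  refine Measure.ext_of_lintegral _ fun f hf => ?_
  rw [Measure.lintegral_conv (by fun_prop), lintegral_fdd _ _ hf, lintegral_fdd _ _
    (Measurable.lintegral_prod_right' (f := fun x : (Unit → Site d) × (Unit → Site d) =>
      f (x.1 + x.2)) (by fun_prop))]
  set h : Site d × WalkData d → ℝ≥0∞ := fun x => f (fun _ => x.1 + walk r' x.2 c) with hh
  have hhm : Measurable h := by
    refine hf.comp (measurable_pi_iff.2 fun _ => measurable_fst.add ?_)
    exact (measurable_walk_right _ _).comp measurable_snd
  refine Eq.trans ?_ ((markov_pos (mul_nonneg hr hc) hhm).trans ?_)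
  · refine lintegral_congr_ae ?_
    filter_upwards [ae_regular] with w hw
    simp only [hh, walk_eq_pos]
    rw [add_mul, hw.pos_add (mul_nonneg hr hc) (mul_nonneg hr' hc)]
  · refine lintegral_congr fun w => ?_
    rw [lintegral_fdd _ _ (by fun_prop)]
    simp only [hh, walk_eq_pos]
    rfl

/-- Walks of rates `r` and `r'` superpose to a walk of rate `r + r'`. All three walks are decomposed
at the smallest positive time, which reduces the number of positive times. -/
lemma fdd_add {ι : Type*} [Fintype ι] {r r' : ℝ} (hr : 0 ≤ r) (hr' : 0 ≤ r') (n : ℕ) :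
    ∀ {u : ι → ℝ}, (∀ i, 0 ≤ u i) → (Finset.univ.filter fun i => 0 < u i).card ≤ n →
    fdd d (r + r') u = fdd d r u ∗ fdd d r' u := by
  classical
  induction n with
  | zero =>
    intro u hu hn
    have h0 : u = fun _ => 0 := by
      funext i
      have : Finset.univ.filter (fun i => 0 < u i) = ∅ := by simpa using hn
      have hi : i ∉ Finset.univ.filter (fun i => 0 < u i) := by simp [this]
      simp only [Finset.mem_filter, Finset.mem_univ, true_and] at hi
      exact le_antisymm (not_lt.1 hi) (hu i)
    rw [h0, fdd_zero, fdd_zero, fdd_zero, Measure.dirac_conv_dirac, add_zero]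
  | succ n ih =>
    intro u hu hn
    by_cases hne : (Finset.univ.filter fun i => 0 < u i).Nonempty
    · obtain ⟨j, hj, hmin⟩ := Finset.exists_min_image _ u hne
      have hj' : 0 < u j := by simpa using hj
      have hcu : ∀ i, 0 < u i → u j ≤ u i := fun i hi => hmin i (by simpa using hi)
      set u' : ι → ℝ := fun i => if 0 < u i then u i - u j else 0 with hu'
      have hu'0 : ∀ i, 0 ≤ u' i := fun i => by
        simp only [hu']; split_ifs with h
        exacts [sub_nonneg.2 (hcu i h), le_rfl]
      have hcard : (Finset.univ.filter fun i => 0 < u' i).card ≤ n := by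
        have hss : (Finset.univ.filter fun i => 0 < u' i) ⊂
            Finset.univ.filter fun i => 0 < u i := by
          rw [Finset.ssubset_iff_of_subset]
          · exact ⟨j, hj, by simp [hu']⟩
          · intro i hi
            simp only [hu', Finset.mem_filter, Finset.mem_univ, true_and] at hi ⊢
            by_contra h
            simp [h] at hi
        have := Finset.card_lt_card hss
        omega
      have hih := ih hu'0 hcard
      let D : (Unit → Site d) →+ (ι → Site d) :=
        { toFun := fun x i => if 0 < u i then x () else 0
          map_zero' := by funext i; simp
          map_add' := fun x y => by funext i; simp only [Pi.add_apply]; split_ifs <;> simp }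
      have hDm : Measurable D := by
        refine measurable_pi_iff.2 fun i => ?_
        change Measurable fun x : Unit → Site d => if 0 < u i then x () else 0
        split_ifs <;> fun_prop
      have hpeel : ∀ {q : ℝ}, 0 ≤ q → fdd d q u = ((fdd d q fun _ : Unit => u j).map D) ∗
          fdd d q u' := fun hq => fdd_peel hq hu hj'.le hcu
      have hprob : ∀ q : ℝ, IsProbabilityMeasure ((fdd d q fun _ : Unit => u j).map D) :=
        fun q => Measure.isProbabilityMeasure_map hDm.aemeasurable
      have := hprob r
      have := hprob r'
      rw [hpeel (add_nonneg hr hr'), hpeel hr, hpeel hr', hih, fdd_unit_add hr hr' hj'.le,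
        Measure.map_conv_addMonoidHom D hDm]
      set α := (fdd d r fun _ : Unit => u j).map D
      set α' := (fdd d r' fun _ : Unit => u j).map D
      rw [Measure.conv_assoc, Measure.conv_assoc, ← Measure.conv_assoc α',
        Measure.conv_comm α', Measure.conv_assoc]
    · refine ih hu ?_
      rw [Finset.not_nonempty_iff_eq_empty.1 hne]; simp

/-- The walk of rate `r + r'` is the difference of independent walks of rates `r` and `r'`. -/
lemma fdd_add_eq_sub {ι : Type*} [Fintype ι] {r r' : ℝ} (hr : 0 ≤ r) (hr' : 0 ≤ r') {u : ι → ℝ}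
    (hu : ∀ i, 0 ≤ u i) :
    (walkLaw d).map (fun w i => walk (r + r') w (u i)) =
      ((walkLaw d).prod (walkLaw d)).map fun x i => walk r x.1 (u i) - walk r' x.2 (u i) := by
  change fdd d (r + r') u = _
  rw [fdd_add hr hr' _ hu le_rfl]
  have hflip : fdd d r' u = (walkLaw d).map fun w i => -walk r' w (u i) := by
    conv_lhs => rw [fdd, ← map_flip_walkLaw, Measure.map_map (measurable_walk_pi _ _)
      measurable_flip]
    congr 1
    funext w i
    simp [walk_eq_pos, pos_flip]
  have hneg : Measurable fun (w : WalkData d) (i : ι) => -walk r' w (u i) :=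
    measurable_pi_iff.2 fun i => (measurable_walk_right r' (u i)).neg
  rw [hflip, fdd, Measure.conv, Measure.map_prod_map _ _ (measurable_walk_pi _ _) hneg,
    Measure.map_map (by fun_prop) (by
      exact ((measurable_walk_pi _ _).comp measurable_fst).prodMk (hneg.comp measurable_snd))]
  refine congrArg (fun f => Measure.map f _) ?_
  funext x i
  simp [sub_eq_add_neg]

end

section

/-! ### Laplace functional of the Poisson field -/

lemma lintegral_expE_tsum_infinitePi {ι Ω : Type*} [Countable ι] [MeasurableSpace Ω]
    (μ : Measure Ω) [IsProbabilityMeasure μ] {h : ι → Ω → ℝ≥0∞} (hh : ∀ i, Measurable (h i))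
    {a : ι → ℝ≥0∞} (ha : ∀ i, ∫⁻ ω, expE (h i ω) ∂μ = expE (a i)) :
    ∫⁻ ω, expE (∑' i, h i (ω i)) ∂(Measure.infinitePi fun _ : ι => μ) = expE (∑' i, a i) := by
  have hm : ∀ i, Measurable fun ω => expE (h i ω) := fun i => measurable_expE.comp (hh i)
  have hm' : ∀ i, Measurable fun ω : ι → Ω => expE (h i (ω i)) := fun i =>
    (hm i).comp (measurable_pi_apply i)
  simp_rw [expE_tsum]
  rw [lintegral_iSup_directed (fun s => (Finset.measurable_prod s fun i _ => hm' i).aemeasurable)]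
  · refine iSup_congr fun s => ?_
    have hind : iIndepFun (fun i (ω : ι → Ω) => expE (h i (ω i)))
        (Measure.infinitePi fun _ : ι => μ) := iIndepFun_infinitePi fun i => hm i
    rw [lintegral_prod_eq_prod_lintegral_of_indepFun s _ hind hm']
    refine Finset.prod_congr rfl fun i _ => ?_
    rw [← ha i]
    exact (measurePreserving_eval_infinitePi (fun _ : ι => μ) i).lintegral_comp (hm i)
  · intro s t
    classical
    refine ⟨s ∪ t, fun ω => ?_, fun ω => ?_⟩
    · exact Finset.prod_le_prod_of_subset_of_one_le' Finset.subset_union_left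
        fun i _ _ => one_le_expE _
    · exact Finset.prod_le_prod_of_subset_of_one_le' Finset.subset_union_right
        fun i _ _ => one_le_expE _

lemma expE_nat_mul (n : ℕ) (a : ℝ≥0∞) : expE (n * a) = expE a ^ n := by
  have := expE_sum (Finset.range n) fun _ => a
  simpa using this

/-- The generating function of the Poisson distribution. -/
lemma lintegral_expE_poisson (ρ : ℝ≥0) {a r : ℝ≥0∞} (har : expE a = 1 + r) :
    ∫⁻ n : ℕ, expE (n * a) ∂(poissonMeasure ρ) = expE (ρ * r) := by
  rw [lintegral_countable']
  simp_rw [expE_nat_mul, har, poissonMeasure_singleton]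
  have h1 : ∀ n : ℕ, (1 + r) ^ n * ENNReal.ofReal (Real.exp (-ρ) * ρ ^ n / n.factorial) =
      ENNReal.ofReal (Real.exp (-ρ)) * ((n.factorial : ℝ≥0∞)⁻¹ * (ρ * (1 + r)) ^ n) := by
    intro n
    rw [ENNReal.ofReal_div_of_pos (by positivity), ENNReal.ofReal_mul (Real.exp_nonneg _),
      ENNReal.ofReal_pow ρ.coe_nonneg, ENNReal.ofReal_coe_nnreal, ENNReal.ofReal_natCast,
      mul_pow, div_eq_mul_inv]
    ring
  simp_rw [h1]
  rw [ENNReal.tsum_mul_left, ← expE_eq_tsum, mul_add, mul_one, expE_add, ← mul_assoc]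
  have h2 : expE (ρ : ℝ≥0∞) = ENNReal.ofReal (Real.exp ρ) := rfl
  rw [h2, ← ENNReal.ofReal_mul (Real.exp_nonneg _), ← Real.exp_add]
  simp

variable {d : ℕ}

/-- Sum over the particles of the catalyst of a function of the starting point and the walk. -/
@[irreducible] def particleSum (h : Site d → WalkData d → ℝ≥0∞) (c : CatalystData d) : ℝ≥0∞ :=
  ∑' q : Site d × ℕ, if q.2 < c.1 q.1 then h q.1 (c.2 q) else 0

lemma measurableSet_alive (q : Site d × ℕ) :
    MeasurableSet {c : CatalystData d | q.2 < c.1 q.1} := by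
  have : Measurable fun c : CatalystData d => c.1 q.1 := by fun_prop
  exact measurableSet_lt measurable_const this

lemma measurable_particleSum {h : Site d → WalkData d → ℝ≥0∞} (hh : ∀ y, Measurable (h y)) :
    Measurable (particleSum h) := by
  simp only [funext fun c => particleSum.eq_1 h c]
  refine Measurable.tsum fun q => Measurable.ite (measurableSet_alive q) ?_ measurable_const
  exact (hh q.1).comp ((measurable_pi_apply q).comp measurable_snd)

/-! ### The weight of a path in the catalyst -/

/-- `occ γ b t x y w` is `γ` times the time which a catalyst particle with starting point `y` and
data `w` spends on the path `x`, which is run backwards in the time window `[b, b + t]`. -/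
@[irreducible] def occ (γ b t : ℝ) (x : ℝ → Site d) (y : Site d) (w : WalkData d) : ℝ≥0∞ :=
  ENNReal.ofReal γ * ∫⁻ s in Set.Icc 0 t, if y + pos w (b + (t - s)) = x s then 1 else 0

/-- The Feynman-Kac weight of the path `x`, which sees the catalyst in the time window
`[b, b + t]`, run backwards. -/
@[irreducible] def weight (γ b t : ℝ) (x : ℝ → Site d) (c : CatalystData d) : ℝ≥0∞ :=
  expE (ENNReal.ofReal γ * ∫⁻ s in Set.Icc 0 t, (catalyst c (x s) (b + (t - s)) : ℝ≥0∞))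

lemma measurable_occ {α : Type*} [MeasurableSpace α] (γ b t : ℝ) {x : α → ℝ → Site d}
    (hx : Measurable fun z : α × ℝ => x z.1 z.2) (y : Site d) :
    Measurable fun z : α × WalkData d => occ γ b t (x z.1) y z.2 := by
  have hset : MeasurableSet {v : (α × WalkData d) × ℝ |
      y + pos v.1.2 (b + (t - v.2)) = x v.1.1 v.2} := by
    have h1 : Measurable fun v : (α × WalkData d) × ℝ => (v.1.2, b + (t - v.2)) := by fun_prop
    have h2 : Measurable fun v : (α × WalkData d) × ℝ => (v.1.1, v.2) := by fun_prop
    exact measurableSet_eq_fun (measurable_const.add (measurable_pos.comp h1)) (hx.comp h2)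
  have hm : Measurable fun v : (α × WalkData d) × ℝ =>
      if y + pos v.1.2 (b + (t - v.2)) = x v.1.1 v.2 then (1 : ℝ≥0∞) else 0 :=
    Measurable.ite hset measurable_const measurable_const
  simp only [occ]
  exact hm.lintegral_prod_right'.const_mul _

lemma measurable_occ_right (γ b t : ℝ) {x : ℝ → Site d} (hx : Measurable x) (y : Site d) :
    Measurable (occ γ b t x y) := by
  have := measurable_occ (α := Unit) γ b t (x := fun _ => x) (by fun_prop) y
  exact this.comp (measurable_prodMk_left (x := ()))

lemma catalyst_eq_tsum (c : CatalystData d) (x : Site d) (t : ℝ) :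
    (catalyst c x t : ℝ≥0∞) = particleSum (fun y w => if y + pos w t = x then 1 else 0) c := by
  rw [catalyst, ← ENNReal.tsum_set_one, tsum_subtype _ (fun _ => (1 : ℝ≥0∞)), particleSum]
  refine tsum_congr fun q => ?_
  simp only [Set.indicator, Set.mem_ofPred_eq, walk_eq_pos, one_mul]
  by_cases h : q.2 < c.1 q.1 <;> simp [h]

lemma measurable_catalyst :
    Measurable fun z : CatalystData d × Site d × ℝ => (catalyst z.1 z.2.1 z.2.2 : ℝ≥0∞) := by
  simp_rw [catalyst_eq_tsum, particleSum]
  refine Measurable.tsum fun q => Measurable.ite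
    ((measurableSet_alive q).preimage measurable_fst) ?_ measurable_const
  refine Measurable.ite ?_ measurable_const measurable_const
  have h1 : Measurable fun z : CatalystData d × Site d × ℝ => (z.1.2 q, z.2.2) := by fun_prop
  exact measurableSet_eq_fun (measurable_const.add (measurable_pos.comp h1)) (by fun_prop)

lemma measurable_weight {α : Type*} [MeasurableSpace α] (γ b t : ℝ) {x : α → ℝ → Site d}
    (hx : Measurable fun z : α × ℝ => x z.1 z.2) :
    Measurable fun z : α × CatalystData d => weight γ b t (x z.1) z.2 := by
  have h1 : Measurable fun v : (α × CatalystData d) × ℝ =>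
      (v.1.2, x v.1.1 v.2, b + (t - v.2)) := by
    have h2 : Measurable fun v : (α × CatalystData d) × ℝ => (v.1.1, v.2) := by fun_prop
    exact (measurable_snd.comp measurable_fst).prodMk ((hx.comp h2).prodMk (by fun_prop))
  have hm := measurable_catalyst.comp h1
  simp only [weight]
  exact measurable_expE.comp (hm.lintegral_prod_right'.const_mul _)

lemma measurable_weight_right (γ b t : ℝ) {x : ℝ → Site d} (hx : Measurable x) :
    Measurable (weight γ b t x) := by
  have := measurable_weight (α := Unit) γ b t (x := fun _ => x) (by fun_prop)
  exact this.comp (measurable_prodMk_left (x := ()))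

lemma weight_eq (γ b t : ℝ) {x : ℝ → Site d} (hx : Measurable x) (c : CatalystData d) :
    weight γ b t x c = expE (particleSum (occ γ b t x) c) := by
  rw [weight]
  congr 1
  simp_rw [catalyst_eq_tsum, particleSum]
  rw [lintegral_tsum, ← ENNReal.tsum_mul_left]
  · refine tsum_congr fun q => ?_
    split_ifs <;> simp [occ]
  · intro q
    split_ifs
    · refine (Measurable.ite ?_ measurable_const measurable_const).aemeasurable
      have h1 : Measurable fun s : ℝ => (c.2 q, b + (t - s)) := by fun_prop
      exact measurableSet_eq_fun (measurable_const.add (measurable_pos.comp h1)) hx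
    · exact measurable_const.aemeasurable

lemma prod_weight_eq {p : ℕ} (γ b t : ℝ) {x : Fin p → ℝ → Site d} (hx : ∀ q, Measurable (x q))
    (c : CatalystData d) : ∏ q, weight γ b t (x q) c =
      expE (particleSum (fun y w => ∑ q, occ γ b t (x q) y w) c) := by
  simp_rw [weight_eq γ b t (hx _)]
  rw [← expE_sum]
  congr 1
  simp_rw [particleSum]
  rw [← Summable.tsum_finsetSum fun _ _ => ENNReal.summable]
  refine tsum_congr fun q => ?_
  split_ifs <;> simp

/-- Summed over its starting point, a particle spends the time `t` on any path: at each instant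
exactly one starting point leads to the path. -/
lemma tsum_occ (γ b t : ℝ) {x : ℝ → Site d} (hx : Measurable x) (w : WalkData d) :
    ∑' y, occ γ b t x y w = ENNReal.ofReal γ * ENNReal.ofReal t := by
  simp_rw [occ]
  rw [ENNReal.tsum_mul_left, ← lintegral_tsum]
  · congr 1
    have : ∀ s, ∑' y : Site d, (if y + pos w (b + (t - s)) = x s then (1 : ℝ≥0∞) else 0) = 1 := by
      intro s
      rw [tsum_eq_single (x s - pos w (b + (t - s)))]
      · simp
      · intro y hy
        rw [if_neg]
        rintro h
        exact hy (eq_sub_of_add_eq h)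
    simp [this]
  · intro y
    refine (Measurable.ite ?_ measurable_const measurable_const).aemeasurable
    have h1 : Measurable fun s : ℝ => (w, b + (t - s)) := by fun_prop
    exact measurableSet_eq_fun (measurable_const.add (measurable_pos.comp h1)) hx

/-! ### Moments of the weights over the catalyst -/

variable [NeZero d]

instance (ρ : ℝ≥0) : IsProbabilityMeasure (catalystLaw d ρ) := by
  unfold catalystLaw; infer_instance

/-- The Laplace functional of the Poisson field of independent walks. -/
lemma lintegral_expE_particleSum (ρ : ℝ≥0) {h : Site d → WalkData d → ℝ≥0∞}
    (hh : ∀ y, Measurable (h y)) :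
    ∫⁻ c, expE (particleSum h c) ∂(catalystLaw d ρ) =
      expE (ρ * ∑' y, ∫⁻ w, expOne (h y w) ∂(walkLaw d)) := by
  have hr : ∀ y, ∫⁻ w, expE (h y w) ∂(walkLaw d) = 1 + ∫⁻ w, expOne (h y w) ∂(walkLaw d) := by
    intro y
    simp_rw [expE_eq_one_add]
    rw [lintegral_add_left measurable_const]
    simp
  choose a ha using fun y => expE_surj (y := ∫⁻ w, expE (h y w) ∂(walkLaw d))
    (by rw [hr]; exact le_self_add)
  have hN : ∀ N : Site d → ℕ, ∫⁻ Y, expE (particleSum h (N, Y))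
      ∂(Measure.infinitePi fun _ : Site d × ℕ => walkLaw d) = expE (∑' y, N y * a y) := by
    intro N
    have := lintegral_expE_tsum_infinitePi (walkLaw d)
      (h := fun (q : Site d × ℕ) w => if q.2 < N q.1 then h q.1 w else 0)
      (a := fun q => if q.2 < N q.1 then a q.1 else 0)
      (fun q => by split_ifs; exacts [hh _, measurable_const])
      (fun q => by split_ifs; exacts [(ha q.1).symm, by simp [expE_zero]])
    simp only [particleSum]
    refine this.trans ?_
    rw [ENNReal.tsum_prod (f := fun y k => if k < N y then a y else 0)]
    congr 1
    refine tsum_congr fun y => ?_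
    rw [tsum_eq_sum (s := Finset.range (N y))]
    · rw [Finset.sum_congr rfl fun k hk => if_pos (Finset.mem_range.1 hk)]
      simp
    · intro k hk
      exact if_neg (by simpa using hk)
  have hm : Measurable fun c => expE (particleSum h c) :=
    measurable_expE.comp (measurable_particleSum hh)
  rw [catalystLaw, lintegral_prod _ hm.aemeasurable]
  simp_rw [hN]
  rw [lintegral_expE_tsum_infinitePi (poissonMeasure ρ) (h := fun y n => (n : ℝ≥0∞) * a y)
    (fun y => measurable_of_countable _)
    (fun y => lintegral_expE_poisson ρ ((ha y).trans (hr y))), ENNReal.tsum_mul_left]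

/-- Positive correlation of exponentials of additive functionals of the Poisson field, from the
superadditivity of `exp x - 1`. -/
lemma lintegral_expE_particleSum_mul_le (ρ : ℝ≥0) {h h' : Site d → WalkData d → ℝ≥0∞}
    (hh : ∀ y, Measurable (h y)) (hh' : ∀ y, Measurable (h' y)) :
    (∫⁻ c, expE (particleSum h c) ∂(catalystLaw d ρ)) *
      ∫⁻ c, expE (particleSum h' c) ∂(catalystLaw d ρ) ≤
      ∫⁻ c, expE (particleSum h c) * expE (particleSum h' c) ∂(catalystLaw d ρ) := by
  have hsum : ∀ c : CatalystData d, expE (particleSum h c) * expE (particleSum h' c) =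
      expE (particleSum (fun y w => h y w + h' y w) c) := by
    intro c
    rw [← expE_add, particleSum, particleSum, ← ENNReal.tsum_add, particleSum]
    congr 1
    refine tsum_congr fun q => ?_
    split_ifs <;> simp
  simp_rw [hsum]
  rw [lintegral_expE_particleSum ρ hh, lintegral_expE_particleSum ρ hh',
    lintegral_expE_particleSum ρ (h := fun y w => h y w + h' y w)
      (fun y => (hh y).add (hh' y)), ← expE_add, ← mul_add,
    ← ENNReal.tsum_add]
  refine expE_mono ?_
  gcongr with y
  rw [← lintegral_add_left (f := fun w => expOne (h y w)) (measurable_expOne.comp (hh y))]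
  exact lintegral_mono fun w => expOne_add_le _ _

lemma lintegral_prod_weight (ρ : ℝ≥0) {p : ℕ} (γ b t : ℝ) {x : Fin p → ℝ → Site d}
    (hx : ∀ q, Measurable (x q)) :
    ∫⁻ c, ∏ q, weight γ b t (x q) c ∂(catalystLaw d ρ) =
      expE (ρ * ∑' y, ∫⁻ w, expOne (∑ q, occ γ b t (x q) y w) ∂(walkLaw d)) := by
  simp_rw [prod_weight_eq γ b t hx]
  exact lintegral_expE_particleSum ρ fun y =>
    Finset.measurable_fun_sum _ fun q _ => measurable_occ_right γ b t (hx q) y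

/-- The catalyst is stationary in time: sums over the starting points of the particles do not see
their displacement by time `b`. -/
lemma lintegral_prod_weight_shift (ρ : ℝ≥0) {p : ℕ} (γ t : ℝ) {b : ℝ} (hb : 0 ≤ b)
    {x : Fin p → ℝ → Site d} (hx : ∀ q, Measurable (x q)) :
    ∫⁻ c, ∏ q, weight γ b t (x q) c ∂(catalystLaw d ρ) =
      ∫⁻ c, ∏ q, weight γ 0 t (x q) c ∂(catalystLaw d ρ) := by
  rw [lintegral_prod_weight ρ γ b t hx, lintegral_prod_weight ρ γ 0 t hx]
  have hm : ∀ b y, Measurable fun w => expOne (∑ q, occ γ b t (x q) y w) := fun b y =>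
    measurable_expOne.comp
      (Finset.measurable_fun_sum _ fun q _ => measurable_occ_right γ b t (hx q) y)
  congr 2
  rw [← lintegral_tsum fun y => (hm _ y).aemeasurable,
    ← lintegral_tsum fun y => (hm _ y).aemeasurable,
    ← lintegral_shift hb (Measurable.tsum fun y => hm 0 y)]
  refine lintegral_congr_ae ?_
  filter_upwards [ae_regular] with w hw
  have hocc : ∀ y q, occ γ b t (x q) y w = occ γ 0 t (x q) (y + pos w b) (shift b w) := by
    intro y q
    rw [occ, occ]
    congr 1
    refine setLIntegral_congr_fun measurableSet_Icc fun s hs => ?_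
    simp only [zero_add]
    rw [hw.pos_add hb (sub_nonneg.2 hs.2), add_assoc]
  simp_rw [hocc]
  exact (Equiv.addRight (pos w b)).tsum_eq
    fun y => expOne (∑ q, occ γ 0 t (x q) y (shift b w))

/-- The moments of the solution are finite, uniformly in the reactant paths. -/
lemma exists_lintegral_prod_weight_le (ρ : ℝ≥0) (p : ℕ) (γ b t : ℝ) :
    ∃ C : ℝ≥0∞, C ≠ ∞ ∧ ∀ x : Fin p → ℝ → Site d, (∀ q, Measurable (x q)) →
      ∫⁻ c, ∏ q, weight γ b t (x q) c ∂(catalystLaw d ρ) ≤ C := by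
  set L : ℝ≥0∞ := p * (ENNReal.ofReal γ * ENNReal.ofReal t) with hL
  have hLtop : L ≠ ∞ := ENNReal.mul_ne_top (ENNReal.natCast_ne_top p)
    (ENNReal.mul_ne_top ENNReal.ofReal_ne_top ENNReal.ofReal_ne_top)
  refine ⟨expE (ρ * (L * expE L)), expE_ne_top (ENNReal.mul_ne_top ENNReal.coe_ne_top
    (ENNReal.mul_ne_top hLtop (expE_ne_top hLtop))), fun x hx => ?_⟩
  rw [lintegral_prod_weight ρ γ b t hx]
  refine expE_mono ?_
  gcongr
  have hm : ∀ y, Measurable fun w => ∑ q, occ γ b t (x q) y w := fun y =>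
    Finset.measurable_fun_sum _ fun q _ => measurable_occ_right γ b t (hx q) y
  have hsum : ∀ w, ∑' y, ∑ q, occ γ b t (x q) y w = L := by
    intro w
    rw [Summable.tsum_finsetSum fun _ _ => ENNReal.summable]
    simp [tsum_occ γ b t (hx _), hL]
  have hm' : ∀ y, Measurable fun w => expOne (∑ q, occ γ b t (x q) y w) := fun y =>
    measurable_expOne.comp (hm y)
  rw [← lintegral_tsum fun y => (hm' y).aemeasurable]
  calc ∫⁻ w, ∑' y, expOne (∑ q, occ γ b t (x q) y w) ∂(walkLaw d)
      ≤ ∫⁻ w, L * expE L ∂(walkLaw d) := by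
        refine lintegral_mono fun w => ?_
        calc ∑' y, expOne (∑ q, occ γ b t (x q) y w)
            ≤ ∑' y, (∑ q, occ γ b t (x q) y w) * expE L := by
              refine ENNReal.tsum_le_tsum fun y => (expOne_le_mul _).trans ?_
              gcongr
              refine expE_mono ?_
              rw [← hsum w]
              exact ENNReal.le_tsum y
          _ = L * expE L := by rw [ENNReal.tsum_mul_right, hsum w]
    _ = L * expE L := by simp

end

section

/-! ### Completely positive kernels -/

lemma lintegral_mul_sq_le {α : Type*} [MeasurableSpace α] (μ : Measure α) {f g : α → ℝ≥0∞}
    (hf : Measurable f) (hg : Measurable g) :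
    (∫⁻ a, f a * g a ∂μ) ^ 2 ≤ (∫⁻ a, f a ^ 2 ∂μ) * ∫⁻ a, g a ^ 2 ∂μ := by
  have h := ENNReal.lintegral_mul_le_Lp_mul_Lq μ (p := 2) (q := 2)
    Real.HolderConjugate.two_two hf.aemeasurable hg.aemeasurable
  simp only [Pi.mul_apply, ENNReal.rpow_two] at h
  calc (∫⁻ a, f a * g a ∂μ) ^ 2
      ≤ ((∫⁻ a, f a ^ 2 ∂μ) ^ (1 / 2 : ℝ) * (∫⁻ a, g a ^ 2 ∂μ) ^ (1 / 2 : ℝ)) ^ 2 := by gcongr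
    _ = _ := by
      rw [mul_pow, ← ENNReal.rpow_two, ← ENNReal.rpow_two, ← ENNReal.rpow_mul,
        ← ENNReal.rpow_mul]
      norm_num

lemma tsum_mul_sq_le {ι : Type*} (f g : ι → ℝ≥0∞) :
    (∑' i, f i * g i) ^ 2 ≤ (∑' i, f i ^ 2) * ∑' i, g i ^ 2 := by
  let _ : MeasurableSpace ι := ⊤
  have _ : DiscreteMeasurableSpace ι := ⟨fun _ => trivial⟩
  have h := lintegral_mul_sq_le (Measure.count : Measure ι) (f := f) (g := g)
    (fun _ _ => trivial) (fun _ _ => trivial)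
  simpa only [lintegral_count] using h

/-- A kernel is completely positive if it is a superposition of products `f a * f b` with
nonnegative `f`. The superposition is written as a countable sum of integrals, which makes the class
visibly closed under countable sums and products. -/
def IsCompletelyPositive {S : Type*} [MeasurableSpace S] (K : S → S → ℝ≥0∞) : Prop :=
  ∃ (ι : Type) (_ : Countable ι) (Ω : ι → Type) (_ : ∀ i, MeasurableSpace (Ω i))
    (M : ∀ i, Measure (Ω i)) (_ : ∀ i, SFinite (M i)) (f : ∀ i, S → Ω i → ℝ≥0∞),
    (∀ i, Measurable fun v : S × Ω i => f i v.1 v.2) ∧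
      ∀ a b, K a b = ∑' i, ∫⁻ ω, f i a ω * f i b ω ∂(M i)

namespace IsCompletelyPositive

variable {S : Type*} [MeasurableSpace S]

lemma of_lintegral {K : S → S → ℝ≥0∞} {Ω : Type} [MeasurableSpace Ω] (M : Measure Ω) [SFinite M]
    (f : S → Ω → ℝ≥0∞) (hf : Measurable fun v : S × Ω => f v.1 v.2)
    (hK : ∀ a b, K a b = ∫⁻ ω, f a ω * f b ω ∂M) : IsCompletelyPositive K :=
  ⟨Unit, inferInstance, fun _ => Ω, fun _ => inferInstance, fun _ => M, fun _ => inferInstance,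
    fun _ => f, fun _ => hf, fun a b => by simp [hK]⟩

lemma const (c : ℝ≥0∞) : IsCompletelyPositive fun _ _ : S => c :=
  of_lintegral (c • Measure.dirac ()) (fun _ _ => 1) measurable_const (by simp)

lemma mul {K K' : S → S → ℝ≥0∞} (h : IsCompletelyPositive K) (h' : IsCompletelyPositive K') :
    IsCompletelyPositive fun a b => K a b * K' a b := by
  obtain ⟨ι, _, Ω, _, M, _, f, hf, hK⟩ := h
  obtain ⟨ι', _, Ω', _, M', _, f', hf', hK'⟩ := h'
  have hfa : ∀ i a, Measurable (f i a) := fun i a => (hf i).comp measurable_prodMk_left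
  have hfa' : ∀ i a, Measurable (f' i a) := fun i a => (hf' i).comp measurable_prodMk_left
  refine ⟨ι × ι', inferInstance, fun i => Ω i.1 × Ω' i.2, fun i => inferInstance,
    fun i => (M i.1).prod (M' i.2), fun i => inferInstance,
    fun i a ω => f i.1 a ω.1 * f' i.2 a ω.2, fun i => ?_, fun a b => ?_⟩
  · have h1 : Measurable fun v : S × (Ω i.1 × Ω' i.2) => (v.1, v.2.1) := by fun_prop
    have h2 : Measurable fun v : S × (Ω i.1 × Ω' i.2) => (v.1, v.2.2) := by fun_prop
    exact ((hf i.1).comp h1).mul ((hf' i.2).comp h2)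
  · beta_reduce
    rw [hK, hK', ENNReal.tsum_prod', ← ENNReal.tsum_mul_right]
    refine tsum_congr fun i => ?_
    rw [← ENNReal.tsum_mul_left]
    refine tsum_congr fun j => ?_
    refine (lintegral_prod_mul ((hfa i a).mul (hfa i b)).aemeasurable
      ((hfa' j a).mul (hfa' j b)).aemeasurable).symm.trans (lintegral_congr fun ω => ?_)
    simp only [Pi.mul_apply]
    ring

lemma pow {K : S → S → ℝ≥0∞} (h : IsCompletelyPositive K) (n : ℕ) :
    IsCompletelyPositive fun a b => K a b ^ n := by
  induction n with
  | zero => simpa using const 1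
  | succ n ih => simpa only [pow_succ] using ih.mul h

lemma tsum {K : ℕ → S → S → ℝ≥0∞} (h : ∀ n, IsCompletelyPositive (K n)) :
    IsCompletelyPositive fun a b => ∑' n, K n a b := by
  choose ι hι Ω hΩ M hM f hf hK using h
  refine ⟨Σ n, ι n, inferInstance, fun i => Ω i.1 i.2, fun i => hΩ i.1 i.2, fun i => M i.1 i.2,
    fun i => hM i.1 i.2, fun i => f i.1 i.2, fun i => hf i.1 i.2, fun a b => ?_⟩
  rw [ENNReal.tsum_sigma']
  exact tsum_congr fun n => hK n a b

lemma const_mul {K : S → S → ℝ≥0∞} (h : IsCompletelyPositive K) (c : ℝ≥0∞) :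
    IsCompletelyPositive fun a b => c * K a b := (const c).mul h

lemma exp {K : S → S → ℝ≥0∞} (h : IsCompletelyPositive K) :
    IsCompletelyPositive fun a b => expE (K a b) := by
  simp_rw [expE_eq_tsum]
  exact tsum fun n => (h.pow n).const_mul _

/-- Cauchy-Schwarz inequality for the bilinear form of a completely positive kernel. -/
lemma lintegral_sq_le {K : S → S → ℝ≥0∞} (h : IsCompletelyPositive K) (μ ν : Measure S) [SFinite μ]
    [SFinite ν] : (∫⁻ a, ∫⁻ b, K a b ∂ν ∂μ) ^ 2 ≤
      (∫⁻ a, ∫⁻ b, K a b ∂μ ∂μ) * ∫⁻ a, ∫⁻ b, K a b ∂ν ∂ν := by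
  obtain ⟨ι, _, Ω, _, M, _, f, hf, hK⟩ := h
  have hfω : ∀ i ω, Measurable fun a => f i a ω := fun i ω => (hf i).comp measurable_prodMk_right
  have hfa : ∀ i a, Measurable (f i a) := fun i a => (hf i).comp measurable_prodMk_left
  have hint : ∀ (μ : Measure S) [SFinite μ] i, Measurable fun ω => ∫⁻ a, f i a ω ∂μ :=
    fun μ _ i => (hf i).lintegral_prod_left'
  have key : ∀ (μ ν : Measure S) [SFinite μ] [SFinite ν], ∫⁻ a, ∫⁻ b, K a b ∂ν ∂μ =
      ∑' i, ∫⁻ ω, (∫⁻ a, f i a ω ∂μ) * ∫⁻ b, f i b ω ∂ν ∂(M i) := by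
    intro μ ν _ _
    have h1 : ∀ a, ∫⁻ b, K a b ∂ν = ∑' i, ∫⁻ ω, f i a ω * ∫⁻ b, f i b ω ∂ν ∂(M i) := by
      intro a
      simp_rw [hK]
      have hm : ∀ i, Measurable fun v : S × Ω i => f i a v.2 * f i v.1 v.2 := fun i =>
        ((hfa i a).comp measurable_snd).mul (hf i)
      rw [lintegral_tsum fun i => (hm i).lintegral_prod_right'.aemeasurable]
      refine tsum_congr fun i => ?_
      rw [lintegral_lintegral_swap (hm i).aemeasurable]
      refine lintegral_congr fun ω => ?_
      exact lintegral_const_mul (f i a ω) (hfω i ω)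
    simp_rw [h1]
    have hm : ∀ i, Measurable fun v : S × Ω i => f i v.1 v.2 * ∫⁻ b, f i b v.2 ∂ν := fun i =>
      (hf i).mul ((hint ν i).comp measurable_snd)
    rw [lintegral_tsum fun i => (hm i).lintegral_prod_right'.aemeasurable]
    refine tsum_congr fun i => ?_
    rw [lintegral_lintegral_swap (hm i).aemeasurable]
    refine lintegral_congr fun ω => ?_
    exact lintegral_mul_const (∫⁻ b, f i b ω ∂ν) (hfω i ω)
  rw [key, key, key]
  simp_rw [← pow_two]
  set F : ι → ℝ≥0∞ := fun i => ∫⁻ ω, (∫⁻ a, f i a ω ∂μ) ^ 2 ∂(M i)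
  set G : ι → ℝ≥0∞ := fun i => ∫⁻ ω, (∫⁻ a, f i a ω ∂ν) ^ 2 ∂(M i)
  have hsq : ∀ x : ℝ≥0∞, (x ^ (1 / 2 : ℝ)) ^ 2 = x := fun x => by
    rw [← ENNReal.rpow_two, ← ENNReal.rpow_mul]; norm_num
  have hle : ∀ i, ∫⁻ ω, (∫⁻ a, f i a ω ∂μ) * ∫⁻ b, f i b ω ∂ν ∂(M i) ≤
      F i ^ (1 / 2 : ℝ) * G i ^ (1 / 2 : ℝ) := by
    intro i
    rw [← ENNReal.mul_rpow_of_nonneg _ _ (by norm_num : (0 : ℝ) ≤ 1 / 2)]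
    have h := lintegral_mul_sq_le (M i) (hint μ i) (hint ν i)
    calc ∫⁻ ω, (∫⁻ a, f i a ω ∂μ) * ∫⁻ b, f i b ω ∂ν ∂(M i)
        = ((∫⁻ ω, (∫⁻ a, f i a ω ∂μ) * ∫⁻ b, f i b ω ∂ν ∂(M i)) ^ 2) ^ (1 / 2 : ℝ) := by
          rw [← ENNReal.rpow_two, ← ENNReal.rpow_mul]; norm_num
      _ ≤ _ := ENNReal.rpow_le_rpow h (by norm_num)
  calc (∑' i, ∫⁻ ω, (∫⁻ a, f i a ω ∂μ) * ∫⁻ b, f i b ω ∂ν ∂(M i)) ^ 2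
      ≤ (∑' i, F i ^ (1 / 2 : ℝ) * G i ^ (1 / 2 : ℝ)) ^ 2 := by
        gcongr with i
        exact hle i
    _ ≤ _ := tsum_mul_sq_le _ _
    _ = _ := by simp_rw [hsq]

end IsCompletelyPositive

/-! ### Complete positivity of the moment kernel -/

variable {d : ℕ}

/-- Summing over the starting point of a catalyst particle decouples the two halves `α`, `β` of a
difference, up to the shape of `α`. -/
lemma tsum_prod_ite_eq {n : ℕ} (α β : Fin (n + 1) → Site d) :
    ∑' y : Site d, ∏ i, (if y + α i = β i then (1 : ℝ≥0∞) else 0) =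
      ∑' z : Fin (n + 1) → Site d, (if ∀ i, α i - α 0 = z i then 1 else 0) *
        (if ∀ i, β i - β 0 = z i then 1 else 0) := by
  have hprod : ∀ y : Site d, ∏ i, (if y + α i = β i then (1 : ℝ≥0∞) else 0) =
      if ∀ i, y + α i = β i then 1 else 0 := by
    intro y
    split_ifs with h
    · exact Finset.prod_eq_one fun i _ => if_pos (h i)
    · push Not at h
      obtain ⟨i, hi⟩ := h
      exact Finset.prod_eq_zero (Finset.mem_univ i) (if_neg hi)
  simp_rw [hprod]
  rw [tsum_eq_single (β 0 - α 0), tsum_eq_single (fun i => α i - α 0)]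
  · simp only [implies_true, if_true, one_mul]
    congr 1
    refine propext (forall_congr' fun i => ?_)
    constructor <;> intro h
    · rw [← h]; abel
    · rw [sub_add_comm, ← h]; abel
  · intro z hz
    have : ¬ ∀ i, α i - α 0 = z i := fun h => hz (funext fun i => (h i).symm)
    simp [this]
  · intro y hy
    exact if_neg fun h => hy (eq_sub_of_add_eq (h 0))

/-- The measure on labelled times with respect to which the local times are integrals. -/
def timeMeasure (p : ℕ) (γ t : ℝ) : Measure (Fin p × ℝ) :=
  Measure.count.prod (ENNReal.ofReal γ • volume.restrict (Set.Icc 0 t))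

instance (γ t : ℝ) : IsFiniteMeasure (ENNReal.ofReal γ • volume.restrict (Set.Icc 0 t)) :=
  Measure.smul_finite _ ENNReal.ofReal_ne_top

instance (p : ℕ) (γ t : ℝ) : IsFiniteMeasure (timeMeasure p γ t) := by
  unfold timeMeasure; infer_instance

lemma ae_timeMeasure (p : ℕ) (γ t : ℝ) : ∀ᵐ σ ∂(timeMeasure p γ t), σ.2 ∈ Set.Icc 0 t := by
  have h : ∀ᵐ s ∂(ENNReal.ofReal γ • volume.restrict (Set.Icc 0 t)), s ∈ Set.Icc 0 t :=
    Measure.ae_smul_measure (ae_restrict_mem measurableSet_Icc) _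
  exact (Measure.quasiMeasurePreserving_snd (μ := (Measure.count : Measure (Fin p)))).ae h

lemma measurable_uncurry_path {α : Type*} [MeasurableSpace α] {p : ℕ} {x : α → Fin p → ℝ → Site d}
    (hx : ∀ q, Measurable fun v : α × ℝ => x v.1 q v.2) :
    Measurable fun v : α × (Fin p × ℝ) => x v.1 v.2.1 v.2.2 := by
  have h1 : Measurable fun v : Fin p × (α × ℝ) => x v.2.1 v.1 v.2.2 :=
    measurable_from_prod_countable_right hx
  have h2 : Measurable fun v : α × (Fin p × ℝ) => (v.2.1, (v.1, v.2.2)) := by fun_prop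
  exact h1.comp h2

lemma sum_occ_eq {p : ℕ} (γ t : ℝ) {x : Fin p → ℝ → Site d} (hx : ∀ q, Measurable (x q))
    (y : Site d) (w : WalkData d) : ∑ q, occ γ 0 t (x q) y w =
      ∫⁻ σ, (if y + pos w (t - σ.2) = x σ.1 σ.2 then 1 else 0) ∂(timeMeasure p γ t) := by
  have hx' : Measurable fun v : Fin p × ℝ => x v.1 v.2 := measurable_from_prod_countable_right hx
  have hm : Measurable fun σ : Fin p × ℝ =>
      if y + pos w (t - σ.2) = x σ.1 σ.2 then (1 : ℝ≥0∞) else 0 := by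
    refine Measurable.ite ?_ measurable_const measurable_const
    have h1 : Measurable fun σ : Fin p × ℝ => (w, t - σ.2) := by fun_prop
    exact measurableSet_eq_fun (measurable_const.add (measurable_pos.comp h1)) hx'
  rw [timeMeasure, lintegral_prod _ hm.aemeasurable, lintegral_count, tsum_fintype]
  refine Finset.sum_congr rfl fun q _ => ?_
  rw [lintegral_smul_measure, occ, smul_eq_mul]
  simp_rw [zero_add]

variable [NeZero d]

/-- The probability that the path `a`, seen from an independent walk of rate `1 / 2`, has the shape
`z` at the labelled times `σ`. -/
@[irreducible] def shape {p n : ℕ} (t : ℝ) (a : Fin p → ℝ → Site d) (σ : Fin (n + 1) → Fin p × ℝ)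
    (z : Fin (n + 1) → Site d) : ℝ≥0∞ :=
  ∫⁻ w, (if ∀ i, (walk (1 / 2) w (t - (σ i).2) - a (σ i).1 (σ i).2) -
    (walk (1 / 2) w (t - (σ 0).2) - a (σ 0).1 (σ 0).2) = z i then 1 else 0) ∂(walkLaw d)

lemma measurable_shape {α : Type*} [MeasurableSpace α] {p n : ℕ} (t : ℝ)
    {x : α → Fin p → ℝ → Site d} (hx : ∀ q, Measurable fun v : α × ℝ => x v.1 q v.2) :
    Measurable fun v : α × ((Fin (n + 1) → Fin p × ℝ) × (Fin (n + 1) → Site d)) =>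
      shape t (x v.1) v.2.1 v.2.2 := by
  simp only [shape]
  refine Measurable.lintegral_prod_right' (f := fun u : (α × ((Fin (n + 1) → Fin p × ℝ) ×
    (Fin (n + 1) → Site d))) × WalkData d =>
      if ∀ i, (walk (1 / 2) u.2 (t - (u.1.2.1 i).2) - x u.1.1 (u.1.2.1 i).1 (u.1.2.1 i).2) -
        (walk (1 / 2) u.2 (t - (u.1.2.1 0).2) - x u.1.1 (u.1.2.1 0).1 (u.1.2.1 0).2) = u.1.2.2 i
      then (1 : ℝ≥0∞) else 0) ?_
  have hx' := measurable_uncurry_path hx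
  have hw : ∀ i, Measurable fun u : (α × ((Fin (n + 1) → Fin p × ℝ) ×
      (Fin (n + 1) → Site d))) × WalkData d => walk (1 / 2) u.2 (t - (u.1.2.1 i).2) := fun i => by
    have h : Measurable fun u : (α × ((Fin (n + 1) → Fin p × ℝ) ×
      (Fin (n + 1) → Site d))) × WalkData d => (u.2, t - (u.1.2.1 i).2) := by fun_prop
    simpa only [Function.comp_def] using (measurable_walk (1 / 2)).comp h
  have ha : ∀ i, Measurable fun u : (α × ((Fin (n + 1) → Fin p × ℝ) ×
      (Fin (n + 1) → Site d))) × WalkData d => x u.1.1 (u.1.2.1 i).1 (u.1.2.1 i).2 := fun i => by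
    have h : Measurable fun u : (α × ((Fin (n + 1) → Fin p × ℝ) ×
      (Fin (n + 1) → Site d))) × WalkData d => (u.1.1, u.1.2.1 i) := by fun_prop
    exact hx'.comp h
  refine Measurable.ite ?_ measurable_const measurable_const
  rw [Set.ofPred_forall]
  refine MeasurableSet.iInter fun i => ?_
  exact measurableSet_eq_fun (((hw i).sub (ha i)).sub ((hw 0).sub (ha 0))) (by fun_prop)

/-- Writing the particle path as a difference of two walks of rate `1 / 2`, the expected number of
particles which meet the path `a - b` at all labelled times `σ` splits into products. -/
lemma tsum_lintegral_prod_ite {p n : ℕ} (t : ℝ) (a b : Fin p → ℝ → Site d)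
    {σ : Fin (n + 1) → Fin p × ℝ} (hσ : ∀ i, (σ i).2 ∈ Set.Icc 0 t) :
    ∑' y : Site d, ∫⁻ w, ∏ i, (if y + pos w (t - (σ i).2) = a (σ i).1 (σ i).2 - b (σ i).1 (σ i).2
      then (1 : ℝ≥0∞) else 0) ∂(walkLaw d) = ∑' z, shape t a σ z * shape t b σ z := by
  have hfd := fdd_add_eq_sub (d := d) (r := 1 / 2) (r' := 1 / 2) (by norm_num) (by norm_num)
    (u := fun i => t - (σ i).2) (fun i => sub_nonneg.2 (hσ i).2)
  have hm2 : Measurable fun (x : WalkData d × WalkData d) (i : Fin (n + 1)) =>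
      walk (1 / 2) x.1 (t - (σ i).2) - walk (1 / 2) x.2 (t - (σ i).2) :=
    measurable_pi_iff.2 fun i => ((measurable_walk_right _ _).comp measurable_fst).sub
      ((measurable_walk_right _ _).comp measurable_snd)
  have h1 : ∀ y : Site d, ∫⁻ w, ∏ i, (if y + pos w (t - (σ i).2) =
      a (σ i).1 (σ i).2 - b (σ i).1 (σ i).2 then (1 : ℝ≥0∞) else 0) ∂(walkLaw d) =
      ∫⁻ x, ∏ i, (if y + (walk (1 / 2) x.1 (t - (σ i).2) - a (σ i).1 (σ i).2) =
        walk (1 / 2) x.2 (t - (σ i).2) - b (σ i).1 (σ i).2 then (1 : ℝ≥0∞) else 0)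
        ∂((walkLaw d).prod (walkLaw d)) := by
    intro y
    have hF : Measurable fun v : Fin (n + 1) → Site d => ∏ i, (if y + v i =
      a (σ i).1 (σ i).2 - b (σ i).1 (σ i).2 then (1 : ℝ≥0∞) else 0) := measurable_of_countable _
    have e1 := lintegral_map (μ := walkLaw d) hF
      (measurable_walk_pi (1 / 2 + 1 / 2) fun i => t - (σ i).2)
    have e2 := lintegral_map (μ := (walkLaw d).prod (walkLaw d)) hF hm2
    rw [hfd] at e1
    have e3 := e1.symm.trans e2
    norm_num only [walk_eq_pos, one_mul] at e3 ⊢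
    refine e3.trans (lintegral_congr fun x => Finset.prod_congr rfl fun i _ => ?_)
    congr 1
    refine propext ⟨fun h => ?_, fun h => ?_⟩
    · rw [eq_sub_iff_add_eq] at h ⊢; rw [← sub_eq_zero] at h ⊢; rw [← h]; abel
    · rw [eq_sub_iff_add_eq] at h ⊢; rw [← sub_eq_zero] at h ⊢; rw [← h]; abel
  simp_rw [h1]
  have hmu : ∀ (c : Fin p → ℝ → Site d) (i : Fin (n + 1)), Measurable fun w : WalkData d =>
      walk (1 / 2) w (t - (σ i).2) - c (σ i).1 (σ i).2 := fun c i =>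
    (measurable_walk_right _ _).sub measurable_const
  rw [← lintegral_tsum]
  · simp_rw [tsum_prod_ite_eq]
    have hms : ∀ (c : Fin p → ℝ → Site d) (z : Fin (n + 1) → Site d), Measurable
        fun w : WalkData d => (if ∀ i, (walk (1 / 2) w (t - (σ i).2) - c (σ i).1 (σ i).2) -
          (walk (1 / 2) w (t - (σ 0).2) - c (σ 0).1 (σ 0).2) = z i then (1 : ℝ≥0∞) else 0) := by
      intro c z
      refine Measurable.ite ?_ measurable_const measurable_const
      rw [Set.ofPred_forall]
      exact MeasurableSet.iInter fun i =>
        measurableSet_eq_fun ((hmu c i).sub (hmu c 0)) measurable_const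
    refine (lintegral_tsum fun z => (((hms a z).comp measurable_fst).mul
      ((hms b z).comp measurable_snd)).aemeasurable).trans ?_
    refine tsum_congr fun z => ?_
    simp only [shape]
    exact lintegral_prod_mul (hms a z).aemeasurable (hms b z).aemeasurable
  · intro y
    refine (Finset.measurable_prod _ fun i _ => ?_).aemeasurable
    refine Measurable.ite ?_ measurable_const measurable_const
    exact measurableSet_eq_fun (measurable_const.add ((hmu a i).comp measurable_fst))
      ((hmu b i).comp measurable_snd)

lemma tsum_lintegral_pow {p : ℕ} (n : ℕ) (γ t : ℝ) {a b : Fin p → ℝ → Site d}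
    (ha : ∀ q, Measurable (a q)) (hb : ∀ q, Measurable (b q)) :
    ∑' y : Site d, ∫⁻ w, (∑ q, occ γ 0 t (fun s => a q s - b q s) y w) ^ (n + 1) ∂(walkLaw d) =
      ∫⁻ σ, ∑' z, shape t a σ z * shape t b σ z
        ∂(Measure.pi fun _ : Fin (n + 1) => timeMeasure p γ t) := by
  have ha' : Measurable fun v : Fin p × ℝ => a v.1 v.2 := measurable_from_prod_countable_right ha
  have hb' : Measurable fun v : Fin p × ℝ => b v.1 v.2 := measurable_from_prod_countable_right hb
  have hm : ∀ y : Site d, Measurable fun v : WalkData d × (Fin p × ℝ) =>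
      if y + pos v.1 (t - v.2.2) = a v.2.1 v.2.2 - b v.2.1 v.2.2 then (1 : ℝ≥0∞) else 0 := by
    intro y
    refine Measurable.ite ?_ measurable_const measurable_const
    have h1 : Measurable fun v : WalkData d × (Fin p × ℝ) => (v.1, t - v.2.2) := by fun_prop
    exact measurableSet_eq_fun (measurable_const.add (measurable_pos.comp h1))
      ((ha'.comp measurable_snd).sub (hb'.comp measurable_snd))
  have hm2 : ∀ y : Site d, Measurable fun v : WalkData d × (Fin (n + 1) → Fin p × ℝ) =>
      ∏ i, (if y + pos v.1 (t - (v.2 i).2) = a (v.2 i).1 (v.2 i).2 - b (v.2 i).1 (v.2 i).2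
        then (1 : ℝ≥0∞) else 0) := by
    intro y
    refine Finset.measurable_prod _ fun i _ => ?_
    have h1 : Measurable fun v : WalkData d × (Fin (n + 1) → Fin p × ℝ) => (v.1, v.2 i) := by
      fun_prop
    exact (hm y).comp h1
  have h1 : ∀ y : Site d,
      ∫⁻ w, (∑ q, occ γ 0 t (fun s => a q s - b q s) y w) ^ (n + 1) ∂(walkLaw d) =
      ∫⁻ σ, ∫⁻ w, ∏ i, (if y + pos w (t - (σ i).2) = a (σ i).1 (σ i).2 - b (σ i).1 (σ i).2
        then (1 : ℝ≥0∞) else 0) ∂(walkLaw d)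
        ∂(Measure.pi fun _ : Fin (n + 1) => timeMeasure p γ t) := by
    intro y
    rw [← lintegral_lintegral_swap (hm2 y).aemeasurable]
    refine lintegral_congr fun w => ?_
    rw [sum_occ_eq γ t (x := fun q s => a q s - b q s) (fun q => (ha q).sub (hb q))]
    exact lintegral_pow_eq _ _ ((hm y).comp (measurable_prodMk_left (x := w)))
  simp_rw [h1]
  rw [← lintegral_tsum fun y => (hm2 y).lintegral_prod_left'.aemeasurable]
  refine lintegral_congr_ae ?_
  have hae : ∀ᵐ σ ∂(Measure.pi fun _ : Fin (n + 1) => timeMeasure p γ t),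
      ∀ i, (σ i).2 ∈ Set.Icc 0 t := by
    rw [ae_all_iff]
    exact fun i => (Measure.quasiMeasurePreserving_eval (fun _ => timeMeasure p γ t) i).ae
      (ae_timeMeasure p γ t)
  filter_upwards [hae] with σ hσ
  exact tsum_lintegral_prod_ite t a b hσ

/-- The joint moment of the weights of the differences of two families of paths is a completely
positive kernel: this is the source of all inequalities below. -/
lemma isCompletelyPositive_moment {S : Type*} [MeasurableSpace S] (ρ : ℝ≥0) {p : ℕ} (γ t : ℝ)
    {x : S → Fin p → ℝ → Site d} (hx : ∀ q, Measurable fun v : S × ℝ => x v.1 q v.2) :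
    IsCompletelyPositive fun a b : S =>
      ∫⁻ c, ∏ q, weight γ 0 t (fun s => x a q s - x b q s) c ∂(catalystLaw d ρ) := by
  have hxa : ∀ a q, Measurable (x a q) := fun a q => (hx q).comp measurable_prodMk_left
  have hn : ∀ n : ℕ, IsCompletelyPositive fun a b : S => ∑' y : Site d, ∫⁻ w,
      (∑ q, occ γ 0 t (fun s => x a q s - x b q s) y w) ^ (n + 1) ∂(walkLaw d) := by
    intro n
    have hs := measurable_shape (n := n) t hx
    refine IsCompletelyPositive.of_lintegral
      ((Measure.pi fun _ : Fin (n + 1) => timeMeasure p γ t).prod Measure.count)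
      (fun a v => shape t (x a) v.1 v.2) hs fun a b => ?_
    have hsa : ∀ a, Measurable fun v : (Fin (n + 1) → Fin p × ℝ) × (Fin (n + 1) → Site d) =>
      shape t (x a) v.1 v.2 := fun a => hs.comp measurable_prodMk_left
    rw [tsum_lintegral_pow n γ t (hxa a) (hxa b),
      lintegral_prod (fun v : (Fin (n + 1) → Fin p × ℝ) × (Fin (n + 1) → Site d) =>
        shape t (x a) v.1 v.2 * shape t (x b) v.1 v.2) ((hsa a).mul (hsa b)).aemeasurable]
    simp_rw [lintegral_count]
  have hocc : ∀ a b y, Measurable fun w : WalkData d =>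
      ∑ q, occ γ 0 t (fun s => x a q s - x b q s) y w := fun a b y =>
    Finset.measurable_fun_sum _ fun q _ =>
      measurable_occ_right γ 0 t ((hxa a q).sub (hxa b q)) y
  have hsum : ∀ a b : S, ∑' y : Site d, ∫⁻ w,
      expOne (∑ q, occ γ 0 t (fun s => x a q s - x b q s) y w) ∂(walkLaw d) =
      ∑' n : ℕ, ((n + 1).factorial : ℝ≥0∞)⁻¹ * ∑' y : Site d, ∫⁻ w,
        (∑ q, occ γ 0 t (fun s => x a q s - x b q s) y w) ^ (n + 1) ∂(walkLaw d) := by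
    intro a b
    simp_rw [expOne, ← ENNReal.tsum_mul_left]
    rw [ENNReal.tsum_comm]
    refine tsum_congr fun y => ?_
    rw [lintegral_tsum fun n => (((hocc a b y).pow_const _).const_mul _).aemeasurable]
    refine tsum_congr fun n => ?_
    rw [lintegral_const_mul _ ((hocc a b y).pow_const _)]
  have := ((IsCompletelyPositive.tsum fun n => (hn n).const_mul
    ((n + 1).factorial : ℝ≥0∞)⁻¹).const_mul (ρ : ℝ≥0∞)).exp
  convert this using 3 with a b
  rw [lintegral_prod_weight ρ γ 0 t (x := fun q s => x a q s - x b q s)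
    fun q => (hxa a q).sub (hxa b q), hsum]

end

section

/-! ### The tilted solution -/

variable {d : ℕ}

-- Unfolding these is never useful below and makes unification in measurability proofs expensive.
attribute [local irreducible] walk catalyst

lemma Measurable.walk_comp {α : Type*} [MeasurableSpace α] (r : ℝ) {f : α → WalkData d} {g : α → ℝ}
    (hf : Measurable f) (hg : Measurable g) : Measurable fun a => walk r (f a) (g a) := by
  simpa only [Function.comp_def] using (measurable_walk r).comp (hf.prodMk hg)

lemma Measurable.apply_site {α : Type*} [MeasurableSpace α] {f : α → Site d} (hf : Measurable f)
    (φ : Site d → ℝ≥0∞) : Measurable fun a => φ (f a) := by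
  simpa only [Function.comp_def] using (measurable_of_countable φ).comp hf

lemma Measurable.weight_comp {α : Type*} [MeasurableSpace α] (γ b t : ℝ) {f : α → ℝ → Site d}
    {g : α → CatalystData d} (hf : Measurable fun v : α × ℝ => f v.1 v.2) (hg : Measurable g) :
    Measurable fun a => weight γ b t (f a) (g a) := by
  simpa only [Function.comp_def] using (measurable_weight γ b t hf).comp (measurable_id'.prodMk hg)

lemma measurable_walk_path (r : ℝ) (w : WalkData d) : Measurable (walk r w) :=
  Measurable.walk_comp r measurable_const measurable_id

lemma one_le_weight (γ b t : ℝ) (x : ℝ → Site d) (c : CatalystData d) : 1 ≤ weight γ b t x c := by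
  rw [weight]; exact one_le_expE _

lemma measurable_tilted_integrand (γ r b t : ℝ) (φ : Site d → ℝ≥0∞) {α : Type*}
    [MeasurableSpace α] {f : α → WalkData d} {g : α → CatalystData d} (hf : Measurable f)
    (hg : Measurable g) :
    Measurable fun a => weight γ b t (walk r (f a)) (g a) * φ (walk r (f a) t) :=
  (Measurable.weight_comp γ b t
    (f := fun a => walk r (f a))
    (Measurable.walk_comp r (f := fun v : α × ℝ => f v.1) (hf.comp measurable_fst)
      measurable_snd) hg).mul
      (Measurable.apply_site (Measurable.walk_comp r hf measurable_const) φ)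

variable [NeZero d]

/-- The Feynman-Kac expectation for a reactant of total jump rate `r` in the catalyst time window
`[b, b + t]`, with the final position of the reactant weighted by `φ`. -/
def tilted (γ r b t : ℝ) (φ : Site d → ℝ≥0∞) (c : CatalystData d) : ℝ≥0∞ :=
  ∫⁻ w, weight γ b t (walk r w) c * φ (walk r w t) ∂(walkLaw d)

lemma measurable_tilted (γ r b t : ℝ) (φ : Site d → ℝ≥0∞) : Measurable (tilted γ r b t φ) :=
  Measurable.lintegral_prod_left' (f := fun z : WalkData d × CatalystData d =>
    weight γ b t (walk r z.1) z.2 * φ (walk r z.1 t))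
    (measurable_tilted_integrand γ r b t φ measurable_fst measurable_snd)

lemma reactant_eq_tilted (κ γ t : ℝ) (c : CatalystData d) :
    reactant κ γ c 0 t = tilted γ (2 * d * κ) 0 t (fun _ => 1) c := by
  simp only [reactant, tilted, weight, zero_add, mul_one]
  rfl

/-- The walk of rate `r₁ + r₂` may be replaced by a difference of independent walks. -/
lemma lintegral_weight_add {r₁ r₂ : ℝ} (h₁ : 0 ≤ r₁) (h₂ : 0 ≤ r₂) (γ b : ℝ) {t : ℝ} (ht : 0 ≤ t)
    {η : ℝ → Site d} (hη : Measurable η) (φ : Site d → ℝ≥0∞) (c : CatalystData d) :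
    ∫⁻ w, weight γ b t (fun s => walk (r₁ + r₂) w s - η s) c * φ (walk (r₁ + r₂) w t)
      ∂(walkLaw d) =
    ∫⁻ w, ∫⁻ w', weight γ b t (fun s => walk r₁ w s - walk r₂ w' s - η s) c *
      φ (walk r₁ w t - walk r₂ w' t) ∂(walkLaw d) ∂(walkLaw d) := by
  have hX₂ : Measurable fun x : (WalkData d × WalkData d) × ℝ =>
      walk r₁ x.1.1 x.2 - walk r₂ x.1.2 x.2 := by
    have h1 := Measurable.walk_comp (α := (WalkData d × WalkData d) × ℝ) r₁
      (f := fun x => x.1.1) (g := fun x => x.2) (by fun_prop) (by fun_prop)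
    have h2 := Measurable.walk_comp (α := (WalkData d × WalkData d) × ℝ) r₂
      (f := fun x => x.1.2) (g := fun x => x.2) (by fun_prop) (by fun_prop)
    exact h1.sub h2
  obtain ⟨g, hg⟩ : ∃ g : ℝ → Site d → ℝ≥0∞, ∀ s z,
      g s z = ENNReal.ofReal γ * (catalyst c (z - η s) (b + (t - s)) : ℝ≥0∞) := ⟨_, fun _ _ => rfl⟩
  have hgm : Measurable fun x : ℝ × Site d => g x.1 x.2 := by
    have h : Measurable fun x : ℝ × Site d => (c, x.2 - η x.1, b + (t - x.1)) :=
      measurable_const.prodMk ((measurable_snd.sub (hη.comp measurable_fst)).prodMk (by fun_prop))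
    simp_rw [hg]
    exact (measurable_catalyst.comp h).const_mul _
  have key := lintegral_expE_congr (walkLaw d) ((walkLaw d).prod (walkLaw d))
    (X₁ := fun w => walk (r₁ + r₂) w) (X₂ := fun x s => walk r₁ x.1 s - walk r₂ x.2 s)
    (measurable_walk (r₁ + r₂)) hX₂ (T := Set.Icc 0 t) measurableSet_Icc
    (fun n u hu => fdd_add_eq_sub h₁ h₂ fun i => (hu i).1) hgm (t := t) ⟨ht, le_rfl⟩
    (measurable_of_countable φ)
  have hφ : Measurable fun x : WalkData d × WalkData d =>
      φ (walk r₁ x.1 t - walk r₂ x.2 t) :=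
    Measurable.apply_site ((Measurable.walk_comp r₁ measurable_fst measurable_const).sub
      (Measurable.walk_comp r₂ measurable_snd measurable_const)) φ
  have hw : ∀ x : ℝ → Site d, Measurable x → weight γ b t (fun s => x s - η s) c =
      expE (∫⁻ s in Set.Icc 0 t, g s (x s)) := by
    intro x hx
    have h : Measurable fun s : ℝ => (c, x s - η s, b + (t - s)) :=
      measurable_const.prodMk ((hx.sub hη).prodMk (by fun_prop))
    have h' : Measurable fun s : ℝ => (catalyst c (x s - η s) (b + (t - s)) : ℝ≥0∞) := by
      simpa only [Function.comp_def] using measurable_catalyst.comp h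
    simp_rw [hg]
    rw [weight, lintegral_const_mul _ h']
  have e1 : ∀ w : WalkData d, weight γ b t (fun s => walk (r₁ + r₂) w s - η s) c =
      expE (∫⁻ s in Set.Icc 0 t, g s (walk (r₁ + r₂) w s)) := fun w =>
    hw _ (measurable_walk_path _ _)
  have e2 : ∀ w w' : WalkData d, weight γ b t (fun s => walk r₁ w s - walk r₂ w' s - η s) c =
      expE (∫⁻ s in Set.Icc 0 t, g s (walk r₁ w s - walk r₂ w' s)) := fun w w' =>
    hw _ ((measurable_walk_path r₁ w).sub (measurable_walk_path r₂ w'))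
  simp_rw [e1, e2]
  refine key.trans (lintegral_prod _ (Measurable.aemeasurable ?_))
  refine Measurable.mul ?_ hφ
  have h3 : Measurable fun v : (WalkData d × WalkData d) × ℝ =>
      g v.2 (walk r₁ v.1.1 v.2 - walk r₂ v.1.2 v.2) := hgm.comp (measurable_snd.prodMk hX₂)
  exact measurable_expE.comp h3.lintegral_prod_right'

/-- `p`-th moments in terms of `p` independent copies of the reactant. -/
lemma lintegral_tilted_pow (ρ : ℝ≥0) (p : ℕ) (γ r b t : ℝ) (φ : Site d → ℝ≥0∞) :
    ∫⁻ c, tilted γ r b t φ c ^ p ∂(catalystLaw d ρ) =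
      ∫⁻ W, (∏ q, φ (walk r (W q) t)) * ∫⁻ c, ∏ q, weight γ b t (walk r (W q)) c
        ∂(catalystLaw d ρ) ∂(Measure.pi fun _ : Fin p => walkLaw d) := by
  have h1 : ∀ c, tilted γ r b t φ c ^ p = ∫⁻ W : Fin p → WalkData d,
      ∏ q, (weight γ b t (walk r (W q)) c * φ (walk r (W q) t))
        ∂(Measure.pi fun _ : Fin p => walkLaw d) := fun c =>
    lintegral_pow_eq _ _ (measurable_tilted_integrand γ r b t φ measurable_id measurable_const)
  simp_rw [h1]
  refine (lintegral_lintegral_swap (Measurable.aemeasurable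
    (Finset.measurable_prod _ fun q _ =>
      measurable_tilted_integrand γ r b t φ (by fun_prop) measurable_fst))).trans ?_
  refine lintegral_congr fun W => ?_
  simp_rw [Finset.prod_mul_distrib]
  rw [lintegral_mul_const _ (Finset.measurable_prod _ fun q _ =>
    measurable_weight_right γ b t (measurable_walk_path r (W q))), mul_comm]

lemma lintegral_tilted_pow_shift (ρ : ℝ≥0) (p : ℕ) (γ r t : ℝ) {b : ℝ} (hb : 0 ≤ b)
    (φ : Site d → ℝ≥0∞) : ∫⁻ c, tilted γ r b t φ c ^ p ∂(catalystLaw d ρ) =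
      ∫⁻ c, tilted γ r 0 t φ c ^ p ∂(catalystLaw d ρ) := by
  rw [lintegral_tilted_pow, lintegral_tilted_pow]
  refine lintegral_congr fun W => ?_
  rw [lintegral_prod_weight_shift ρ γ t hb fun q => measurable_walk_path r (W q)]

lemma lintegral_tilted_pow_ne_top (ρ : ℝ≥0) (p : ℕ) (γ r b t : ℝ) {φ : Site d → ℝ≥0∞}
    (hφ : ∀ x, φ x ≤ 1) : ∫⁻ c, tilted γ r b t φ c ^ p ∂(catalystLaw d ρ) ≠ ∞ := by
  obtain ⟨C, hC, h⟩ := exists_lintegral_prod_weight_le (d := d) ρ p γ b t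
  rw [lintegral_tilted_pow]
  refine ne_top_of_le_ne_top hC ?_
  calc _ ≤ ∫⁻ _, C ∂(Measure.pi fun _ : Fin p => walkLaw d) := by
        refine lintegral_mono fun W => ?_
        calc _ ≤ 1 * C := by
              gcongr
              · exact Finset.prod_le_one' fun q _ => hφ _
              · exact h _ fun q => measurable_walk_path r (W q)
          _ = C := one_mul C
    _ = C := by simp

/-! ### Cauchy-Schwarz inequality for moments -/

/-- The `p`-th moment of the Feynman-Kac expectation for the difference of two independent
processes `A` and `B`, restricted to the event that the marks `α` and `β` coincide. -/
def pairMoment (ρ : ℝ≥0) (p : ℕ) (γ t : ℝ) (A B : WalkData d → ℝ → Site d)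
    (α β : WalkData d → Site d) : ℝ≥0∞ :=
  ∫⁻ c, (∫⁻ w, ∫⁻ w', weight γ 0 t (fun s => A w s - B w' s) c *
    (if α w = β w' then 1 else 0) ∂(walkLaw d) ∂(walkLaw d)) ^ p ∂(catalystLaw d ρ)

lemma pairMoment_eq (ρ : ℝ≥0) (p : ℕ) (γ t : ℝ) {A B : WalkData d → ℝ → Site d}
    {α β : WalkData d → Site d} (hA : Measurable fun v : WalkData d × ℝ => A v.1 v.2)
    (hB : Measurable fun v : WalkData d × ℝ => B v.1 v.2) (hα : Measurable α) (hβ : Measurable β) :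
    pairMoment ρ p γ t A B α β = ∫⁻ W, ∫⁻ W', (∫⁻ c, ∏ q, weight γ 0 t
      (fun s => A (W q) s - B (W' q) s) c ∂(catalystLaw d ρ)) *
        ∏ q, (if α (W q) = β (W' q) then 1 else 0)
        ∂(Measure.pi fun _ : Fin p => walkLaw d) ∂(Measure.pi fun _ : Fin p => walkLaw d) := by
  set P := Measure.pi fun _ : Fin p => walkLaw d
  have hm : ∀ {ι : Type} [MeasurableSpace ι] {f g : ι → WalkData d} {h : ι → CatalystData d},
      Measurable f → Measurable g → Measurable h → Measurable fun z : ι =>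
        weight γ 0 t (fun s => A (f z) s - B (g z) s) (h z) *
          (if α (f z) = β (g z) then (1 : ℝ≥0∞) else 0) := by
    intro ι _ f g h hf hg hh
    refine (Measurable.weight_comp γ 0 t (f := fun z s => A (f z) s - B (g z) s) ?_ hh).mul
      (Measurable.ite (measurableSet_eq_fun (hα.comp hf) (hβ.comp hg))
        measurable_const measurable_const)
    exact (hA.comp ((hf.comp measurable_fst).prodMk measurable_snd)).sub
      (hB.comp ((hg.comp measurable_fst).prodMk measurable_snd))
  have h1 : ∀ c, (∫⁻ w, ∫⁻ w', weight γ 0 t (fun s => A w s - B w' s) c *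
      (if α w = β w' then 1 else 0) ∂(walkLaw d) ∂(walkLaw d)) ^ p =
      ∫⁻ V : (Fin p → WalkData d) × (Fin p → WalkData d),
        ∏ q, (weight γ 0 t (fun s => A (V.1 q) s - B (V.2 q) s) c *
          (if α (V.1 q) = β (V.2 q) then 1 else 0)) ∂(P.prod P) := by
    intro c
    have hmc : Measurable fun z : WalkData d × WalkData d =>
        weight γ 0 t (fun s => A z.1 s - B z.2 s) c * (if α z.1 = β z.2 then (1 : ℝ≥0∞) else 0) :=
      hm measurable_fst measurable_snd measurable_const
    rw [lintegral_pow_eq _ _ hmc.lintegral_prod_right', lintegral_prod _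
      (Measurable.aemeasurable (Finset.measurable_prod _ fun q _ =>
        hm (by fun_prop) (by fun_prop) measurable_const))]
    refine lintegral_congr fun W => ?_
    exact (lintegral_pi_prod (walkLaw d) fun q =>
      hm measurable_const measurable_id measurable_const).symm
  rw [pairMoment]
  simp_rw [h1]
  have hbig : Measurable fun z : CatalystData d × ((Fin p → WalkData d) × (Fin p → WalkData d)) =>
      ∏ q, (weight γ 0 t (fun s => A (z.2.1 q) s - B (z.2.2 q) s) z.1 *
        (if α (z.2.1 q) = β (z.2.2 q) then (1 : ℝ≥0∞) else 0)) :=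
    Finset.measurable_prod _ fun q _ => hm (by fun_prop) (by fun_prop) measurable_fst
  rw [lintegral_lintegral_swap hbig.aemeasurable, lintegral_prod _
    hbig.lintegral_prod_left'.aemeasurable]
  refine lintegral_congr fun W => lintegral_congr fun W' => ?_
  have hw : ∀ q, Measurable fun c => weight γ 0 t (fun s => A (W q) s - B (W' q) s) c := fun q =>
    measurable_weight_right γ 0 t ((hA.comp (measurable_prodMk_left (x := W q))).sub
      (hB.comp (measurable_prodMk_left (x := W' q))))
  have hw' : Measurable fun c => ∏ q, weight γ 0 t (fun s => A (W q) s - B (W' q) s) c :=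
    Finset.measurable_prod _ fun q _ => hw q
  refine Eq.trans (lintegral_congr fun c => ?_) (lintegral_mul_const
    (∏ q, (if α (W q) = β (W' q) then (1 : ℝ≥0∞) else 0)) hw')
  exact Finset.prod_mul_distrib

/-- Cauchy-Schwarz inequality for moments of differences of independent processes. -/
lemma pairMoment_sq_le (ρ : ℝ≥0) (p : ℕ) (γ t : ℝ) {A B : WalkData d → ℝ → Site d}
    {α β : WalkData d → Site d} (hA : Measurable fun v : WalkData d × ℝ => A v.1 v.2)
    (hB : Measurable fun v : WalkData d × ℝ => B v.1 v.2) (hα : Measurable α) (hβ : Measurable β) :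
    pairMoment ρ p γ t A B α β ^ 2 ≤
      pairMoment ρ p γ t A A α α * pairMoment ρ p γ t B B β β := by
  set P := Measure.pi fun _ : Fin p => walkLaw d
  -- Both processes live on one space; the Boolean tells which of them is meant.
  set x : Bool × (Fin p → WalkData d) → Fin p → ℝ → Site d := fun v q s =>
    if v.1 = true then A (v.2 q) s else B (v.2 q) s with hx
  set m : Bool × (Fin p → WalkData d) → Fin p → Site d := fun v q =>
    if v.1 = true then α (v.2 q) else β (v.2 q) with hm
  have hxm : ∀ q, Measurable fun v : (Bool × (Fin p → WalkData d)) × ℝ => x v.1 q v.2 := by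
    intro q
    have h2 : Measurable fun v : (Bool × (Fin p → WalkData d)) × ℝ => (v.1.2 q, v.2) := by fun_prop
    exact Measurable.ite (measurableSet_eq_fun (by fun_prop) measurable_const)
      (hA.comp h2) (hB.comp h2)
  have hmm : ∀ q, Measurable fun v : Bool × (Fin p → WalkData d) => m v q := by
    intro q
    have h2 : Measurable fun v : Bool × (Fin p → WalkData d) => v.2 q := by fun_prop
    exact Measurable.ite (measurableSet_eq_fun (by fun_prop) measurable_const)
      (hα.comp h2) (hβ.comp h2)
  have hmark : IsCompletelyPositive fun a b : Bool × (Fin p → WalkData d) =>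
      ∏ q, (if m a q = m b q then (1 : ℝ≥0∞) else 0) := by
    refine IsCompletelyPositive.of_lintegral (Measure.count : Measure (Fin p → Site d))
      (fun a z => if ∀ q, m a q = z q then 1 else 0) ?_ fun a b => ?_
    · refine Measurable.ite ?_ measurable_const measurable_const
      rw [Set.ofPred_forall]
      exact MeasurableSet.iInter fun q =>
        measurableSet_eq_fun ((hmm q).comp measurable_fst) (by fun_prop)
    · rw [lintegral_count, tsum_eq_single (m a)]
      · simp only [implies_true, if_true, one_mul]
        split_ifs with h
        · exact Finset.prod_eq_one fun q _ => if_pos (h q).symm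
        · push Not at h
          obtain ⟨q, hq⟩ := h
          exact Finset.prod_eq_zero (Finset.mem_univ q) (if_neg (Ne.symm hq))
      · intro z hz
        have : ¬ ∀ q, m a q = z q := fun h => hz (funext fun q => (h q).symm)
        simp [this]
  have hcp := (isCompletelyPositive_moment ρ γ t hxm).mul hmark
  have hemb : ∀ e : Bool, MeasurableEmbedding (Prod.mk e : (Fin p → WalkData d) → _) := fun e =>
    measurableEmbedding_prodMk_left e
  have key := hcp.lintegral_sq_le (P.map (Prod.mk true)) (P.map (Prod.mk false))
  simp only [(hemb _).lintegral_map] at key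
  rw [pairMoment_eq ρ p γ t hA hB hα hβ, pairMoment_eq ρ p γ t hA hA hα hα,
    pairMoment_eq ρ p γ t hB hB hβ hβ]
  simpa [hx, hm] using key

end

section

variable {d : ℕ}

attribute [local irreducible] walk catalyst

/-! ### Comparison of moments for different jump rates -/

/-- Jensen's inequality for a mixture of functions with uniformly bounded `p`-th moments. -/
lemma lintegral_mixture_pow_le {Ω C : Type*} [MeasurableSpace Ω] [MeasurableSpace C]
    (μ : Measure Ω) [SigmaFinite μ] (P : Measure C) [SFinite P] {p : ℕ} (hp : p ≠ 0)
    {ψ : Ω → ℝ≥0∞} (hψ : Measurable ψ) {F : Ω → C → ℝ≥0∞}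
    (hF : Measurable fun z : Ω × C => F z.1 z.2) {V : ℝ≥0∞} (hV : ∀ w, ∫⁻ c, F w c ^ p ∂P ≤ V) :
    ∫⁻ c, (∫⁻ w, ψ w * F w c ∂μ) ^ p ∂P ≤ (∫⁻ w, ψ w ∂μ) ^ p * V := by
  have hFm : ∀ w, Measurable (F w) := fun w => hF.comp (measurable_prodMk_left (x := w))
  have h1 : ∀ c, (∫⁻ w, ψ w * F w c ∂μ) ^ p =
      ∫⁻ W, ∏ q, (ψ (W q) * F (W q) c) ∂(Measure.pi fun _ : Fin p => μ) := fun c =>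
    lintegral_pow_eq μ p (hψ.mul (hF.comp (measurable_prodMk_right (y := c))))
  simp_rw [h1]
  have hbig : Measurable fun z : C × (Fin p → Ω) => ∏ q, (ψ (z.2 q) * F (z.2 q) z.1) := by
    refine Finset.measurable_prod _ fun q _ => ?_
    have e1 : Measurable fun z : C × (Fin p → Ω) => z.2 q := by fun_prop
    exact (hψ.comp e1).mul (hF.comp (e1.prodMk measurable_fst))
  have hψm : Measurable fun W : Fin p → Ω => ∏ q, ψ (W q) :=
    Finset.measurable_prod _ fun q _ => hψ.comp (measurable_pi_apply q)
  rw [lintegral_lintegral_swap hbig.aemeasurable, lintegral_pow_eq μ p hψ,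
    ← lintegral_mul_const V hψm]
  refine lintegral_mono fun W => ?_
  simp_rw [Finset.prod_mul_distrib]
  have hm : Measurable fun c => ∏ q, F (W q) c := Finset.measurable_prod _ fun q _ => hFm _
  rw [lintegral_const_mul _ hm]
  gcongr
  have hp0 : (p : ℝ) ≠ 0 := by exact_mod_cast hp
  have e : ∀ c, ∏ q, F (W q) c = ∏ q : Fin p, (F (W q) c ^ p) ^ (1 / (p : ℝ)) := by
    intro c
    refine Finset.prod_congr rfl fun q _ => ?_
    rw [← ENNReal.rpow_natCast, ← ENNReal.rpow_mul, mul_one_div_cancel hp0, ENNReal.rpow_one]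
  simp_rw [e]
  refine (ENNReal.lintegral_prod_norm_pow_le Finset.univ (f := fun q c => F (W q) c ^ p)
    (fun q _ => ((hFm (W q)).pow_const p).aemeasurable) (p := fun _ => 1 / (p : ℝ))
    (by simp [hp0]) fun _ _ => by positivity).trans ?_
  calc ∏ q : Fin p, (∫⁻ c, F (W q) c ^ p ∂P) ^ (1 / (p : ℝ))
      ≤ ∏ _q : Fin p, V ^ (1 / (p : ℝ)) := by
        gcongr with q
        exact hV _
    _ = V := by
        rw [Finset.prod_const, Finset.card_univ, Fintype.card_fin, ← ENNReal.rpow_natCast,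
          ← ENNReal.rpow_mul, one_div_mul_cancel hp0, ENNReal.rpow_one]

lemma measurable_walk_sub (r : ℝ) {η : ℝ → Site d} (hη : Measurable η) :
    Measurable fun v : WalkData d × ℝ => walk r v.1 v.2 - η v.2 :=
  (Measurable.walk_comp r measurable_fst measurable_snd).sub (hη.comp measurable_snd)

lemma measurable_weight_sub (γ r r' t : ℝ) (c : CatalystData d) :
    Measurable fun z : WalkData d × WalkData d =>
      weight γ 0 t (fun s => walk r z.1 s - walk r' z.2 s) c :=
  Measurable.weight_comp γ 0 t (f := fun (z : WalkData d × WalkData d) s =>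
      walk r z.1 s - walk r' z.2 s)
    ((Measurable.walk_comp r (by fun_prop) measurable_snd).sub
      (Measurable.walk_comp r' (by fun_prop) measurable_snd)) measurable_const

lemma Regular.jumpCount_mono {w : WalkData d} (hw : Regular w) {s t : ℝ} (hs : 0 ≤ s)
    (hst : s ≤ t) : jumpCount w s ≤ jumpCount w t :=
  (hw.le_jumpCount_iff (hs.trans hst) _).2
    (((hw.le_jumpCount_iff hs _).1 le_rfl).trans hst)

lemma weight_congr {γ b t : ℝ} {x y : ℝ → Site d} (h : ∀ s ∈ Set.Icc 0 t, x s = y s)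
    (c : CatalystData d) : weight γ b t x c = weight γ b t y c := by
  rw [weight, weight]
  congr 2
  exact setLIntegral_congr_fun measurableSet_Icc fun s hs => by simp only [h s hs]

lemma le_of_sq_le_sq {a b : ℝ≥0∞} (h : a ^ 2 ≤ b ^ 2) : a ≤ b :=
  le_of_not_gt fun hab => (ENNReal.pow_lt_pow_left two_ne_zero hab).not_ge h

variable [NeZero d]

/-- The `p`-th moment of the Feynman-Kac expectation with final weight `φ`. -/
def moment (ρ : ℝ≥0) (p : ℕ) (γ r t : ℝ) (φ : Site d → ℝ≥0∞) : ℝ≥0∞ :=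
  ∫⁻ c, tilted γ r 0 t φ c ^ p ∂(catalystLaw d ρ)

/-- The final weight which pins the reactant at the site `x`. -/
def pin (x : Site d) : Site d → ℝ≥0∞ := fun z => if z = x then 1 else 0

lemma moment_ne_top (ρ : ℝ≥0) (p : ℕ) (γ r t : ℝ) {φ : Site d → ℝ≥0∞}
    (hφ : ∀ x, φ x ≤ 1) : moment ρ p γ r t φ ≠ ∞ :=
  lintegral_tilted_pow_ne_top ρ p γ r 0 t hφ

lemma moment_mono (ρ : ℝ≥0) (p : ℕ) (γ r t : ℝ) {φ ψ : Site d → ℝ≥0∞}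
    (h : ∀ x, φ x ≤ ψ x) : moment ρ p γ r t φ ≤ moment ρ p γ r t ψ := by
  unfold moment tilted
  gcongr
  exact h _

lemma one_le_moment_one (ρ : ℝ≥0) (p : ℕ) (γ r t : ℝ) :
    1 ≤ moment (d := d) ρ p γ r t fun _ => 1 := by
  have h1 : ∀ c : CatalystData d, 1 ≤ tilted γ r 0 t (fun _ => 1) c := fun c => by
    calc (1 : ℝ≥0∞) = ∫⁻ _, 1 ∂(walkLaw d) := by simp
      _ ≤ _ := lintegral_mono fun w => by rw [mul_one]; exact one_le_weight _ _ _ _ _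
  calc (1 : ℝ≥0∞) = ∫⁻ _, 1 ∂(catalystLaw d ρ) := by simp
    _ ≤ _ := lintegral_mono fun c => one_le_pow₀ (h1 c)

lemma tilted_add {r₁ r₂ : ℝ} (h₁ : 0 ≤ r₁) (h₂ : 0 ≤ r₂) (γ b : ℝ) {t : ℝ} (ht : 0 ≤ t)
    (φ : Site d → ℝ≥0∞) (c : CatalystData d) :
    tilted γ (r₁ + r₂) b t φ c =
      ∫⁻ w, ∫⁻ w', weight γ b t (fun s => walk r₁ w s - walk r₂ w' s) c *
        φ (walk r₁ w t - walk r₂ w' t) ∂(walkLaw d) ∂(walkLaw d) := by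
  have := lintegral_weight_add h₁ h₂ γ b ht (η := fun _ => (0 : Site d)) measurable_const φ c
  simpa only [sub_zero, tilted] using this

lemma pairMoment_walk {r₁ r₂ : ℝ} (h₁ : 0 ≤ r₁) (h₂ : 0 ≤ r₂) (ρ : ℝ≥0) (p : ℕ) (γ : ℝ)
    {t : ℝ} (ht : 0 ≤ t) :
    pairMoment (d := d) ρ p γ t (walk r₁) (walk r₂) (fun _ => 0) (fun _ => 0) =
      moment (d := d) ρ p γ (r₁ + r₂) t fun _ => 1 := by
  simp only [moment, pairMoment, tilted_add h₁ h₂ γ 0 ht, if_true]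

/-- Midpoint log-convexity of the moments in the jump rate. -/
lemma moment_sq_le {r₁ r₂ : ℝ} (h₁ : 0 ≤ r₁) (h₂ : 0 ≤ r₂) (ρ : ℝ≥0) (p : ℕ) (γ : ℝ)
    {t : ℝ} (ht : 0 ≤ t) :
    moment (d := d) ρ p γ (r₁ + r₂) t (fun _ => 1) ^ 2 ≤
      moment (d := d) ρ p γ (r₁ + r₁) t (fun _ => 1) *
        moment (d := d) ρ p γ (r₂ + r₂) t (fun _ => 1) := by
  rw [← pairMoment_walk h₁ h₂ ρ p γ ht, ← pairMoment_walk h₁ h₁ ρ p γ ht,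
    ← pairMoment_walk h₂ h₂ ρ p γ ht]
  exact pairMoment_sq_le ρ p γ t (measurable_walk _) (measurable_walk _)
    measurable_const measurable_const

/-- Among all ways to pin the end point, returning to the origin has the largest moment. -/
lemma moment_pin_le {r : ℝ} (hr : 0 ≤ r) (ρ : ℝ≥0) (p : ℕ) (γ : ℝ) {t : ℝ} (ht : 0 ≤ t)
    (x : Site d) : moment ρ p γ r t (pin x) ≤ moment (d := d) ρ p γ r t (pin 0) := by
  have hr2 : 0 ≤ r / 2 := by positivity
  have hw : Measurable fun w : WalkData d => walk (r / 2) w t :=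
    Measurable.walk_comp _ measurable_id measurable_const
  have e : ∀ x y : Site d, pairMoment (d := d) ρ p γ t (walk (r / 2)) (walk (r / 2))
      (fun w => walk (r / 2) w t - x) (fun w => walk (r / 2) w t - y) =
      moment (d := d) ρ p γ r t (pin (x - y)) := by
    intro x y
    rw [moment, pairMoment]
    conv_rhs => rw [← add_halves r]
    simp only [tilted_add hr2 hr2 γ 0 ht, pin]
    simp only [sub_eq_sub_iff_sub_eq_sub (b := x) (d := y)]
  have h := pairMoment_sq_le ρ p γ t (measurable_walk (d := d) (r / 2)) (measurable_walk (r / 2))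
    (hw.sub_const x) (hw.sub_const 0)
  rw [e, e, e, sub_zero, sub_self, sub_self, ← sq] at h
  exact le_of_sq_le_sq h

/-- Subtracting a deterministic path from the reactant cannot increase the moments. -/
lemma lintegral_shifted_pow_le {r : ℝ} (hr : 0 ≤ r) (ρ : ℝ≥0) (p : ℕ) (γ : ℝ) {t : ℝ}
    (ht : 0 ≤ t) {η : ℝ → Site d} (hη : Measurable η) :
    ∫⁻ c, (∫⁻ w, weight γ 0 t (fun s => walk r w s - η s) c ∂(walkLaw d)) ^ p ∂(catalystLaw d ρ) ≤
      moment (d := d) ρ p γ r t fun _ => 1 := by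
  have hr2 : 0 ≤ r / 2 := by positivity
  have h := pairMoment_sq_le ρ p γ t (A := fun w s => walk (r / 2) w s - η s)
    (measurable_walk_sub (d := d) (r / 2) hη)
    (measurable_walk (r / 2)) (α := fun _ => 0) (β := fun _ => 0) measurable_const measurable_const
  have e : pairMoment ρ p γ t (fun w s => walk (r / 2) w s - η s)
      (fun w s => walk (r / 2) w s - η s) (fun _ => 0) (fun _ => 0) = moment (d := d) ρ p γ r t fun _ => 1 := by
    conv_rhs => rw [← add_halves r, ← pairMoment_walk hr2 hr2 ρ p γ ht]
    simp only [pairMoment, sub_sub_sub_cancel_right]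
  rw [e, pairMoment_walk hr2 hr2 ρ p γ ht, add_halves, ← sq] at h
  refine le_trans (le_of_eq ?_) (le_of_sq_le_sq h)
  rw [pairMoment]
  refine lintegral_congr fun c => ?_
  have h2 := lintegral_weight_add hr2 hr2 γ 0 ht hη (fun _ => 1) c
  simp only [add_halves, mul_one] at h2
  simp only [h2, if_true, mul_one, sub_right_comm]

/-- The randomised version of the previous bound: the subtracted path is an independent walk,
weighted by `ψ`. -/
lemma lintegral_weighted_pow_le {r r' : ℝ} (hr : 0 ≤ r) (ρ : ℝ≥0) {p : ℕ} (hp : p ≠ 0) (γ : ℝ)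
    {t : ℝ} (ht : 0 ≤ t) {ψ : WalkData d → ℝ≥0∞} (hψ : Measurable ψ) :
    ∫⁻ c, (∫⁻ w', ψ w' * ∫⁻ w, weight γ 0 t (fun s => walk r w s - walk r' w' s) c ∂(walkLaw d)
      ∂(walkLaw d)) ^ p ∂(catalystLaw d ρ) ≤
      (∫⁻ w', ψ w' ∂(walkLaw d)) ^ p * moment (d := d) ρ p γ r t fun _ => 1 := by
  refine lintegral_mixture_pow_le (walkLaw d) (catalystLaw d ρ) hp hψ
    (F := fun w' c => ∫⁻ w, weight γ 0 t (fun s => walk r w s - walk r' w' s) c ∂(walkLaw d)) ?_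
    fun w' => lintegral_shifted_pow_le hr ρ p γ ht (measurable_walk_path r' w')
  have : Measurable fun z : (WalkData d × CatalystData d) × WalkData d =>
      weight γ 0 t (fun s => walk r z.2 s - walk r' z.1.1 s) z.1.2 :=
    Measurable.weight_comp γ 0 t (f := fun (z : (WalkData d × CatalystData d) × WalkData d) s =>
        walk r z.2 s - walk r' z.1.1 s)
      ((Measurable.walk_comp r (by fun_prop) measurable_snd).sub
        (Measurable.walk_comp r' (by fun_prop) measurable_snd)) (by fun_prop)
  exact this.lintegral_prod_right'

/-- The moments decrease with the jump rate. -/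
lemma moment_add_le {r r' : ℝ} (hr : 0 ≤ r) (hr' : 0 ≤ r') (ρ : ℝ≥0) {p : ℕ} (hp : p ≠ 0) (γ : ℝ)
    {t : ℝ} (ht : 0 ≤ t) : moment (d := d) ρ p γ (r + r') t (fun _ => 1) ≤
      moment (d := d) ρ p γ r t fun _ => 1 := by
  have h := lintegral_weighted_pow_le (d := d) (r := r) (r' := r') hr ρ hp γ ht
    (ψ := fun _ => 1) measurable_const
  simp only [lintegral_const, measure_univ, mul_one, one_pow, one_mul] at h
  refine le_trans (le_of_eq ?_) h
  rw [moment]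
  refine lintegral_congr fun c => ?_
  rw [tilted_add hr hr' γ 0 ht]
  simp only [mul_one]
  rw [lintegral_lintegral_swap (measurable_weight_sub γ r r' t c).aemeasurable]

/-- Increasing the jump rate by `r'` costs at most the probability that the additional jumps do
not occur. -/
lemma le_moment_add {r r' : ℝ} (hr : 0 ≤ r) (hr' : 0 ≤ r') (ρ : ℝ≥0) (p : ℕ) (γ : ℝ)
    {t : ℝ} (ht : 0 ≤ t) (φ : Site d → ℝ≥0∞) :
    ENNReal.ofReal (Real.exp (-(r' * t))) ^ p * moment ρ p γ r t φ ≤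
      moment ρ p γ (r + r') t φ := by
  have hrt : 0 ≤ r' * t := by positivity
  set J := {w : WalkData d | jumpCount w (r' * t) = 0} with hJ
  have hJm : MeasurableSet J := measurable_jumpCount_right _ (MeasurableSet.singleton 0)
  have hc : ∀ c, ENNReal.ofReal (Real.exp (-(r' * t))) * tilted γ r 0 t φ c ≤
      tilted γ (r + r') 0 t φ c := by
    intro c
    rw [tilted_add hr hr' γ 0 ht, mul_comm, tilted,
      ← lintegral_mul_const' _ _ ENNReal.ofReal_ne_top]
    refine lintegral_mono fun w => ?_
    calc weight γ 0 t (walk r w) c * φ (walk r w t) * ENNReal.ofReal (Real.exp (-(r' * t)))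
        ≤ weight γ 0 t (walk r w) c * φ (walk r w t) * walkLaw d J := by
          gcongr
          exact exp_neg_le_jumpCount_zero hrt
      _ = ∫⁻ w', J.indicator (fun _ => weight γ 0 t (walk r w) c * φ (walk r w t)) w'
            ∂(walkLaw d) := by
          rw [lintegral_indicator_const hJm]
      _ ≤ _ := by
          refine lintegral_mono_ae ?_
          filter_upwards [ae_regular (d := d)] with w' hw'
          by_cases hj : w' ∈ J
          · rw [Set.indicator_of_mem hj]
            have hz : ∀ s ∈ Set.Icc 0 t, walk r' w' s = 0 := by
              intro s hs
              have h0 : jumpCount w' (r' * s) = 0 := by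
                have := hw'.jumpCount_mono (mul_nonneg hr' hs.1)
                  (mul_le_mul_of_nonneg_left hs.2 hr')
                rw [hJ, Set.mem_ofPred_eq] at hj
                omega
              rw [walk_eq_pos, pos, h0, Finset.sum_range_zero]
            rw [hz t ⟨ht, le_rfl⟩, sub_zero]
            gcongr
            refine (weight_congr (fun s hs => ?_) c).le
            rw [hz s hs, sub_zero]
          · rw [Set.indicator_of_notMem hj]
            exact zero_le
  rw [moment, moment, ← lintegral_const_mul' _ _ (ENNReal.pow_ne_top ENNReal.ofReal_ne_top)]
  refine lintegral_mono fun c => ?_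
  rw [← mul_pow]
  gcongr
  exact hc c

end

section

variable {d : ℕ}

attribute [local irreducible] walk catalyst

/-! ### Pinning the end point costs a polynomial factor only -/

lemma abs_pos_apply_le (w : WalkData d) (t : ℝ) (i : Fin d) : |pos w t i| ≤ jumpCount w t := by
  rw [pos, Finset.sum_apply]
  calc |∑ j ∈ Finset.range (jumpCount w t), (w j).2.vec i|
      ≤ ∑ j ∈ Finset.range (jumpCount w t), |(w j).2.vec i| := Finset.abs_sum_le_sum_abs _ _
    _ ≤ ∑ _j ∈ Finset.range (jumpCount w t), 1 := by
        refine Finset.sum_le_sum fun j _ => ?_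
        rw [Dir.vec, Pi.single_apply]
        split_ifs <;> simp
    _ = jumpCount w t := by simp

/-- The sites all of whose coordinates are at most `n` in absolute value. -/
def box (d n : ℕ) : Finset (Site d) := Fintype.piFinset fun _ => Finset.Icc (-(n : ℤ)) n

lemma card_box (d n : ℕ) : (box d n).card = (2 * n + 1) ^ d := by
  rw [box, Fintype.card_piFinset]
  simp only [Int.card_Icc, Finset.prod_const, Finset.card_univ, Fintype.card_fin]
  congr 1
  omega

/-- The difference of two walks either lies in a box or one of the walks has jumped often. -/
lemma one_le_sum_pin_add {R : ℕ} (w w' : WalkData d) (r t : ℝ) :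
    (1 : ℝ≥0∞) ≤ ∑ x ∈ box d (2 * R), (if walk r w t - walk r w' t = x then 1 else 0) +
      (if R < jumpCount w (r * t) then 1 else 0) + (if R < jumpCount w' (r * t) then 1 else 0) := by
  by_cases h1 : R < jumpCount w (r * t)
  · rw [if_pos h1]; exact le_add_right le_add_self
  by_cases h2 : R < jumpCount w' (r * t)
  · rw [if_pos h2]; exact le_add_self
  refine le_add_right (le_add_right ?_)
  have hmem : walk r w t - walk r w' t ∈ box d (2 * R) := by
    rw [box, Fintype.mem_piFinset]
    intro i
    have e1 := abs_le.1 (abs_pos_apply_le w (r * t) i)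
    have e2 := abs_le.1 (abs_pos_apply_le w' (r * t) i)
    rw [walk_eq_pos, walk_eq_pos, Finset.mem_Icc, Pi.sub_apply]
    push_cast
    omega
  rw [Finset.sum_ite_eq, if_pos hmem]

lemma add_add_pow_le (a b c : ℝ≥0∞) (p : ℕ) :
    (a + b + c) ^ p ≤ 3 ^ p * (a ^ p + b ^ p + c ^ p) := by
  have h : ∃ m, a + b + c ≤ 3 * m ∧ m ^ p ≤ a ^ p + b ^ p + c ^ p := by
    have key : ∀ m, a ≤ m → b ≤ m → c ≤ m → a + b + c ≤ 3 * m := fun m ha hb hc => by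
      calc a + b + c ≤ m + m + m := by gcongr
        _ = 3 * m := by ring
    rcases le_total a b with hab | hab
    · rcases le_total b c with hbc | hbc
      · exact ⟨c, key c (hab.trans hbc) hbc le_rfl, le_add_self⟩
      · exact ⟨b, key b hab le_rfl hbc, le_add_right le_add_self⟩
    · rcases le_total a c with hac | hac
      · exact ⟨c, key c hac (hab.trans hac) le_rfl, le_add_self⟩
      · exact ⟨a, key a le_rfl hab hac, le_add_right (le_add_right le_rfl)⟩
  obtain ⟨m, h1, h2⟩ := h
  calc (a + b + c) ^ p ≤ (3 * m) ^ p := by gcongr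
    _ = 3 ^ p * m ^ p := mul_pow _ _ _
    _ ≤ _ := by gcongr

variable [NeZero d]

lemma lintegral_flip {g : WalkData d → ℝ≥0∞} (hg : Measurable g) :
    ∫⁻ w, g (flip w) ∂(walkLaw d) = ∫⁻ w, g w ∂(walkLaw d) := by
  conv_rhs => rw [← map_flip_walkLaw]
  rw [lintegral_map hg measurable_flip]

/-- By Jensen's inequality and the maximality of the return to the origin, the end point may be
pinned in a finite set at the cost of the cardinality of the set. -/
lemma lintegral_sum_pin_pow_le {r : ℝ} (hr : 0 ≤ r) (ρ : ℝ≥0) {p : ℕ} (hp : p ≠ 0) (γ : ℝ)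
    {t : ℝ} (ht : 0 ≤ t) (s : Finset (Site d)) :
    ∫⁻ c, (∑ x ∈ s, tilted γ r 0 t (pin x) c) ^ p ∂(catalystLaw d ρ) ≤
      s.card ^ p * moment (d := d) ρ p γ r t (pin 0) := by
  have h := lintegral_mixture_pow_le (Measure.count : Measure (Site d)) (catalystLaw d ρ) hp
    (ψ := fun x => if x ∈ s then 1 else 0) (measurable_of_countable _)
    (F := fun x c => tilted γ r 0 t (pin x) c)
    (measurable_from_prod_countable_right fun x => measurable_tilted γ r 0 t (pin x))
    (fun x => moment_pin_le hr ρ p γ ht x)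
  have e : ∀ f : Site d → ℝ≥0∞, ∑' x, (if x ∈ s then 1 else 0) * f x = ∑ x ∈ s, f x := by
    intro f
    rw [tsum_eq_sum (s := s) fun x hx => by rw [if_neg hx, zero_mul]]
    exact Finset.sum_congr rfl fun x hx => by rw [if_pos hx, one_mul]
  have e1 := e fun _ => 1
  simp only [mul_one, Finset.sum_const, nsmul_eq_mul] at e1
  simp only [lintegral_count, e, e1] at h
  exact h

/-- The moments are controlled by the pinned moments, up to the contribution of walks with many
jumps. -/
lemma moment_one_le_aux {r : ℝ} (hr : 0 ≤ r) (ρ : ℝ≥0) {p : ℕ} (hp : p ≠ 0) (γ : ℝ) {t : ℝ}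
    (ht : 0 ≤ t) (R : ℕ) :
    moment (d := d) ρ p γ (r + r) t (fun _ => 1) ≤
      3 ^ p * ((box d (2 * R)).card ^ p * moment (d := d) ρ p γ (r + r) t (pin 0) +
        2 * (walkLaw d {w | R < jumpCount w (r * t)} ^ p *
          moment (d := d) ρ p γ r t fun _ => 1)) := by
  have hset : MeasurableSet {w : WalkData d | R < jumpCount w (r * t)} :=
    measurableSet_lt measurable_const (measurable_jumpCount_right _)
  set ψ : WalkData d → ℝ≥0∞ := fun w => if R < jumpCount w (r * t) then 1 else 0 with hψdef
  have hψ : Measurable ψ := Measurable.ite hset measurable_const measurable_const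
  have hψtop : ∀ w, ψ w ≠ ∞ := fun w => by
    simp only [hψdef]; split_ifs <;> simp
  have hψint : ∫⁻ w, ψ w ∂(walkLaw d) = walkLaw d {w | R < jumpCount w (r * t)} := by
    rw [← lintegral_indicator_one hset]
    refine lintegral_congr fun w => ?_
    simp only [hψdef, Set.indicator, Set.mem_ofPred_eq, Pi.one_apply]
  set G : CatalystData d → ℝ≥0∞ := fun c => ∫⁻ w', ψ w' *
    ∫⁻ w, weight γ 0 t (fun s => walk r w s - walk r w' s) c ∂(walkLaw d) ∂(walkLaw d) with hG
  have hGm : ∫⁻ c, G c ^ p ∂(catalystLaw d ρ) ≤ walkLaw d {w | R < jumpCount w (r * t)} ^ p *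
      moment (d := d) ρ p γ r t fun _ => 1 := by
    rw [← hψint]
    exact lintegral_weighted_pow_le hr ρ hp γ ht hψ
  have hW := fun c => measurable_weight_sub (d := d) γ r r t c
  have hc : ∀ c, tilted γ (r + r) 0 t (fun _ => 1) c ≤
      ∑ x ∈ box d (2 * R), tilted γ (r + r) 0 t (pin x) c + G c + G c := by
    intro c
    have e1 : ∫⁻ w, ∫⁻ w', weight γ 0 t (fun s => walk r w s - walk r w' s) c * ψ w'
        ∂(walkLaw d) ∂(walkLaw d) = G c := by
      rw [lintegral_lintegral_swap ((hW c).mul (hψ.comp measurable_snd)).aemeasurable]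
      refine lintegral_congr fun w' => ?_
      rw [lintegral_mul_const' _ _ (hψtop w'), mul_comm]
    have e2 : ∫⁻ w, ∫⁻ w', weight γ 0 t (fun s => walk r w s - walk r w' s) c * ψ w
        ∂(walkLaw d) ∂(walkLaw d) = G c := by
      have hm2 : Measurable fun z : WalkData d × WalkData d =>
        weight γ 0 t (fun s => walk r z.1 s - walk r z.2 s) c * ψ z.1 :=
          (hW c).mul (hψ.comp measurable_fst)
      rw [← lintegral_flip hm2.lintegral_prod_right']
      refine lintegral_congr fun w => ?_
      refine (lintegral_flip (hm2.comp (measurable_prodMk_left (x := flip w)))).symm.trans ?_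
      have hflip : ∀ w s, walk r (flip w : WalkData d) s = -walk r w s := fun w s => by
        rw [walk_eq_pos, walk_eq_pos, pos_flip]
      have hψf : ψ (flip w) = ψ w := rfl
      simp only [Function.comp_apply, hflip, hψf, sub_neg_eq_add, neg_add_eq_sub]
      rw [lintegral_mul_const' _ _ (hψtop w), mul_comm]
    have e3 : ∑ x ∈ box d (2 * R), tilted γ (r + r) 0 t (pin x) c =
        ∫⁻ w, ∫⁻ w', weight γ 0 t (fun s => walk r w s - walk r w' s) c *
          ∑ x ∈ box d (2 * R), (if walk r w t - walk r w' t = x then 1 else 0)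
          ∂(walkLaw d) ∂(walkLaw d) := by
      have hx : ∀ x, Measurable fun z : WalkData d × WalkData d =>
          weight γ 0 t (fun s => walk r z.1 s - walk r z.2 s) c *
            (if walk r z.1 t - walk r z.2 t = x then 1 else 0) := fun x =>
        (hW c).mul (Measurable.apply_site (f := fun z : WalkData d × WalkData d =>
          walk r z.1 t - walk r z.2 t) ((Measurable.walk_comp r measurable_fst
            measurable_const).sub (Measurable.walk_comp r measurable_snd measurable_const)) (pin x))
      simp only [tilted_add hr hr γ 0 ht, pin, Finset.mul_sum]
      rw [← lintegral_finsetSum _ fun x _ => (hx x).lintegral_prod_right']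
      refine lintegral_congr fun w => ?_
      exact (lintegral_finsetSum _ fun x _ =>
        (hx x).comp (measurable_prodMk_left (x := w))).symm
    rw [tilted_add hr hr γ 0 ht, e3]
    nth_rewrite 1 [← e2]
    rw [← e1]
    have m1 : Measurable fun z : WalkData d × WalkData d =>
        weight γ 0 t (fun s => walk r z.1 s - walk r z.2 s) c * ψ z.1 :=
      (hW c).mul (hψ.comp measurable_fst)
    have m2 : Measurable fun z : WalkData d × WalkData d =>
        weight γ 0 t (fun s => walk r z.1 s - walk r z.2 s) c * ψ z.2 :=
      (hW c).mul (hψ.comp measurable_snd)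
    rw [← lintegral_add_right _ m1.lintegral_prod_right',
      ← lintegral_add_right _ m2.lintegral_prod_right']
    refine lintegral_mono fun w => ?_
    have m1' : Measurable fun w' => weight γ 0 t (fun s => walk r w s - walk r w' s) c * ψ w :=
      m1.comp (measurable_prodMk_left (x := w))
    have m2' : Measurable fun w' => weight γ 0 t (fun s => walk r w s - walk r w' s) c * ψ w' :=
      m2.comp (measurable_prodMk_left (x := w))
    rw [← lintegral_add_right _ m1', ← lintegral_add_right _ m2']
    refine lintegral_mono fun w' => ?_
    rw [← mul_add, ← mul_add]
    gcongr
    exact one_le_sum_pin_add w w' r t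
  have hS : Measurable fun c => ∑ x ∈ box d (2 * R), tilted γ (r + r) 0 t (pin x) c :=
    Finset.measurable_fun_sum _ fun x _ => measurable_tilted γ (r + r) 0 t (pin x)
  calc moment (d := d) ρ p γ (r + r) t (fun _ => 1)
      ≤ ∫⁻ c, 3 ^ p * ((∑ x ∈ box d (2 * R), tilted γ (r + r) 0 t (pin x) c) ^ p +
          2 * G c ^ p) ∂(catalystLaw d ρ) := by
        refine lintegral_mono fun c => ?_
        refine (pow_le_pow_left₀ zero_le (hc c) p).trans ((add_add_pow_le _ _ _ p).trans ?_)
        rw [add_assoc, two_mul (G c ^ p)]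
    _ = 3 ^ p * (∫⁻ c, (∑ x ∈ box d (2 * R), tilted γ (r + r) 0 t (pin x) c) ^ p
          ∂(catalystLaw d ρ) + 2 * ∫⁻ c, G c ^ p ∂(catalystLaw d ρ)) := by
        rw [lintegral_const_mul' _ _ (by simp), lintegral_add_left (hS.pow_const p),
          lintegral_const_mul' _ _ (by simp)]
    _ ≤ _ := by
        gcongr
        exact lintegral_sum_pin_pow_le (add_nonneg hr hr) ρ hp γ ht _

lemma walkLaw_lt_jumpCount_le {s : ℝ} (hs : 0 ≤ s) (R : ℕ) :
    walkLaw d {w | R < jumpCount w s} ≤ ENNReal.ofReal (Real.exp s) * 2⁻¹ ^ (R + 1) := by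
  refine le_trans (measure_mono_ae ?_) (walkLaw_arrival_le (R + 1) s)
  filter_upwards [ae_regular (d := d)] with w hw h
  exact (hw.le_jumpCount_iff hs (R + 1)).1 h

lemma exp_le_four_pow {x : ℝ} {n : ℕ} (h : x ≤ n) : Real.exp x ≤ 4 ^ n := by
  calc Real.exp x ≤ Real.exp n := Real.exp_le_exp.2 h
    _ = Real.exp 1 ^ n := by rw [← Real.exp_nat_mul, mul_one]
    _ ≤ 4 ^ n := by
        gcongr
        have := Real.exp_one_lt_d9
        linarith

/-- Pinning the end point of the reactant costs a factor polynomial in time. -/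
lemma moment_one_le_pin {r : ℝ} (hr : 0 ≤ r) (ρ : ℝ≥0) {p : ℕ} (hp : p ≠ 0) (γ : ℝ) {t : ℝ}
    (ht : 0 ≤ t) {n : ℕ} (hn : r * t ≤ n) :
    moment (d := d) ρ p γ r t (fun _ => 1) ≤
      2 * (3 * (8 * n + 13) ^ d) ^ p * moment (d := d) ρ p γ r t (pin 0) := by
  have hr2 : 0 ≤ r / 2 := by positivity
  have hrt : 0 ≤ r / 2 * t := by positivity
  set v := moment (d := d) ρ p γ r t fun _ => 1 with hv
  set v₀ := moment (d := d) ρ p γ r t (pin 0) with hv₀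
  set E := ENNReal.ofReal (Real.exp (r / 2 * t)) with hE
  have hE' : E * ENNReal.ofReal (Real.exp (-(r / 2 * t))) = 1 := by
    rw [hE, ← ENNReal.ofReal_mul (Real.exp_nonneg _), ← Real.exp_add, add_neg_cancel,
      Real.exp_zero, ENNReal.ofReal_one]
  -- The number of jumps allowed for each of the two walks: more jumps have so small a probability
  -- that the factor `exp (r * t)` from the comparison of jump rates does not matter.
  set R := 2 * n + 3 with hR
  have h1 := moment_one_le_aux (d := d) hr2 ρ hp γ ht R
  rw [add_halves, ← hv, ← hv₀] at h1
  have h2 : moment (d := d) ρ p γ (r / 2) t (fun _ => 1) ≤ E ^ p * v := by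
    have := le_moment_add (d := d) hr2 hr2 ρ p γ ht fun _ => 1
    rw [add_halves, ← hv] at this
    calc moment (d := d) ρ p γ (r / 2) t (fun _ => 1)
        = E ^ p * (ENNReal.ofReal (Real.exp (-(r / 2 * t))) ^ p *
            moment (d := d) ρ p γ (r / 2) t (fun _ => 1)) := by
          rw [← mul_assoc, ← mul_pow, hE', one_pow, one_mul]
      _ ≤ E ^ p * v := by gcongr
  have hsmall : 3 * (walkLaw d {w | R < jumpCount w (r / 2 * t)} * E) ≤ 4⁻¹ := by
    calc 3 * (walkLaw d {w | R < jumpCount w (r / 2 * t)} * E)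
        ≤ 3 * (E * 2⁻¹ ^ (R + 1) * E) := by
          gcongr
          exact walkLaw_lt_jumpCount_le hrt R
      _ = 3 * (ENNReal.ofReal (Real.exp (r * t)) * 2⁻¹ ^ (R + 1)) := by
          have : ENNReal.ofReal (Real.exp (r * t)) = E * E := by
            rw [hE, ← ENNReal.ofReal_mul (Real.exp_nonneg _), ← Real.exp_add]
            congr 2
            ring
          rw [this]
          ring
      _ ≤ 3 * (4 ^ n * 2⁻¹ ^ (R + 1)) := by
          gcongr
          refine (ENNReal.ofReal_le_ofReal (exp_le_four_pow hn)).trans (le_of_eq ?_)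
          rw [ENNReal.ofReal_pow (by norm_num)]
          norm_num
      _ ≤ 4⁻¹ := by
          have e : (2⁻¹ : ℝ≥0∞) ^ (R + 1) = 4⁻¹ ^ n * 16⁻¹ := by
            rw [hR, show 2 * n + 3 + 1 = 2 * n + 4 by ring, pow_add, pow_mul]
            congr 1
            · rw [← ENNReal.inv_pow]; norm_num
            · rw [← ENNReal.inv_pow]; norm_num
          rw [e, ← mul_assoc, ← mul_assoc, mul_assoc 3, ← mul_pow,
            ENNReal.mul_inv_cancel (by norm_num) (by norm_num), one_pow, mul_one]
          rw [← ENNReal.toReal_le_toReal (by finiteness) (by finiteness)]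
          norm_num
  have hhalf : 3 ^ p * (2 * (walkLaw d {w | R < jumpCount w (r / 2 * t)} ^ p *
      moment (d := d) ρ p γ (r / 2) t fun _ => 1)) ≤ 2⁻¹ * v := by
    calc _ ≤ 3 ^ p * (2 * (walkLaw d {w | R < jumpCount w (r / 2 * t)} ^ p * (E ^ p * v))) := by
          gcongr
      _ = (3 * (walkLaw d {w | R < jumpCount w (r / 2 * t)} * E)) ^ p * (2 * v) := by
          rw [mul_pow, mul_pow]; ring
      _ ≤ 4⁻¹ * (2 * v) := by
          gcongr
          calc _ ≤ (4⁻¹ : ℝ≥0∞) ^ p := by gcongr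
            _ ≤ 4⁻¹ ^ 1 := pow_le_pow_right_of_le_one' (by norm_num) (by omega)
            _ = 4⁻¹ := pow_one _
      _ = 2⁻¹ * v := by
          rw [← mul_assoc]
          congr 1
          rw [← ENNReal.toReal_eq_toReal_iff' (by finiteness) (by finiteness)]
          norm_num
  have hvtop : v ≠ ∞ := moment_ne_top ρ p γ r t fun _ => le_rfl
  have h3 : v ≤ 3 ^ p * ((box d (2 * R)).card ^ p * v₀) + 2⁻¹ * v := by
    refine h1.trans ?_
    rw [mul_add]
    gcongr
  have hcard : ((box d (2 * R)).card : ℝ≥0∞) = (8 * n + 13) ^ d := by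
    rw [card_box, hR]
    push_cast
    congr 1
    ring
  have h4 : v = 2⁻¹ * v + 2⁻¹ * v := by
    rw [← add_mul, ENNReal.inv_two_add_inv_two, one_mul]
  have h5 : 2⁻¹ * v ≤ 3 ^ p * ((box d (2 * R)).card ^ p * v₀) := by
    have hfin : 2⁻¹ * v ≠ ∞ := ENNReal.mul_ne_top (by simp) hvtop
    refine (ENNReal.add_le_add_iff_right hfin).1 ?_
    rwa [← h4]
  calc v = 2 * (2⁻¹ * v) := by
        rw [← mul_assoc, ENNReal.mul_inv_cancel (by simp) (by simp), one_mul]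
    _ ≤ 2 * (3 ^ p * ((box d (2 * R)).card ^ p * v₀)) := by gcongr
    _ = _ := by rw [hcard, mul_pow]; ring

end

section

variable {d : ℕ}

attribute [local irreducible] walk catalyst

/-! ### Supermultiplicativity of the pinned moments -/

/-- The weight of a path dominates the product of the weights of its two pieces; the first piece
sees the later part of the catalyst. -/
lemma weight_mul_le (γ : ℝ) {t₁ t₂ : ℝ} (h₁ : 0 ≤ t₁) (h₂ : 0 ≤ t₂) (x : ℝ → Site d)
    (c : CatalystData d) :
    weight γ t₂ t₁ x c * weight γ 0 t₂ (fun u => x (t₁ + u)) c ≤ weight γ 0 (t₁ + t₂) x c := by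
  rw [weight, weight, weight, ← expE_add, ← mul_add]
  refine expE_mono ?_
  gcongr
  set f : ℝ → ℝ≥0∞ := fun s => (catalyst c (x s) (0 + (t₁ + t₂ - s)) : ℝ≥0∞) with hf
  have e1 : ∫⁻ s in Set.Icc 0 t₁, (catalyst c (x s) (t₂ + (t₁ - s)) : ℝ≥0∞) =
      ∫⁻ s in Set.Ico 0 t₁, f s := by
    rw [setLIntegral_congr Ico_ae_eq_Icc]
    refine setLIntegral_congr_fun measurableSet_Icc fun s _ => ?_
    rw [hf]
    simp only
    congr 2
    ring
  have e2 : ∫⁻ u in Set.Icc 0 t₂, (catalyst c (x (t₁ + u)) (0 + (t₂ - u)) : ℝ≥0∞) =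
      ∫⁻ s in Set.Icc t₁ (t₁ + t₂), f s := by
    rw [← (measurePreserving_add_left volume t₁).setLIntegral_comp_preimage_emb
      (measurableEmbedding_addLeft t₁) f, Set.preimage_const_add_Icc, sub_self,
      add_sub_cancel_left]
    refine setLIntegral_congr_fun measurableSet_Icc fun s _ => ?_
    rw [hf]
    simp only
    congr 2
    ring
  rw [e1, e2, ← lintegral_union measurableSet_Icc]
  · refine lintegral_mono_set ?_
    rintro s (hs | hs)
    · exact ⟨hs.1, hs.2.le.trans (by linarith)⟩
    · exact ⟨h₁.trans hs.1, hs.2⟩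
  · rw [Set.disjoint_left]
    intro s hs hs'
    exact absurd hs.2 (not_lt.2 hs'.1)

variable [NeZero d]

/-- Concatenating two loops of the reactant, for a fixed catalyst. -/
lemma tilted_mul_le {r : ℝ} (hr : 0 ≤ r) (γ : ℝ) {t₁ t₂ : ℝ} (h₁ : 0 ≤ t₁) (h₂ : 0 ≤ t₂)
    (c : CatalystData d) :
    tilted γ r t₂ t₁ (pin 0) c * tilted γ r 0 t₂ (pin 0) c ≤ tilted γ r 0 (t₁ + t₂) (pin 0) c := by
  have hs : 0 ≤ r * t₁ := mul_nonneg hr h₁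
  -- Any waiting time longer than `r * t₁` will do to freeze the walk.
  set b : ℝ × Dir d := (r * t₁ + 1, default) with hb
  have hb1 : r * t₁ < b.1 := by simp [hb]
  set F : WalkData d → ℝ≥0∞ := fun w => weight γ t₂ t₁ (walk r w) c * pin 0 (walk r w t₁) with hF
  set G : WalkData d → ℝ≥0∞ := fun w => weight γ 0 t₂ (walk r w) c * pin 0 (walk r w t₂) with hG
  have hFm : Measurable F :=
    measurable_tilted_integrand γ r t₂ t₁ (pin 0) measurable_id measurable_const
  have hGm : Measurable G :=
    measurable_tilted_integrand γ r 0 t₂ (pin 0) measurable_id measurable_const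
  have hfreeze : ∀ᵐ w ∂(walkLaw d), F (freeze b (r * t₁) w) = F w := by
    filter_upwards [ae_regular (d := d)] with w hw
    have h : ∀ s ∈ Set.Icc 0 t₁, walk r (freeze b (r * t₁) w) s = walk r w s := fun s hs' => by
      rw [walk_eq_pos, walk_eq_pos]
      exact hw.pos_freeze (mul_nonneg hr hs'.1) (mul_le_mul_of_nonneg_left hs'.2 hr) hb1
    simp only [hF]
    rw [weight_congr h c, h t₁ ⟨h₁, le_rfl⟩]
  have hm := markov (d := d) b hs (h := fun z => F z.1 * G z.2)
    ((hFm.comp measurable_fst).mul (hGm.comp measurable_snd))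
  have e1 : tilted γ r t₂ t₁ (pin 0) c * tilted γ r 0 t₂ (pin 0) c =
      ∫⁻ w, F (freeze b (r * t₁) w) * G (shift (r * t₁) w) ∂(walkLaw d) := by
    rw [hm, tilted, tilted, ← lintegral_mul_const _ hFm]
    refine lintegral_congr_ae ?_
    filter_upwards [hfreeze] with w hw
    rw [hw, lintegral_const_mul _ hGm]
  rw [e1]
  refine lintegral_mono_ae ?_
  filter_upwards [hfreeze, ae_regular (d := d)] with w hw hreg
  rw [hw]
  by_cases h0 : walk r w t₁ = 0
  · have hadd : ∀ u, 0 ≤ u → walk r (shift (r * t₁) w) u = walk r w (t₁ + u) := by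
      intro u hu
      rw [walk_eq_pos] at h0
      rw [walk_eq_pos, walk_eq_pos, mul_add, hreg.pos_add hs (mul_nonneg hr hu), h0, zero_add]
    have hw2 : weight γ 0 t₂ (walk r (shift (r * t₁) w)) c =
        weight γ 0 t₂ (fun u => walk r w (t₁ + u)) c :=
      weight_congr (fun s hs' => hadd s hs'.1) c
    simp only [hF, hG]
    rw [hw2, hadd t₂ h₂, h0, pin, if_pos rfl, mul_one, ← mul_assoc]
    gcongr
    exact weight_mul_le γ h₁ h₂ _ c
  · simp [hF, pin, h0]

/-- The moments of the two loops factorise from below, by positive correlations and stationarity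
of the catalyst. -/
lemma moment_pin_mul_le {r : ℝ} (hr : 0 ≤ r) (ρ : ℝ≥0) (p : ℕ) (γ : ℝ) {t₁ t₂ : ℝ} (h₁ : 0 ≤ t₁)
    (h₂ : 0 ≤ t₂) :
    moment (d := d) ρ p γ r t₁ (pin 0) * moment (d := d) ρ p γ r t₂ (pin 0) ≤
      moment (d := d) ρ p γ r (t₁ + t₂) (pin 0) := by
  set P := Measure.pi fun _ : Fin p => walkLaw d
  have hf : ∀ (b t : ℝ) {α : Type} [MeasurableSpace α] {f : α → Fin p → WalkData d}
      {g : α → CatalystData d}, Measurable f → Measurable g → Measurable fun a =>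
      ∏ q, (weight γ b t (walk r (f a q)) (g a) * pin 0 (walk r (f a q) t)) := by
    intro b t α _ f g hf hg
    exact Finset.measurable_prod _ fun q _ => measurable_tilted_integrand γ r b t (pin 0)
      ((measurable_pi_apply q).comp hf) hg
  have hpow : ∀ (b t : ℝ) (c : CatalystData d), tilted γ r b t (pin 0) c ^ p =
      ∫⁻ W, ∏ q, (weight γ b t (walk r (W q)) c * pin 0 (walk r (W q) t)) ∂P := fun b t c =>
    lintegral_pow_eq _ _ (measurable_tilted_integrand γ r b t (pin 0) measurable_id
      measurable_const)
  have hcorr : ∀ W W' : Fin p → WalkData d,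
      (∫⁻ c, ∏ q, (weight γ t₂ t₁ (walk r (W q)) c * pin 0 (walk r (W q) t₁)) ∂(catalystLaw d ρ)) *
        ∫⁻ c, ∏ q, (weight γ 0 t₂ (walk r (W' q)) c * pin 0 (walk r (W' q) t₂))
          ∂(catalystLaw d ρ) ≤
      ∫⁻ c, (∏ q, (weight γ t₂ t₁ (walk r (W q)) c * pin 0 (walk r (W q) t₁))) *
        ∏ q, (weight γ 0 t₂ (walk r (W' q)) c * pin 0 (walk r (W' q) t₂)) ∂(catalystLaw d ρ) := by
    intro W W'
    have htop : ∀ (t : ℝ) (V : Fin p → WalkData d), ∏ q, pin 0 (walk r (V q) t) ≠ ∞ := by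
      intro t V
      refine ne_top_of_le_ne_top ENNReal.one_ne_top (Finset.prod_le_one' fun q _ => ?_)
      rw [pin]; split_ifs <;> simp
    have hocc : ∀ (b t : ℝ) (V : Fin p → WalkData d) y,
        Measurable fun w => ∑ q, occ γ b t (walk r (V q)) y w := fun b t V y =>
      Finset.measurable_fun_sum _ fun q _ => measurable_occ_right γ b t
        (measurable_walk_path r (V q)) y
    simp_rw [Finset.prod_mul_distrib, prod_weight_eq γ _ _ fun q => measurable_walk_path r _]
    rw [lintegral_mul_const' _ _ (htop t₁ W), lintegral_mul_const' _ _ (htop t₂ W'),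
      mul_mul_mul_comm]
    conv_rhs => enter [2, c]; rw [mul_mul_mul_comm]
    rw [lintegral_mul_const' _ _ (ENNReal.mul_ne_top (htop t₁ W) (htop t₂ W'))]
    gcongr
    exact lintegral_expE_particleSum_mul_le ρ (hocc _ _ W) (hocc _ _ W')
  have hswap : ∀ b t : ℝ, ∫⁻ c, tilted γ r b t (pin 0) c ^ p ∂(catalystLaw d ρ) =
      ∫⁻ W, ∫⁻ c, ∏ q, (weight γ b t (walk r (W q)) c * pin 0 (walk r (W q) t))
        ∂(catalystLaw d ρ) ∂P := by
    intro b t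
    simp_rw [hpow]
    exact lintegral_lintegral_swap
      (hf b t (f := fun z : CatalystData d × (Fin p → WalkData d) => z.2) measurable_snd
        measurable_fst).aemeasurable
  calc moment (d := d) ρ p γ r t₁ (pin 0) * moment (d := d) ρ p γ r t₂ (pin 0)
      = (∫⁻ c, tilted γ r t₂ t₁ (pin 0) c ^ p ∂(catalystLaw d ρ)) *
          ∫⁻ c, tilted γ r 0 t₂ (pin 0) c ^ p ∂(catalystLaw d ρ) := by
        rw [lintegral_tilted_pow_shift ρ p γ r t₁ h₂]; rfl
    _ = ∫⁻ W, ∫⁻ W', (∫⁻ c, ∏ q, (weight γ t₂ t₁ (walk r (W q)) c * pin 0 (walk r (W q) t₁))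
          ∂(catalystLaw d ρ)) * ∫⁻ c, ∏ q, (weight γ 0 t₂ (walk r (W' q)) c *
            pin 0 (walk r (W' q) t₂)) ∂(catalystLaw d ρ) ∂P ∂P := by
        have hm : ∀ b t : ℝ, Measurable fun W : Fin p → WalkData d => ∫⁻ c,
            ∏ q, (weight γ b t (walk r (W q)) c * pin 0 (walk r (W q) t)) ∂(catalystLaw d ρ) :=
          fun b t => (hf b t (f := fun z : (Fin p → WalkData d) × CatalystData d => z.1)
            measurable_fst measurable_snd).lintegral_prod_right'
        rw [hswap, hswap, ← lintegral_mul_const _ (hm t₂ t₁)]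
        refine lintegral_congr fun W => ?_
        rw [lintegral_const_mul _ (hm 0 t₂)]
    _ ≤ ∫⁻ W, ∫⁻ W', ∫⁻ c, (∏ q, (weight γ t₂ t₁ (walk r (W q)) c * pin 0 (walk r (W q) t₁))) *
          ∏ q, (weight γ 0 t₂ (walk r (W' q)) c * pin 0 (walk r (W' q) t₂)) ∂(catalystLaw d ρ)
            ∂P ∂P := lintegral_mono fun W => lintegral_mono fun W' => hcorr W W'
    _ = ∫⁻ c, tilted γ r t₂ t₁ (pin 0) c ^ p * tilted γ r 0 t₂ (pin 0) c ^ p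
          ∂(catalystLaw d ρ) := by
        have m3 : Measurable fun z : CatalystData d × ((Fin p → WalkData d) ×
            (Fin p → WalkData d)) =>
            (∏ q, (weight γ t₂ t₁ (walk r (z.2.1 q)) z.1 * pin 0 (walk r (z.2.1 q) t₁))) *
            ∏ q, (weight γ 0 t₂ (walk r (z.2.2 q)) z.1 * pin 0 (walk r (z.2.2 q) t₂)) :=
          (hf t₂ t₁ (f := fun z : CatalystData d × ((Fin p → WalkData d) ×
            (Fin p → WalkData d)) => z.2.1) (by fun_prop) measurable_fst).mul
          (hf 0 t₂ (f := fun z : CatalystData d × ((Fin p → WalkData d) ×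
            (Fin p → WalkData d)) => z.2.2) (by fun_prop) measurable_fst)
        rw [← lintegral_prod (μ := P) (ν := P) (fun z => ∫⁻ c, (∏ q, (weight γ t₂ t₁
          (walk r (z.1 q)) c * pin 0 (walk r (z.1 q) t₁))) * ∏ q, (weight γ 0 t₂
            (walk r (z.2 q)) c * pin 0 (walk r (z.2 q) t₂)) ∂(catalystLaw d ρ)) m3.lintegral_prod_left'.aemeasurable,
          ← lintegral_lintegral_swap m3.aemeasurable]
        refine lintegral_congr fun c => ?_
        have mc : ∀ b t : ℝ, Measurable fun W : Fin p → WalkData d =>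
            ∏ q, (weight γ b t (walk r (W q)) c * pin 0 (walk r (W q) t)) := fun b t =>
          hf b t (f := fun W => W) measurable_id measurable_const
        rw [hpow, hpow, lintegral_prod_mul (mc t₂ t₁).aemeasurable (mc 0 t₂).aemeasurable]
    _ ≤ _ := by
        refine lintegral_mono fun c => ?_
        rw [← mul_pow]
        exact pow_le_pow_left₀ zero_le (tilted_mul_le hr γ h₁ h₂ c) p

end

section

/-! ### Superadditive and midpoint convex functions -/

/-- Fekete's lemma for a nonnegative superadditive function on the half-line; the limit may be
infinite. -/
lemma exists_tendsto_div_of_superadditive {g : ℝ → ℝ} (hg : ∀ t, 0 ≤ t → 0 ≤ g t)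
    (hadd : ∀ s t, 0 ≤ s → 0 ≤ t → g s + g t ≤ g (s + t)) :
    ∃ ℓ : EReal, Tendsto (fun t => ((g t / t : ℝ) : EReal)) atTop (𝓝 ℓ) := by
  refine ⟨⨆ t ∈ Set.Ioi (0 : ℝ), ((g t / t : ℝ) : EReal), tendsto_order.2 ⟨fun a ha => ?_,
    fun a ha => ?_⟩⟩
  · obtain ⟨s, hs⟩ := lt_iSup_iff.1 ha
    obtain ⟨hs0, hs⟩ := lt_iSup_iff.1 hs
    have hs0' : 0 < s := hs0
    have hmul : ∀ n : ℕ, n * g s ≤ g (n * s) := by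
      intro n
      induction n with
      | zero => simpa using hg 0 le_rfl
      | succ n ih =>
        have := hadd (n * s) s (by positivity) hs0'.le
        push_cast
        rw [add_mul, add_mul, one_mul, one_mul]
        linarith
    have hlow : ∀ t, 0 < t → g s / s - g s / t ≤ g t / t := by
      intro t ht
      have h1 : (⌊t / s⌋₊ : ℝ) ≤ t / s := Nat.floor_le (by positivity)
      have h2 : t / s < ⌊t / s⌋₊ + 1 := Nat.lt_floor_add_one _
      have h3 : (⌊t / s⌋₊ : ℝ) * s ≤ t := by rwa [le_div_iff₀ hs0'] at h1
      have h4 := hadd (⌊t / s⌋₊ * s) (t - ⌊t / s⌋₊ * s) (by positivity) (by linarith)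
      rw [add_sub_cancel] at h4
      have h5 : (t / s - 1) * g s ≤ g t := by
        have := hg (t - ⌊t / s⌋₊ * s) (by linarith)
        have := hmul ⌊t / s⌋₊
        have : (t / s - 1) * g s ≤ ⌊t / s⌋₊ * g s :=
          mul_le_mul_of_nonneg_right (by linarith) (hg s hs0'.le)
        linarith
      rw [le_div_iff₀ ht]
      calc (g s / s - g s / t) * t = (t / s - 1) * g s := by field_simp
        _ ≤ g t := h5
    have hlim : Tendsto (fun t : ℝ => ((g s / s - g s / t : ℝ) : EReal)) atTop
        (𝓝 ((g s / s : ℝ) : EReal)) := by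
      rw [EReal.tendsto_coe]
      have := (tendsto_const_nhds (x := g s)).div_atTop (tendsto_id (α := ℝ))
      simpa using (tendsto_const_nhds (x := g s / s)).sub this
    filter_upwards [hlim.eventually (lt_mem_nhds hs), eventually_gt_atTop 0] with t ht ht0
    exact ht.trans_le (EReal.coe_le_coe_iff.2 (hlow t ht0))
  · filter_upwards [eventually_gt_atTop 0] with t ht
    exact lt_of_le_of_lt (le_iSup₂ (f := fun t (_ : t ∈ Set.Ioi (0 : ℝ)) =>
      ((g t / t : ℝ) : EReal)) t ht) ha

/-- A continuous midpoint convex function is convex. -/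
lemma convexOn_of_midpoint {s : Set ℝ} (hs : Convex ℝ s) {f : ℝ → ℝ} (hf : ContinuousOn f s)
    (hmid : ∀ x ∈ s, ∀ y ∈ s, f ((x + y) / 2) ≤ (f x + f y) / 2) : ConvexOn ℝ s f := by
  refine ⟨hs, fun x hx y hy a b ha hb hab => ?_⟩
  -- The defect `h` from linear interpolation vanishes at the end points and is midpoint convex,
  -- so that its first maximiser has to be an end point.
  set ℓ : ℝ → ℝ := fun u => (1 - u) * x + u * y with hℓ
  have hmem : ∀ u ∈ Set.Icc (0 : ℝ) 1, ℓ u ∈ s := fun u hu =>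
    hs hx hy (by linarith [hu.2]) hu.1 (by ring)
  set h : ℝ → ℝ := fun u => f (ℓ u) - ((1 - u) * f x + u * f y) with hh
  have hcont : ContinuousOn h (Set.Icc 0 1) := by
    refine ContinuousOn.sub (hf.comp (by fun_prop) hmem) (by fun_prop)
  have hmidh : ∀ u ∈ Set.Icc (0 : ℝ) 1, ∀ v ∈ Set.Icc (0 : ℝ) 1,
      h ((u + v) / 2) ≤ (h u + h v) / 2 := by
    intro u hu v hv
    have := hmid (ℓ u) (hmem u hu) (ℓ v) (hmem v hv)
    have e : ℓ ((u + v) / 2) = (ℓ u + ℓ v) / 2 := by simp only [hℓ]; ring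
    simp only [hh, e]
    linarith
  have h0 : h 0 = 0 := by simp [hh, hℓ]
  have h1 : h 1 = 0 := by simp [hh, hℓ]
  have key : ∀ u ∈ Set.Icc (0 : ℝ) 1, h u ≤ 0 := by
    obtain ⟨m, hm, hmax⟩ := isCompact_Icc.exists_isMaxOn (Set.nonempty_Icc.2 zero_le_one) hcont
    intro u hu
    refine (hmax hu).trans ?_
    by_contra! hpos
    have hK : IsCompact (Set.Icc (0 : ℝ) 1 ∩ h ⁻¹' {h m}) :=
      isCompact_Icc.of_isClosed_subset (hcont.preimage_isClosed_of_isClosed isClosed_Icc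
        isClosed_singleton) Set.inter_subset_left
    obtain ⟨z, ⟨hz, hzm⟩, hzmin⟩ := hK.exists_isLeast ⟨m, hm, rfl⟩
    have hzm' : h z = h m := hzm
    have hz0 : 0 < z := by
      rcases hz.1.eq_or_lt with h' | h'
      · rw [← h', h0] at hzm'; linarith
      · exact h'
    have hz1 : z < 1 := by
      rcases hz.2.eq_or_lt with h' | h'
      · rw [h', h1] at hzm'; linarith
      · exact h'
    set δ := min z (1 - z) with hδ
    have hδ0 : 0 < δ := lt_min hz0 (by linarith)
    have hδ1 : δ ≤ z := min_le_left _ _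
    have hδ2 : δ ≤ 1 - z := min_le_right _ _
    have hl : z - δ ∈ Set.Icc (0 : ℝ) 1 := ⟨by linarith, by linarith⟩
    have hr : z + δ ∈ Set.Icc (0 : ℝ) 1 := ⟨by linarith, by linarith⟩
    have hlt : h (z - δ) < h m := by
      refine lt_of_le_of_ne (hmax hl) fun e => ?_
      have := hzmin ⟨hl, e⟩
      linarith
    have hle : h (z + δ) ≤ h m := hmax hr
    have := hmidh _ hl _ hr
    rw [show (z - δ + (z + δ)) / 2 = z by ring, hzm'] at this
    linarith
  have := key b ⟨hb, by linarith⟩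
  have ha' : a = 1 - b := by linarith
  simp only [hh, hℓ] at this
  simp only [smul_eq_mul, ha']
  linarith

/-! ### The Lyapunov exponents -/

attribute [local irreducible] walk catalyst

variable {d : ℕ}

lemma pin_le_one (x z : Site d) : pin x z ≤ 1 := by
  rw [pin]; split_ifs <;> simp

variable [NeZero d]

/-- The logarithm of the `p`-th moment of the solution at the origin, for jump rate `2dκ`. -/
def logMoment (d : ℕ) [NeZero d] (ρ : ℝ≥0) (γ : ℝ) (p : ℕ) (κ t : ℝ) : ℝ :=
  Real.log (moment (d := d) ρ p γ (2 * d * κ) t fun _ => 1).toReal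

lemma moment_toReal_pos (ρ : ℝ≥0) (γ : ℝ) (p : ℕ) (r t : ℝ) :
    0 < (moment (d := d) ρ p γ r t fun _ => 1).toReal :=
  ENNReal.toReal_pos (zero_lt_one.trans_le (one_le_moment_one ρ p γ r t)).ne'
    (moment_ne_top ρ p γ r t fun _ => le_rfl)

lemma logMoment_nonneg (ρ : ℝ≥0) (γ : ℝ) (p : ℕ) (κ t : ℝ) : 0 ≤ logMoment d ρ γ p κ t := by
  refine Real.log_nonneg ?_
  rw [← ENNReal.toReal_one]
  exact ENNReal.toReal_mono (moment_ne_top ρ p γ _ t fun _ => le_rfl) (one_le_moment_one ρ p γ _ t)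

lemma momentRate_eq (ρ : ℝ≥0) (γ : ℝ) (p : ℕ) (κ t : ℝ) :
    momentRate d ρ γ p κ t = ((logMoment d ρ γ p κ t / (t * p) : ℝ) : EReal) := by
  have e : ∫⁻ c, reactant κ γ c 0 t ^ p ∂(catalystLaw d ρ) =
      moment (d := d) ρ p γ (2 * d * κ) t fun _ => 1 := by
    simp only [reactant_eq_tilted, moment]
  rw [momentRate, e, ENNReal.log_rpow, ENNReal.log_pos_real' (moment_toReal_pos ρ γ p _ t),
    logMoment, ← EReal.coe_mul, ← EReal.coe_mul]
  congr 1
  rw [div_eq_mul_inv _ (t * p), mul_inv]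
  ring

lemma logMoment_antitone (ρ : ℝ≥0) (γ : ℝ) {p : ℕ} (hp : p ≠ 0) {κ κ' t : ℝ} (hκ : 0 ≤ κ)
    (h : κ ≤ κ') (ht : 0 ≤ t) : logMoment d ρ γ p κ' t ≤ logMoment d ρ γ p κ t := by
  refine Real.log_le_log (moment_toReal_pos ρ γ p _ t) (ENNReal.toReal_mono
    (moment_ne_top ρ p γ _ t fun _ => le_rfl) ?_)
  have := moment_add_le (d := d) (r := 2 * d * κ) (r' := 2 * d * (κ' - κ)) (by positivity)
    (mul_nonneg (by positivity) (by linarith)) ρ hp γ ht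
  rwa [← mul_add, add_sub_cancel] at this

lemma le_logMoment (ρ : ℝ≥0) (γ : ℝ) (p : ℕ) {κ κ' t : ℝ} (hκ : 0 ≤ κ) (h : κ ≤ κ')
    (ht : 0 ≤ t) :
    logMoment d ρ γ p κ t - 2 * d * (κ' - κ) * (t * p) ≤ logMoment d ρ γ p κ' t := by
  have := le_moment_add (d := d) (r := 2 * d * κ) (r' := 2 * d * (κ' - κ)) (by positivity)
    (mul_nonneg (by positivity) (by linarith)) ρ p γ ht fun _ => 1
  rw [← mul_add, add_sub_cancel] at this
  have h2 := ENNReal.toReal_mono (moment_ne_top ρ p γ _ t fun _ => le_rfl) this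
  rw [ENNReal.toReal_mul, ENNReal.toReal_pow, ENNReal.toReal_ofReal (Real.exp_nonneg _),
    ← Real.exp_nat_mul] at h2
  have h3 := Real.log_le_log (mul_pos (Real.exp_pos _) (moment_toReal_pos ρ γ p _ t)) h2
  rw [Real.log_mul (Real.exp_ne_zero _) (moment_toReal_pos ρ γ p _ t).ne', Real.log_exp] at h3
  unfold logMoment
  linarith

lemma logMoment_midpoint_le (ρ : ℝ≥0) (γ : ℝ) (p : ℕ) {κ κ' t : ℝ} (hκ : 0 ≤ κ) (hκ' : 0 ≤ κ')
    (ht : 0 ≤ t) : logMoment d ρ γ p ((κ + κ') / 2) t ≤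
      (logMoment d ρ γ p κ t + logMoment d ρ γ p κ' t) / 2 := by
  have h := moment_sq_le (d := d) (r₁ := d * κ) (r₂ := d * κ') (by positivity) (by positivity)
    ρ p γ ht
  rw [show (d : ℝ) * κ + d * κ' = 2 * d * ((κ + κ') / 2) by ring,
    show (d : ℝ) * κ + d * κ = 2 * d * κ by ring,
    show (d : ℝ) * κ' + d * κ' = 2 * d * κ' by ring] at h
  have h2 := ENNReal.toReal_mono (ENNReal.mul_ne_top (moment_ne_top ρ p γ _ t fun _ => le_rfl)
    (moment_ne_top ρ p γ _ t fun _ => le_rfl)) h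
  rw [ENNReal.toReal_mul, ENNReal.toReal_pow] at h2
  have h3 := Real.log_le_log (pow_pos (moment_toReal_pos ρ γ p _ t) 2) h2
  rw [Real.log_pow, Real.log_mul (moment_toReal_pos ρ γ p _ t).ne'
    (moment_toReal_pos ρ γ p _ t).ne'] at h3
  unfold logMoment
  push_cast at h3
  linarith

/-- A lower bound on the pinned moments, from a reactant which does not move. -/
lemma exp_le_moment_pin {r : ℝ} (hr : 0 ≤ r) (ρ : ℝ≥0) (p : ℕ) (γ : ℝ) {t : ℝ} (ht : 0 ≤ t) :
    ENNReal.ofReal (Real.exp (-(r * t))) ^ p ≤ moment (d := d) ρ p γ r t (pin 0) := by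
  have h0 : 1 ≤ moment (d := d) ρ p γ 0 t (pin 0) := by
    have h1 : ∀ c : CatalystData d, 1 ≤ tilted γ 0 0 t (pin 0) c := fun c => by
      calc (1 : ℝ≥0∞) = ∫⁻ _, 1 ∂(walkLaw d) := by simp
        _ ≤ _ := by
          refine lintegral_mono_ae ?_
          filter_upwards [ae_regular (d := d)] with w hw
          rw [walk_eq_pos, zero_mul, hw.pos_zero, pin, if_pos rfl, mul_one]
          exact one_le_weight _ _ _ _ _
    calc (1 : ℝ≥0∞) = ∫⁻ _, 1 ∂(catalystLaw d ρ) := by simp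
      _ ≤ _ := lintegral_mono fun c => one_le_pow₀ (h1 c)
  have := le_moment_add (d := d) le_rfl hr ρ p γ ht (pin 0)
  rw [zero_add] at this
  calc ENNReal.ofReal (Real.exp (-(r * t))) ^ p
      = ENNReal.ofReal (Real.exp (-(r * t))) ^ p * 1 := (mul_one _).symm
    _ ≤ ENNReal.ofReal (Real.exp (-(r * t))) ^ p * moment (d := d) ρ p γ 0 t (pin 0) := by gcongr
    _ ≤ _ := this

lemma moment_pin_toReal_pos {r : ℝ} (hr : 0 ≤ r) (ρ : ℝ≥0) (p : ℕ) (γ : ℝ) {t : ℝ}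
    (ht : 0 ≤ t) : 0 < (moment (d := d) ρ p γ r t (pin 0)).toReal :=
  ENNReal.toReal_pos (ne_of_gt (lt_of_lt_of_le (ENNReal.pow_pos
    (ENNReal.ofReal_pos.2 (Real.exp_pos _)) p) (exp_le_moment_pin hr ρ p γ ht)))
    (moment_ne_top ρ p γ r t (pin_le_one 0))

/-- The moments and the pinned moments have the same exponential growth rate. -/
lemma tendsto_log_moment_sub {r : ℝ} (hr : 0 ≤ r) (ρ : ℝ≥0) (γ : ℝ) {p : ℕ} (hp : p ≠ 0) :
    Tendsto (fun t : ℝ => (Real.log (moment (d := d) ρ p γ r t fun _ => 1).toReal -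
      Real.log (moment (d := d) ρ p γ r t (pin 0)).toReal) / t) atTop (𝓝 0) := by
  have hpos := fun t => moment_pin_toReal_pos (d := d) hr ρ p γ (t := t)
  have hub : ∀ t, 1 ≤ t → Real.log (moment (d := d) ρ p γ r t fun _ => 1).toReal -
      Real.log (moment (d := d) ρ p γ r t (pin 0)).toReal ≤
      Real.log 2 + p * (Real.log 3 + d * (Real.log (8 * r + 21) + Real.log t)) := by
    intro t ht1
    have ht : 0 ≤ t := zero_le_one.trans ht1
    have hn : r * t ≤ ⌈r * t⌉₊ := Nat.le_ceil _
    have hn' : (⌈r * t⌉₊ : ℝ) < r * t + 1 := Nat.ceil_lt_add_one (by positivity)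
    have h := moment_one_le_pin (d := d) hr ρ hp γ ht hn
    have h2 := ENNReal.toReal_mono (ENNReal.mul_ne_top (by finiteness)
      (moment_ne_top ρ p γ r t (pin_le_one 0))) h
    have e : (2 * (3 * (8 * (⌈r * t⌉₊ : ℝ≥0∞) + 13) ^ d) ^ p).toReal =
        2 * (3 * (8 * (⌈r * t⌉₊ : ℝ) + 13) ^ d) ^ p := by
      have : (8 * (⌈r * t⌉₊ : ℝ≥0∞) + 13).toReal = 8 * (⌈r * t⌉₊ : ℝ) + 13 := by
        rw [ENNReal.toReal_add (by finiteness) (by finiteness)]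
        simp
      simp [ENNReal.toReal_mul, ENNReal.toReal_pow, this]
    rw [ENNReal.toReal_mul, e] at h2
    have h3 := Real.log_le_log (moment_toReal_pos ρ γ p r t) h2
    have hb : (0 : ℝ) < 8 * (⌈r * t⌉₊ : ℝ) + 13 := by positivity
    rw [Real.log_mul (by positivity) (hpos t ht).ne', Real.log_mul (by positivity) (by positivity),
      Real.log_pow, Real.log_mul (by positivity) (by positivity), Real.log_pow] at h3
    have h4 : Real.log (8 * (⌈r * t⌉₊ : ℝ) + 13) ≤ Real.log (8 * r + 21) + Real.log t := by
      rw [← Real.log_mul (by positivity) (by positivity)]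
      exact Real.log_le_log hb (by linarith)
    have h5 : (p : ℝ) * (Real.log 3 + d * Real.log (8 * (⌈r * t⌉₊ : ℝ) + 13)) ≤
        p * (Real.log 3 + d * (Real.log (8 * r + 21) + Real.log t)) := by gcongr
    linarith
  have hlim : Tendsto (fun t : ℝ => (Real.log 2 + p * (Real.log 3 + d *
      (Real.log (8 * r + 21) + Real.log t))) / t) atTop (𝓝 0) := by
    have hc : ∀ a : ℝ, Tendsto (fun t : ℝ => a / t) atTop (𝓝 0) := fun a =>
      tendsto_const_nhds.div_atTop tendsto_id
    have hlog : Tendsto (fun t : ℝ => (Real.log (8 * r + 21) + Real.log t) / t) atTop (𝓝 0) := by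
      simp_rw [add_div]
      simpa using (hc _).add Real.isLittleO_log_id_atTop.tendsto_div_nhds_zero
    have := (hc (Real.log 2)).add (((hc (Real.log 3)).add (hlog.const_mul (d : ℝ))).const_mul
      (p : ℝ))
    simp only [mul_zero, add_zero] at this
    refine this.congr fun t => ?_
    ring
  refine tendsto_of_tendsto_of_tendsto_of_le_of_le' tendsto_const_nhds hlim ?_ ?_
  · filter_upwards [eventually_ge_atTop 0] with t ht
    refine div_nonneg (sub_nonneg.2 (Real.log_le_log (hpos t ht) (ENNReal.toReal_mono
      (moment_ne_top ρ p γ r t fun _ => le_rfl) (moment_mono ρ p γ r t (pin_le_one 0))))) ht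
  · filter_upwards [eventually_ge_atTop 1] with t ht
    exact div_le_div_of_nonneg_right (hub t ht) (zero_le_one.trans ht)

/-- The Lyapunov exponents exist as limits. -/
lemma tendsto_momentRate (ρ : ℝ≥0) (γ : ℝ) {p : ℕ} (hp : p ≠ 0) {κ : ℝ} (hκ : 0 ≤ κ) :
    Tendsto (momentRate d ρ γ p κ) atTop (𝓝 (lyapunov d ρ γ p κ)) := by
  suffices h : ∃ ℓ, Tendsto (momentRate d ρ γ p κ) atTop (𝓝 ℓ) by
    obtain ⟨ℓ, hℓ⟩ := h
    rwa [lyapunov, hℓ.limUnder_eq]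
  set r : ℝ := 2 * d * κ with hr_def
  have hr : 0 ≤ r := by positivity
  have hp0 : (0 : ℝ) < p := by exact_mod_cast Nat.pos_of_ne_zero hp
  have hpos := fun t => moment_pin_toReal_pos (d := d) hr ρ p γ (t := t)
  -- The linear term makes the superadditive function nonnegative.
  set g : ℝ → ℝ := fun t =>
    Real.log (moment (d := d) ρ p γ r t (pin 0)).toReal / p + r * t with hg
  obtain ⟨ℓ, hℓ⟩ := exists_tendsto_div_of_superadditive (g := g) (fun t ht => by
      have h := ENNReal.toReal_mono (moment_ne_top ρ p γ r t (pin_le_one (d := d) 0))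
        (exp_le_moment_pin hr ρ p γ ht)
      rw [ENNReal.toReal_pow, ENNReal.toReal_ofReal (Real.exp_nonneg _), ← Real.exp_nat_mul] at h
      have h2 := Real.log_le_log (Real.exp_pos _) h
      rw [Real.log_exp] at h2
      have h3 : -(r * t) ≤ Real.log (moment (d := d) ρ p γ r t (pin 0)).toReal / p := by
        rw [le_div_iff₀ hp0]; linarith
      simp only [hg]; linarith)
    (fun s t hs ht => by
      have h := ENNReal.toReal_mono (moment_ne_top ρ p γ r (s + t) (pin_le_one (d := d) 0))
        (moment_pin_mul_le hr ρ p γ hs ht)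
      rw [ENNReal.toReal_mul] at h
      have h2 := Real.log_le_log (mul_pos (hpos s hs) (hpos t ht)) h
      rw [Real.log_mul (hpos s hs).ne' (hpos t ht).ne'] at h2
      have h3 := div_le_div_of_nonneg_right h2 hp0.le
      rw [add_div] at h3
      simp only [hg]; linarith)
  have hc : Tendsto (fun t => (((Real.log (moment (d := d) ρ p γ r t fun _ => 1).toReal -
      Real.log (moment (d := d) ρ p γ r t (pin 0)).toReal) / t / p - r : ℝ) : EReal)) atTop
      (𝓝 ((-r : ℝ) : EReal)) := by
    rw [EReal.tendsto_coe]
    simpa using ((tendsto_log_moment_sub (d := d) hr ρ γ hp).div_const (p : ℝ)).sub_const r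
  refine ⟨(-r : ℝ) + ℓ, Tendsto.congr' ?_ ((EReal.continuousAt_add (p := (((-r : ℝ) : EReal), ℓ))
    (Or.inl (EReal.coe_ne_top _)) (Or.inl (EReal.coe_ne_bot _))).tendsto.comp
      (hc.prodMk_nhds hℓ))⟩
  filter_upwards [eventually_gt_atTop 0] with t ht
  rw [momentRate_eq, Function.comp_apply, ← EReal.coe_add, logMoment, ← hr_def]
  congr 1
  simp only [hg]
  field_simp
  ring

end

end PAM

end

theorem theorem2p1 (d : ℕ) [NeZero d] (ρ : NNReal) (hρ : 0 < ρ) (γ : ℝ) (hγ : 0 < γ)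
    (p : ℕ) (hp : 1 ≤ p) :
    (∀ κ : ℝ, 0 ≤ κ →
      Tendsto (PAM.momentRate d ρ γ p κ) atTop (𝓝 (PAM.lyapunov d ρ γ p κ))) ∧
    (PAM.lyapunov d ρ γ p 0 < ⊤ →
      (∀ κ : ℝ, 0 ≤ κ → PAM.lyapunov d ρ γ p κ ≠ ⊤ ∧ PAM.lyapunov d ρ γ p κ ≠ ⊥) ∧
      ContinuousOn (fun κ => (PAM.lyapunov d ρ γ p κ).toReal) (Set.Ici 0) ∧
      AntitoneOn (fun κ => (PAM.lyapunov d ρ γ p κ).toReal) (Set.Ici 0) ∧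
      ConvexOn ℝ (Set.Ici 0) (fun κ => (PAM.lyapunov d ρ γ p κ).toReal)) := by
  have hp' : p ≠ 0 := by omega
  have hp0 : (0 : ℝ) < p := by exact_mod_cast hp
  have hlim : ∀ κ : ℝ, 0 ≤ κ →
      Tendsto (PAM.momentRate d ρ γ p κ) atTop (𝓝 (PAM.lyapunov d ρ γ p κ)) :=
    fun κ hκ => PAM.tendsto_momentRate ρ γ hp' hκ
  refine ⟨hlim, fun hfin => ?_⟩
  have hne : ∀ κ : ℝ, 0 ≤ κ → PAM.lyapunov d ρ γ p κ ≠ ⊤ ∧ PAM.lyapunov d ρ γ p κ ≠ ⊥ := by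
    intro κ hκ
    constructor
    · refine ne_top_of_le_ne_top hfin.ne
        (le_of_tendsto_of_tendsto (hlim κ hκ) (hlim 0 le_rfl) ?_)
      filter_upwards [eventually_gt_atTop 0] with t ht
      rw [PAM.momentRate_eq, PAM.momentRate_eq, EReal.coe_le_coe_iff]
      exact div_le_div_of_nonneg_right (PAM.logMoment_antitone ρ γ hp' le_rfl hκ ht.le)
        (by positivity)
    · refine (lt_of_lt_of_le (EReal.bot_lt_coe 0) (ge_of_tendsto (hlim κ hκ) ?_)).ne'
      filter_upwards [eventually_gt_atTop 0] with t ht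
      rw [PAM.momentRate_eq, EReal.coe_le_coe_iff]
      exact div_nonneg (PAM.logMoment_nonneg ρ γ p κ t) (by positivity)
  set f : ℝ → ℝ := fun κ => (PAM.lyapunov d ρ γ p κ).toReal with hf
  have hreal : ∀ κ : ℝ, 0 ≤ κ →
      Tendsto (fun t => PAM.logMoment d ρ γ p κ t / (t * p)) atTop (𝓝 (f κ)) := by
    intro κ hκ
    rw [← EReal.tendsto_coe, hf, EReal.coe_toReal (hne κ hκ).1 (hne κ hκ).2]
    refine (hlim κ hκ).congr fun t => ?_
    rw [PAM.momentRate_eq]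
  have hanti : AntitoneOn f (Set.Ici 0) := by
    intro κ hκ κ' hκ' h
    refine le_of_tendsto_of_tendsto (hreal κ' hκ') (hreal κ hκ) ?_
    filter_upwards [eventually_gt_atTop 0] with t ht
    exact div_le_div_of_nonneg_right (PAM.logMoment_antitone ρ γ hp' hκ h ht.le) (by positivity)
  have hlip : ∀ κ κ' : ℝ, 0 ≤ κ → κ ≤ κ' → f κ - 2 * d * (κ' - κ) ≤ f κ' := by
    intro κ κ' hκ h
    refine le_of_tendsto_of_tendsto ((hreal κ hκ).sub_const _) (hreal κ' (hκ.trans h)) ?_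
    filter_upwards [eventually_gt_atTop 0] with t ht
    have htp : 0 < t * p := by positivity
    rw [le_div_iff₀ htp, sub_mul, div_mul_cancel₀ _ htp.ne']
    exact PAM.le_logMoment ρ γ p hκ h ht.le
  have hcont : ContinuousOn f (Set.Ici 0) := by
    have hK : LipschitzOnWith (2 * d : NNReal) f (Set.Ici 0) := by
      refine LipschitzOnWith.of_dist_le_mul fun κ hκ κ' hκ' => ?_
      rw [Real.dist_eq, Real.dist_eq]
      push_cast
      rcases le_total κ κ' with h | h
      · have h1 := hlip κ κ' hκ h
        have h2 := hanti hκ hκ' h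
        rw [abs_of_nonneg (by linarith), abs_of_nonpos (by linarith)]
        linarith
      · have h1 := hlip κ' κ hκ' h
        have h2 := hanti hκ' hκ h
        rw [abs_of_nonpos (by linarith), abs_of_nonneg (by linarith)]
        linarith
    exact hK.continuousOn
  refine ⟨hne, hcont, hanti, PAM.convexOn_of_midpoint (convex_Ici 0) hcont
    fun κ hκ κ' hκ' => ?_⟩
  have hκ0 : (0 : ℝ) ≤ κ := hκ
  have hκ0' : (0 : ℝ) ≤ κ' := hκ'
  refine le_of_tendsto_of_tendsto (hreal _ (by positivity))
    (((hreal κ hκ).add (hreal κ' hκ')).div_const 2) ?_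
  filter_upwards [eventually_gt_atTop 0] with t ht
  rw [← add_div, div_right_comm]
  exact div_le_div_of_nonneg_right (PAM.logMoment_midpoint_le ρ γ p hκ0 hκ0' ht.le)
    (by positivity)
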